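/- Let $d\ge 1$ be an integer, let $0<\alpha<2$, $\beta>0$ and $\mu,\nu\in(-1,1]$ with $\frac{\alpha}{2}<|\mu-\nu|<2-\frac{\alpha}{2}$ (that is, the argument in $(-\pi,\pi]$ of $e^{(\nu-\mu)\pi i}$ has absolute value greater than $\alpha\pi/2$). Let $E_{\alpha,\alpha}(z)=\sum_{k\ge 0} z^k/\Gamma(\alpha k+\alpha)$ be the Mittag-Leffler function, and for $t>0$ let $$W_{\alpha,\mu,\nu}(t,x)=\int_{\mathbb{R}^d}e^{2\pi i x\cdot\xi}\,E_{\alpha,\alpha}\!\left(e^{(\nu-\mu)\pi i}t^{\alpha}|\xi|^{\beta}\right)d\xi ,$$ that is, $W_{\alpha,\mu,\nu}(t,\cdot)$ is the inverse Fourier transform, in the sense of tempered distributions, of the bounded function $\xi\mapsto E_{\alpha,\alpha}(e^{(\nu-\mu)\pi i}t^{\alpha}|\xi|^{\beta})$. This distribution is a locally integrable function for every $t>0$. For $F:[0,\infty)\times\mathbb{R}^d\to\mathbb{C}$ let $$w(t,x)=e^{-\mu\pi i}\int_0^t (t-s)^{\alpha-1}\,\big(W_{\alpha,\mu,\nu}(t-s,\cdot)\ast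 F(s,\cdot)\big)(x)\,ds$$ be the Duhamel solution of the problem $e^{\mu\pi i}\partial_t^{\alpha}w=e^{\nu\pi i}(-\Delta)^{\beta/2}w+F$ on $(0,\infty)\times\mathbb{R}^d$, with $\partial_t^\alpha$ the Caputo derivative, and $w(0,\cdot)=0$. Suppose that $1\le r\le\infty$ and $r>\frac1\alpha$, and that $1\le p<q\le\infty$ satisfy $$\frac1p-\frac1q<\frac{\beta}{d}\left(1-\frac{1}{\alpha r}\right).$$ Then there is a constant $C$, depending only on $d,\alpha,\beta,\mu,\nu,p,q,r$, such that for every $F\in L^r([0,\infty);L^p(\mathbb{R}^d))$ and every $t>0$ the integrals that define $w(t,x)$ converge absolutely for almost every $x$ (the convolution integral for almost every $s\in(0,t)$, and then the integral in $s$), $w(t,\cdot)$ is measurable, and $$\|w(t,\cdot)\|_{L^q(\mathbb{R}^d)}\le C\,t^{\frac{\alpha}{\beta}d\left(\frac{\beta}{d}-\left(\frac1p-\frac1q\right)\right)-\frac1r}\,\|F\|_{L^r([0,\infty);L^p(\mathbb{R}^d))}.$$ -/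

import Mathlib

open MeasureTheory Set
open scoped ENNReal NNReal FourierTransform SchwartzMap

noncomputable section

namespace FracDuhamel

/-- The space `ℝ^d` with its Euclidean norm. -/
abbrev Space (d : ℕ) : Type := EuclideanSpace ℝ (Fin d)

/-- The two-parameter Mittag-Leffler function `E_{a,b}(z) = ∑ z^k / Γ(a k + b)`. -/
def mittagLeffler (a b : ℝ) (z : ℂ) : ℂ :=
  ∑' k : ℕ, z ^ k / (Real.Gamma (a * k + b) : ℂ)

/-- The Fourier symbol `ξ ↦ E_{α,α}(e^{(ν-μ)πi} t^α |ξ|^β)`. -/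
def symbolW {d : ℕ} (α β μ ν t : ℝ) (ξ : Space d) : ℂ :=
  mittagLeffler α α
    (Complex.exp (((ν - μ) * Real.pi : ℝ) * Complex.I) * ((t ^ α * ‖ξ‖ ^ β : ℝ) : ℂ))

/-- The function `K` is the inverse Fourier transform of the function `m`, in the sense of tempered
distributions: `⟨K, φ⟩ = ⟨m, 𝓕⁻ φ⟩` for every Schwartz function `φ`, where
`𝓕⁻ φ (ξ) = ∫ e^{2πi x·ξ} φ(x) dx`. -/
def IsInverseFourier {d : ℕ} (m K : Space d → ℂ) : Prop :=
  LocallyIntegrable K ∧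
    ∀ φ : 𝓢(Space d, ℂ),
      Integrable (fun x => K x * φ x) ∧ Integrable (fun ξ => m ξ * (𝓕⁻ φ) ξ) ∧
        ∫ x, K x * φ x = ∫ ξ, m ξ * (𝓕⁻ φ) ξ

open Classical in
/-- The kernel `W_{α,μ,ν}(t,x) = ∫ e^{2πi x·ξ} E_{α,α}(e^{(ν-μ)πi} t^α |ξ|^β) dξ`: the locally
integrable function (unique up to null sets) that is the inverse Fourier transform of the symbol.
It is set to zero when there is no such function. -/
def kernelW {d : ℕ} (α β μ ν t : ℝ) : Space d → ℂ :=
  if h : ∃ K : Space d → ℂ, IsInverseFourier (symbolW α β μ ν t) K then h.choose else 0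

/-- The spatial convolution `(W_{α,μ,ν}(τ,·) ∗ g)(x)`. -/
def convW {d : ℕ} (α β μ ν τ : ℝ) (g : Space d → ℂ) (x : Space d) : ℂ :=
  convolution (kernelW α β μ ν τ) g (ContinuousLinearMap.mul ℂ ℂ) volume x

/-- The integrand `s ↦ (t-s)^{α-1} (W_{α,μ,ν}(t-s,·) ∗ F(s,·))(x)` of Duhamel's formula. -/
def duhamelIntegrand {d : ℕ} (α β μ ν : ℝ) (F : ℝ → Space d → ℂ) (t : ℝ) (x : Space d) (s : ℝ) :
    ℂ :=
  (((t - s) ^ (α - 1) : ℝ) : ℂ) * convW α β μ ν (t - s) (F s) x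

/-- The Duhamel solution
`w(t,x) = e^{-μπi} ∫_0^t (t-s)^{α-1} (W_{α,μ,ν}(t-s,·) ∗ F(s,·))(x) ds`. -/
def duhamel {d : ℕ} (α β μ ν : ℝ) (F : ℝ → Space d → ℂ) (t : ℝ) (x : Space d) : ℂ :=
  Complex.exp (-((μ * Real.pi : ℝ) * Complex.I)) *
    ∫ s in (0 : ℝ)..t, duhamelIntegrand α β μ ν F t x s

/-- The mixed norm `‖F‖_{L^r([0,∞);L^p(ℝ^d))}`, with values in `[0,∞]`. -/
def mixedNorm {d : ℕ} (r p : ℝ≥0∞) (F : ℝ → Space d → ℂ) : ℝ≥0∞ :=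
  eLpNorm (fun s => eLpNorm (F s) p volume) r (volume.restrict (Ici (0 : ℝ)))

end FracDuhamel

end

/-! The proof writes the kernel `W` as a superposition of heat kernels of high order and then uses
only the scaling of those kernels.

The condition on `|μ-ν|` says that `e^{(ν-μ)πi} = -e^{iθ}` with `|θ| < π - απ/2`. In closed sectors
about the negative axis of half-opening less than `π - απ/2`, `E_{α,α}(z)` is `O(1/(1+|z|))`
(`exists_mittagLeffler_le`). To see this, sum Hankel's formula for `1/Γ(αk+α)` against `z^k`: this
gives `E_{α,α}(z) = (1/2πi) ∫ e^s/(s^α - z) ds` for small `z`, and analytic continuation carries it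
into the sector, where `|s^α - z|` is at least a multiple of `1+|z|`.

For small `γ > 0` the function `ρ ↦ E_{α,α}(-e^{iθ}ρ^γ)` is therefore holomorphic in a sector of
half-opening larger than `π/2`. After subtraction of `E_{α,α}(0)/(1+ρ)` it is `O(|ρ|^γ)` at `0` and
`O(|ρ|^{-γ})` at infinity. Cauchy's formula in the sector, with `1/(ρ-w) = ∫ e^{-l(ρ-w)} dl` on the
bounding rays, exhibits it as the Laplace transform of some `h` with `∫ l^{-κ}|h(l)| dl < ∞` for `0
≤ κ < γ` (`exists_laplace_mittagLeffler`).

Take `γ = β/(4k)` and `ρ = t^{α/γ}|ξ|^{4k}`. The symbol becomes `∫ h(l) e^{-lσ|ξ|^{4k}} dl` with `σ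
= t^{α/γ}`, so `W` is the superposition with density `h` of the Schwartz kernels of
`e^{-lσ|ξ|^{4k}}`, whose `L^a` norm is a constant times `(lσ)^{-(d/4k)(1-1/a)}`
(`exists_kernelW_ae_eq_heatSuperposition`, `eLpNorm_heatKernel`).

Put `δ = 1/p - 1/q` and `1/a = 1 - δ`. Young's inequality in space, Minkowski's in `(s,l)` and
Hölder's in `s` reduce the estimate to two conditions: the moment of `h` of order `dδ/(4k)` is
finite, which holds as `dδ < β`, and the resulting power of `t` is positive. Both follow from the
bound on `δ`. Everything is done for a nonnegative majorant, whose almost everywhere finiteness also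
gives the absolute convergence. -/

namespace FracDuhamel

open Filter Topology

/-! ### Rotating the rays of Hankel's contour -/

section Ray

/-- The pull-back of the form `e^s s^{-b} ds` to the ray `s = r e^{iψ}`. -/
noncomputable def rayIntegrand (b ψ r : ℝ) : ℂ :=
  Complex.exp (r * Complex.exp (ψ * Complex.I)) * ((r ^ (-b) : ℝ) : ℂ) *
    Complex.exp (ψ * (1 - b) * Complex.I)

/-- The pull-back of the form `e^s s^{1-b} i` to the ray `s = r e^{iψ}`, a primitive in `r` of the
`ψ`-derivative of `rayIntegrand`. -/
noncomputable def rayPrimitive (b ψ r : ℝ) : ℂ :=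
  Complex.I * Complex.exp (r * Complex.exp (ψ * Complex.I)) * ((r ^ (1 - b) : ℝ) : ℂ) *
    Complex.exp (ψ * (1 - b) * Complex.I)

/-- The `ψ`-derivative of `rayIntegrand`. -/
noncomputable def rayDeriv (b ψ r : ℝ) : ℂ :=
  rayIntegrand b ψ r * (Complex.I * (r * Complex.exp (ψ * Complex.I) + (1 - b)))

lemma hasDerivAt_cexp_ofReal_mul_I (ψ : ℝ) :
    HasDerivAt (fun ψ : ℝ => Complex.exp (ψ * Complex.I))
      (Complex.exp (ψ * Complex.I) * Complex.I) ψ := by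
  have h : HasDerivAt (fun ψ : ℝ => ((ψ : ℝ) : ℂ) * Complex.I) (1 * Complex.I) ψ :=
    (Complex.ofRealCLM.hasDerivAt (x := ψ)).mul_const _
  simpa using h.cexp

lemma hasDerivAt_rayIntegrand_angle (b ψ r : ℝ) :
    HasDerivAt (fun ψ => rayIntegrand b ψ r) (rayDeriv b ψ r) ψ := by
  have h1 := ((hasDerivAt_cexp_ofReal_mul_I ψ).const_mul (r : ℂ)).cexp
  have h2 : HasDerivAt (fun ψ : ℝ => Complex.exp (ψ * (1 - b) * Complex.I))
      (Complex.exp (ψ * (1 - b) * Complex.I) * ((1 - b) * Complex.I)) ψ := by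
    have h : HasDerivAt (fun ψ : ℝ => ((ψ : ℝ) : ℂ) * (1 - b) * Complex.I)
        (1 * (1 - b) * Complex.I) ψ :=
      ((Complex.ofRealCLM.hasDerivAt (x := ψ)).mul_const _).mul_const _
    simpa using h.cexp
  have h3 := (h1.mul_const ((r ^ (-b) : ℝ) : ℂ)).mul h2
  refine h3.congr_deriv ?_
  simp only [rayDeriv, rayIntegrand]
  ring

/-- This is the closedness of `e^s s^{-b} ds` in polar coordinates. It takes the place of Cauchy's
theorem: the change of a ray integral with the angle is a boundary term. -/
lemma hasDerivAt_rayPrimitive (b ψ : ℝ) {r : ℝ} (hr : 0 < r) :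
    HasDerivAt (fun r => rayPrimitive b ψ r) (rayDeriv b ψ r) r := by
  have h1 : HasDerivAt (fun r : ℝ => Complex.exp (r * Complex.exp (ψ * Complex.I)))
      (Complex.exp (r * Complex.exp (ψ * Complex.I)) * Complex.exp (ψ * Complex.I)) r := by
    have h : HasDerivAt (fun r : ℝ => ((r : ℝ) : ℂ) * Complex.exp (ψ * Complex.I))
        (1 * Complex.exp (ψ * Complex.I)) r :=
      (Complex.ofRealCLM.hasDerivAt (x := r)).mul_const _
    simpa using h.cexp
  have h2 : HasDerivAt (fun r : ℝ => ((r ^ (1 - b) : ℝ) : ℂ))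
      (((1 - b) * r ^ (1 - b - 1) : ℝ) : ℂ) r :=
    (Real.hasDerivAt_rpow_const (Or.inl hr.ne')).ofReal_comp
  have h3 := ((h1.const_mul Complex.I).mul h2).mul_const (Complex.exp (ψ * (1 - b) * Complex.I))
  refine h3.congr_deriv ?_
  have e1 : r ^ (1 - b - 1) = r ^ (-b) := by congr 1; ring
  have e2 : r ^ (1 - b) = r * r ^ (-b) := by
    rw [sub_eq_add_neg, Real.rpow_add hr, Real.rpow_one]
  simp only [rayDeriv, rayIntegrand]
  rw [e1, e2]
  push_cast
  ring

lemma norm_cexp_ray (ψ r : ℝ) :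
    ‖Complex.exp (r * Complex.exp (ψ * Complex.I))‖ = Real.exp (r * Real.cos ψ) := by
  rw [Complex.norm_exp]
  simp [Complex.exp_ofReal_mul_I_re]

lemma norm_cexp_angle (ψ b : ℝ) : ‖Complex.exp (ψ * (1 - b) * Complex.I)‖ = 1 := by
  have : (ψ * (1 - b) * Complex.I : ℂ) = ((ψ * (1 - b) : ℝ) : ℂ) * Complex.I := by push_cast; ring
  rw [this, Complex.norm_exp_ofReal_mul_I]

lemma norm_rayIntegrand {b ψ r : ℝ} (hr : 0 ≤ r) :
    ‖rayIntegrand b ψ r‖ = Real.exp (r * Real.cos ψ) * r ^ (-b) := by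
  rw [rayIntegrand, norm_mul, norm_mul, norm_cexp_ray, norm_cexp_angle, Complex.norm_real,
    Real.norm_of_nonneg (Real.rpow_nonneg hr _), mul_one]

lemma norm_rayPrimitive {b ψ r : ℝ} (hr : 0 ≤ r) :
    ‖rayPrimitive b ψ r‖ = Real.exp (r * Real.cos ψ) * r ^ (1 - b) := by
  rw [rayPrimitive, norm_mul, norm_mul, norm_mul, norm_cexp_ray, norm_cexp_angle,
    Complex.norm_real, Real.norm_of_nonneg (Real.rpow_nonneg hr _), mul_one, Complex.norm_I, one_mul]

lemma norm_rayDeriv_le {b ψ r : ℝ} (hb : b ≤ 1) (hb0 : 0 ≤ b) (hr : 0 ≤ r) :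
    ‖rayDeriv b ψ r‖ ≤ Real.exp (r * Real.cos ψ) * r ^ (-b) * (r + 1) := by
  rw [rayDeriv, norm_mul, norm_rayIntegrand hr]
  refine mul_le_mul_of_nonneg_left ?_ (mul_nonneg (Real.exp_pos _).le (Real.rpow_nonneg hr _))
  rw [norm_mul, Complex.norm_I, one_mul]
  refine (norm_add_le _ _).trans (add_le_add ?_ ?_)
  · rw [norm_mul, Complex.norm_exp_ofReal_mul_I, mul_one, Complex.norm_real,
      Real.norm_of_nonneg hr]
  · have : (1 - b : ℂ) = ((1 - b : ℝ) : ℂ) := by push_cast; ring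
    rw [this, Complex.norm_real, Real.norm_of_nonneg (by linarith)]
    linarith

lemma measurable_rayIntegrand (b ψ : ℝ) : Measurable (rayIntegrand b ψ) := by
  unfold rayIntegrand; fun_prop

lemma measurable_rayDeriv (b ψ : ℝ) : Measurable (rayDeriv b ψ) := by
  unfold rayDeriv
  have := measurable_rayIntegrand b ψ
  fun_prop

lemma integrableOn_exp_mul_rpow {b c : ℝ} (hb : b < 1) (hc : 0 < c) :
    IntegrableOn (fun r : ℝ => Real.exp (-c * r) * r ^ (-b) * (r + 1)) (Ioi 0) := by
  have h1 := integrableOn_rpow_mul_exp_neg_mul_rpow (p := 1) (s := -b) (b := c)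
    (by linarith) one_pos hc
  have h2 := integrableOn_rpow_mul_exp_neg_mul_rpow (p := 1) (s := 1 - b) (b := c)
    (by linarith) one_pos hc
  refine (h2.add h1).congr_fun (fun r hr => ?_) measurableSet_Ioi
  have hr : 0 < r := hr
  have e2 : r ^ (1 - b) = r * r ^ (-b) := by
    rw [sub_eq_add_neg, Real.rpow_add hr, Real.rpow_one]
  simp only [Pi.add_apply, Real.rpow_one, e2]
  ring

/-- One majorant serves two regimes: full rays with `cos ψ < 0`, where `A = 0`, and the segment
`(0,1]` at any angle, where `r cos ψ ≤ 2 - r`. -/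
lemma rayBound {S : Set ℝ} {b A c : ℝ} (hS : S ⊆ Ioi 0) (hb : b < 1) (hc : 0 < c) :
    IntegrableOn (fun r : ℝ => Real.exp (A - c * r) * r ^ (-b) * (r + 1)) S := by
  refine IntegrableOn.mono_set ?_ hS
  refine IntegrableOn.congr_fun (Integrable.const_mul (integrableOn_exp_mul_rpow hb hc) (Real.exp A))
    (fun r _ => ?_) measurableSet_Ioi
  simp only [sub_eq_add_neg, Real.exp_add, neg_mul]
  ring

lemma integrableOn_rayIntegrand {S : Set ℝ} (hSm : MeasurableSet S) (hS : S ⊆ Ioi 0) {b A c ψ : ℝ}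
    (hb : b < 1) (hc : 0 < c) (hψ : ∀ r ∈ S, r * Real.cos ψ ≤ A - c * r) :
    IntegrableOn (rayIntegrand b ψ) S := by
  refine Integrable.mono' (rayBound (A := A) hS hb hc) (measurable_rayIntegrand _ _).aestronglyMeasurable ?_
  refine (ae_restrict_iff' hSm).2 (ae_of_all _ fun r hr => ?_)
  have hr0 : (0 : ℝ) < r := hS hr
  rw [norm_rayIntegrand hr0.le]
  have h1 := Real.exp_le_exp.2 (hψ r hr)
  have h2 := Real.rpow_nonneg hr0.le (-b)
  calc _ ≤ Real.exp (A - c * r) * r ^ (-b) * 1 := by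
        rw [mul_one]; exact mul_le_mul_of_nonneg_right h1 h2
    _ ≤ _ := by gcongr; linarith

lemma integrableOn_rayDeriv {S : Set ℝ} (hSm : MeasurableSet S) (hS : S ⊆ Ioi 0) {b A c ψ : ℝ}
    (hb0 : 0 ≤ b) (hb : b < 1) (hc : 0 < c) (hψ : ∀ r ∈ S, r * Real.cos ψ ≤ A - c * r) :
    IntegrableOn (rayDeriv b ψ) S := by
  refine Integrable.mono' (rayBound (A := A) hS hb hc) (measurable_rayDeriv _ _).aestronglyMeasurable ?_
  refine (ae_restrict_iff' hSm).2 (ae_of_all _ fun r hr => ?_)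
  have hr0 : (0 : ℝ) < r := hS hr
  refine (norm_rayDeriv_le hb.le hb0 hr0.le).trans ?_
  have := hψ r hr
  gcongr

lemma hasDerivAt_integral_rayIntegrand {S : Set ℝ} (hSm : MeasurableSet S) (hS : S ⊆ Ioi 0)
    {b A c ψ : ℝ} (hb0 : 0 ≤ b) (hb : b < 1) (hc : 0 < c) {s : Set ℝ} (hs : s ∈ 𝓝 ψ)
    (hψ : ∀ ψ ∈ s, ∀ r ∈ S, r * Real.cos ψ ≤ A - c * r) :
    HasDerivAt (fun ψ => ∫ r in S, rayIntegrand b ψ r) (∫ r in S, rayDeriv b ψ r) ψ := by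
  refine (hasDerivAt_integral_of_dominated_loc_of_deriv_le (μ := volume.restrict S)
    (bound := fun r : ℝ => Real.exp (A - c * r) * r ^ (-b) * (r + 1)) hs
    (Eventually.of_forall fun ψ => (measurable_rayIntegrand b ψ).aestronglyMeasurable)
    (integrableOn_rayIntegrand hSm hS hb hc (hψ ψ (mem_of_mem_nhds hs)))
    (measurable_rayDeriv b ψ).aestronglyMeasurable ?_ (rayBound hS hb hc)
    (ae_of_all _ fun r ψ _ => hasDerivAt_rayIntegrand_angle b ψ r)).2
  refine (ae_restrict_iff' hSm).2 (ae_of_all _ fun r hr ψ hψs => ?_)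
  have hr0 : (0 : ℝ) < r := hS hr
  refine (norm_rayDeriv_le hb.le hb0 hr0.le).trans ?_
  have := hψ ψ hψs r hr
  gcongr

lemma continuous_rayPrimitive {b : ℝ} (hb : b < 1) (ψ : ℝ) : Continuous (rayPrimitive b ψ) := by
  unfold rayPrimitive
  have : Continuous fun r : ℝ => r ^ (1 - b) := Real.continuous_rpow_const (by linarith)
  fun_prop

lemma rayPrimitive_zero {b : ℝ} (hb : b < 1) (ψ : ℝ) : rayPrimitive b ψ 0 = 0 := by
  simp [rayPrimitive, Real.zero_rpow (by linarith : 1 - b ≠ 0)]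

lemma integral_rayDeriv_unit {b : ℝ} (hb0 : 0 ≤ b) (hb : b < 1) (ψ : ℝ) :
    ∫ r in Ioc 0 1, rayDeriv b ψ r = rayPrimitive b ψ 1 := by
  have hi : IntegrableOn (rayDeriv b ψ) (Ioc 0 1) :=
    integrableOn_rayDeriv (A := 2) (c := 1) measurableSet_Ioc (fun r hr => hr.1) hb0 hb one_pos
      (fun r hr => by nlinarith [Real.cos_le_one ψ, hr.1, hr.2])
  rw [← intervalIntegral.integral_of_le zero_le_one,
    intervalIntegral.integral_eq_sub_of_hasDerivAt_of_le zero_le_one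
      (continuous_rayPrimitive hb ψ).continuousOn
      (fun r hr => hasDerivAt_rayPrimitive b ψ hr.1)
      ((intervalIntegrable_iff_integrableOn_Ioc_of_le zero_le_one).2 hi),
    rayPrimitive_zero hb, sub_zero]

/-- Both boundary terms vanish, at `0` because `b < 1` and at infinity because `e^s` decays, so a
ray may turn freely within the left half-plane. -/
lemma integral_rayDeriv_Ioi {b : ℝ} (hb0 : 0 ≤ b) (hb : b < 1) {ψ : ℝ} (hψ : Real.cos ψ < 0) :
    ∫ r in Ioi 0, rayDeriv b ψ r = 0 := by
  have hi : IntegrableOn (rayDeriv b ψ) (Ioi 0) :=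
    integrableOn_rayDeriv (A := 0) (c := -Real.cos ψ) measurableSet_Ioi subset_rfl hb0 hb
      (by linarith) (fun r hr => by linarith)
  have ht : Tendsto (rayPrimitive b ψ) atTop (𝓝 0) := by
    rw [tendsto_zero_iff_norm_tendsto_zero]
    have h := tendsto_rpow_mul_exp_neg_mul_atTop_nhds_zero (1 - b) (-Real.cos ψ) (by linarith)
    refine h.congr' ?_
    filter_upwards [eventually_ge_atTop 0] with r hr
    rw [norm_rayPrimitive hr, mul_comm]
    congr 2
    ring
  have := integral_Ioi_of_hasDerivAt_of_tendsto
    (continuous_rayPrimitive hb ψ).continuousWithinAt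
    (fun r hr => hasDerivAt_rayPrimitive b ψ hr) hi ht
  rw [this, rayPrimitive_zero hb, sub_zero]

lemma integral_rayIntegrand_const {b : ℝ} (hb0 : 0 ≤ b) (hb : b < 1) {ψ₁ ψ₂ : ℝ} (h : ψ₁ ≤ ψ₂)
    (hψ : ∀ ψ ∈ Icc ψ₁ ψ₂, Real.cos ψ < 0) :
    ∫ r in Ioi 0, rayIntegrand b ψ₂ r = ∫ r in Ioi 0, rayIntegrand b ψ₁ r := by
  have hd : ∀ ψ ∈ Icc ψ₁ ψ₂,
      HasDerivAt (fun ψ => ∫ r in Ioi 0, rayIntegrand b ψ r) 0 ψ := by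
    intro ψ hψm
    rw [← integral_rayDeriv_Ioi hb0 hb (hψ ψ hψm)]
    -- Giving up half of the decay rate makes the majorant uniform over nearby angles.
    have hlt : Real.cos ψ < Real.cos ψ / 2 := by linarith [hψ ψ hψm]
    refine hasDerivAt_integral_rayIntegrand (A := 0) (c := -(Real.cos ψ / 2)) measurableSet_Ioi
      subset_rfl hb0 hb (by linarith [hψ ψ hψm])
      (Real.continuous_cos.continuousAt.eventually_lt continuousAt_const hlt) ?_
    intro ψ' h' r hr
    have h' : Real.cos ψ' < Real.cos ψ / 2 := h'
    have hr : 0 < r := hr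
    nlinarith
  have := constant_of_has_deriv_right_zero (f := fun ψ => ∫ r in Ioi 0, rayIntegrand b ψ r)
    (a := ψ₁) (b := ψ₂) (fun ψ hψm => (hd ψ hψm).continuousAt.continuousWithinAt)
    (fun ψ hψm => (hd ψ ⟨hψm.1, hψm.2.le⟩).hasDerivWithinAt)
  exact this ψ₂ (right_mem_Icc.2 h)

/-- On the cut the integrand is that of Euler's integral. The two sides `ψ = ±π` differ only in the
phase of `s^{1-b}`. -/
lemma integral_rayIntegrand_neg_axis {b : ℝ} (hb : b < 1) {ψ : ℝ}
    (hψ : Complex.exp (ψ * Complex.I) = -1) :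
    ∫ r in Ioi 0, rayIntegrand b ψ r =
      (Real.Gamma (1 - b) : ℂ) * Complex.exp (ψ * (1 - b) * Complex.I) := by
  have : (Real.Gamma (1 - b) : ℂ) = ∫ r in Ioi (0 : ℝ), ((Real.exp (-r) * r ^ (1 - b - 1) : ℝ) : ℂ) := by
    rw [integral_complex_ofReal, Real.Gamma_eq_integral (by linarith)]
  rw [this, ← integral_mul_const]
  refine integral_congr_ae (ae_of_all _ fun r => ?_)
  simp only [rayIntegrand, hψ]
  have e : 1 - b - 1 = -b := by ring
  rw [e]
  push_cast
  ring_nf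

/-- The difference of the integrals over the two rays that bound the Hankel contour. -/
lemma integral_rayIntegrand_sub {b φ : ℝ} (hb0 : 0 < b) (hb : b < 1) (hφ : Real.pi / 2 < φ)
    (hφ' : φ ≤ Real.pi) :
    (∫ r in Ioi 0, rayIntegrand b φ r) - ∫ r in Ioi 0, rayIntegrand b (-φ) r =
      2 * Real.pi * Complex.I / Complex.Gamma b := by
  have hpi := Real.pi_pos
  have h1 : ∫ r in Ioi 0, rayIntegrand b φ r = ∫ r in Ioi 0, rayIntegrand b Real.pi r :=
    (integral_rayIntegrand_const hb0.le hb hφ' fun ψ hψ =>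
      Real.cos_neg_of_pi_div_two_lt_of_lt (by linarith [hψ.1]) (by linarith [hψ.2])).symm
  have h2 : ∫ r in Ioi 0, rayIntegrand b (-φ) r = ∫ r in Ioi 0, rayIntegrand b (-Real.pi) r :=
    (integral_rayIntegrand_const hb0.le hb (by linarith) fun ψ hψ => by
      rw [← Real.cos_neg]
      exact Real.cos_neg_of_pi_div_two_lt_of_lt (by linarith [hψ.2]) (by linarith [hψ.1]))
  rw [h1, h2, integral_rayIntegrand_neg_axis hb Complex.exp_pi_mul_I,
    integral_rayIntegrand_neg_axis hb (by
      push_cast; rw [neg_mul, Complex.exp_neg, Complex.exp_pi_mul_I]; norm_num), ← mul_sub]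
  have hs : Complex.exp (Real.pi * (1 - b) * Complex.I) -
      Complex.exp ((-Real.pi : ℝ) * (1 - b) * Complex.I) =
      2 * Complex.I * Complex.sin (Real.pi * b) := by
    have : Complex.sin (Real.pi * b) = Complex.sin (Real.pi * (1 - b)) := by
      rw [mul_sub, mul_one, Complex.sin_pi_sub]
    rw [this, Complex.sin]
    push_cast
    ring_nf
    rw [Complex.I_sq]
    ring
  -- The jump across the cut contributes `2i sin(πb) Γ(1-b)`, and the reflection formula turns this
  -- into `2πi/Γ(b)`.
  have hΓ := Complex.Gamma_mul_Gamma_one_sub (b : ℂ)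
  have hsin : Complex.sin (Real.pi * b) ≠ 0 := by
    rw [← Complex.ofReal_mul, ← Complex.ofReal_sin]
    exact_mod_cast (Real.sin_pos_of_pos_of_lt_pi (by positivity) (by nlinarith)).ne'
  have hG : Complex.Gamma b ≠ 0 := by
    rw [Complex.Gamma_ofReal]
    exact_mod_cast (Real.Gamma_pos_of_pos hb0).ne'
  have hcast : (Real.Gamma (1 - b) : ℂ) = Complex.Gamma (1 - b) := by
    rw [← Complex.Gamma_ofReal]; push_cast; rfl
  rw [hs, hcast, eq_div_iff hG]
  rw [eq_div_iff hsin] at hΓ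
  linear_combination 2 * Complex.I * hΓ

end Ray

/-! ### Hankel's integral for the reciprocal Gamma function -/

section Hankel

/-- The logarithm along the Hankel contour, which comes in from `∞ e^{-iφ}` to `e^{-iφ}`, follows
the unit circle to `e^{iφ}` and leaves to `∞ e^{iφ}`. -/
noncomputable def hankelLog (φ u : ℝ) : ℂ :=
  (Real.log (max 1 |u|) : ℂ) + ((φ * max (-1) (min 1 u) : ℝ) : ℂ) * Complex.I

/-- The derivative of the parametrization `exp ∘ hankelLog φ` of the Hankel contour. -/
noncomputable def hankelSpeed (φ u : ℝ) : ℂ :=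
  if u ≤ -1 then -Complex.exp ((-φ : ℝ) * Complex.I)
  else if u ≤ 1 then φ * Complex.I * Complex.exp ((φ * u : ℝ) * Complex.I)
  else Complex.exp (φ * Complex.I)

/-- The density of `e^s ds` along the Hankel contour. -/
noncomputable def hankelWeight (φ u : ℝ) : ℂ :=
  Complex.exp (Complex.exp (hankelLog φ u)) * hankelSpeed φ u

lemma measurable_hankelLog (φ : ℝ) : Measurable (hankelLog φ) := by
  unfold hankelLog; fun_prop

lemma measurable_hankelSpeed (φ : ℝ) : Measurable (hankelSpeed φ) := by
  unfold hankelSpeed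
  refine Measurable.ite measurableSet_Iic measurable_const
    (Measurable.ite measurableSet_Iic ?_ measurable_const)
  fun_prop

lemma measurable_hankelWeight (φ : ℝ) : Measurable (hankelWeight φ) := by
  unfold hankelWeight
  have := measurable_hankelLog φ
  have := measurable_hankelSpeed φ
  fun_prop

lemma hankelLog_re (φ u : ℝ) : (hankelLog φ u).re = Real.log (max 1 |u|) := by
  simp [hankelLog]

lemma hankelLog_im (φ u : ℝ) : (hankelLog φ u).im = φ * max (-1) (min 1 u) := by
  simp [hankelLog, -Complex.ofReal_mul]

lemma hankelLog_re_nonneg (φ u : ℝ) : 0 ≤ (hankelLog φ u).re := by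
  rw [hankelLog_re]; exact Real.log_nonneg (le_max_left _ _)

lemma abs_hankelLog_im_le {φ : ℝ} (hφ : 0 ≤ φ) (u : ℝ) : |(hankelLog φ u).im| ≤ φ := by
  rw [hankelLog_im, abs_mul, abs_of_nonneg hφ]
  refine mul_le_of_le_one_right hφ (abs_le.2 ⟨le_max_left _ _, max_le (by norm_num) (min_le_left _ _)⟩)

lemma norm_hankelLog_le {φ : ℝ} (hφ : 0 ≤ φ) (u : ℝ) :
    ‖hankelLog φ u‖ ≤ Real.log (max 1 |u|) + φ := by
  refine (Complex.norm_le_abs_re_add_abs_im _).trans (add_le_add ?_ (abs_hankelLog_im_le hφ u))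
  rw [abs_of_nonneg (hankelLog_re_nonneg φ u), hankelLog_re]

lemma cexp_hankelLog_of_one_le (φ : ℝ) {u : ℝ} (hu : 1 ≤ u) :
    Complex.exp (hankelLog φ u) = u * Complex.exp (φ * Complex.I) := by
  have hu0 : (0 : ℝ) < u := by linarith
  have h : hankelLog φ u = (Real.log u : ℂ) + φ * Complex.I := by
    rw [hankelLog, abs_of_nonneg hu0.le, max_eq_right hu, min_eq_left hu, max_eq_right (by norm_num)]
    simp
  rw [h, Complex.exp_add, ← Complex.ofReal_exp, Real.exp_log hu0]

lemma cexp_hankelLog_of_le_neg_one (φ : ℝ) {u : ℝ} (hu : u ≤ -1) :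
    Complex.exp (hankelLog φ u) = -u * Complex.exp ((-φ : ℝ) * Complex.I) := by
  have hu0 : (0 : ℝ) < -u := by linarith
  have h : hankelLog φ u = (Real.log (-u) : ℂ) + (-φ : ℝ) * Complex.I := by
    rw [hankelLog, abs_of_nonpos (by linarith), max_eq_right (by linarith),
      min_eq_right (by linarith), max_eq_left hu]
    simp
  rw [h, Complex.exp_add, ← Complex.ofReal_exp, Real.exp_log hu0]
  push_cast; rfl

lemma hankelLog_of_abs_le (φ : ℝ) {u : ℝ} (hu : |u| ≤ 1) :
    hankelLog φ u = (φ * u : ℝ) * Complex.I := by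
  rw [hankelLog, max_eq_left hu, min_eq_right (abs_le.1 hu).2, max_eq_right (abs_le.1 hu).1]
  simp

lemma norm_hankelSpeed_le {φ : ℝ} (hφ : 0 ≤ φ) (u : ℝ) : ‖hankelSpeed φ u‖ ≤ 1 + φ := by
  unfold hankelSpeed
  split_ifs
  · rw [norm_neg, Complex.norm_exp_ofReal_mul_I]; linarith
  · rw [norm_mul, Complex.norm_exp_ofReal_mul_I, norm_mul, Complex.norm_I, Complex.norm_real,
      Real.norm_of_nonneg hφ]; linarith
  · rw [Complex.norm_exp_ofReal_mul_I]; linarith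

/-- On the rays `Re s = |u| cos φ`; on the arc `Re s ≤ 1`, which the constant `e^{1 - cos φ}`
absorbs. -/
lemma norm_hankelWeight_le {φ : ℝ} (hφ : 0 ≤ φ) (hφc : Real.cos φ < 0) (u : ℝ) :
    ‖hankelWeight φ u‖ ≤ (1 + φ) * Real.exp (1 - Real.cos φ) * Real.exp (Real.cos φ * |u|) := by
  rw [hankelWeight, norm_mul, mul_comm, mul_assoc]
  refine mul_le_mul (norm_hankelSpeed_le hφ u) ?_ (norm_nonneg _) (by linarith)
  rw [Complex.norm_exp, ← Real.exp_add]
  refine Real.exp_le_exp.2 ?_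
  have hc := Real.cos_le_one φ
  have hc' := Real.neg_one_le_cos φ
  rcases le_total |u| 1 with h | h
  · rw [hankelLog_of_abs_le φ h, Complex.exp_ofReal_mul_I_re]
    nlinarith [Real.cos_le_one (φ * u), abs_nonneg u]
  · rcases le_abs.1 h with h | h
    · rw [cexp_hankelLog_of_one_le φ h, Complex.re_ofReal_mul, Complex.exp_ofReal_mul_I_re,
        abs_of_nonneg (by linarith)]
      nlinarith
    · rw [cexp_hankelLog_of_le_neg_one φ (by linarith), ← Complex.ofReal_neg, Complex.re_ofReal_mul,
        Complex.exp_ofReal_mul_I_re, abs_of_nonpos (by linarith), Real.cos_neg]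
      nlinarith

lemma integrable_exp_neg_mul_abs {c : ℝ} (hc : 0 < c) :
    Integrable (fun u : ℝ => Real.exp (-c * |u|)) := by
  have h1 : IntegrableOn (fun u : ℝ => Real.exp (-c * |u|)) (Ioi 0) :=
    IntegrableOn.congr_fun (exp_neg_integrableOn_Ioi 0 hc)
      (fun u hu => by rw [abs_of_pos (show (0 : ℝ) < u from hu)]) measurableSet_Ioi
  have h2 : IntegrableOn (fun u : ℝ => Real.exp (-c * |u|)) (Iic 0) :=
    IntegrableOn.congr_fun (integrableOn_exp_mul_Iic hc 0)
      (fun u hu => by simp only [abs_of_nonpos (show u ≤ (0 : ℝ) from hu), neg_mul_neg])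
      measurableSet_Iic
  rw [← integrableOn_univ, ← Iic_union_Ioi (a := (0 : ℝ))]
  exact h2.union h1

lemma integrable_exp_neg_mul_abs_mul_pow {c : ℝ} (hc : 0 < c) (M : ℕ) :
    Integrable (fun u : ℝ => Real.exp (-c * |u|) * (max 1 |u|) ^ M) := by
  have hc2 : 0 < c / 2 := by linarith
  refine Integrable.mono' (g := fun u : ℝ => (Real.exp (c / 2) * (M.factorial * (2 / c) ^ M)) *
    Real.exp (-(c / 2) * |u|)) ((integrable_exp_neg_mul_abs hc2).const_mul _)
    (by fun_prop) (ae_of_all _ fun u => ?_)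
  have h0 : (0 : ℝ) ≤ max 1 |u| := le_trans zero_le_one (le_max_left _ _)
  rw [Real.norm_of_nonneg (mul_nonneg (Real.exp_pos _).le (pow_nonneg h0 _))]
  have h1 := Real.pow_div_factorial_le_exp (c / 2 * max 1 |u|) (by positivity) M
  have hf : (0 : ℝ) < M.factorial := by exact_mod_cast M.factorial_pos
  rw [div_le_iff₀ hf, mul_pow] at h1
  have h2 : Real.exp (c / 2 * max 1 |u|) ≤ Real.exp (c / 2) * Real.exp (c / 2 * |u|) := by
    rw [← Real.exp_add]
    refine Real.exp_le_exp.2 ?_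
    have : max 1 |u| ≤ 1 + |u| := max_le (by linarith [abs_nonneg u]) (by linarith)
    nlinarith
  have h3 : (max 1 |u|) ^ M ≤ (2 / c) ^ M * (Real.exp (c / 2) * Real.exp (c / 2 * |u|) * M.factorial) := by
    have : (max 1 |u|) ^ M = (2 / c) ^ M * ((c / 2) ^ M * (max 1 |u|) ^ M) := by
      rw [← mul_assoc, ← mul_pow]
      have : 2 / c * (c / 2) = 1 := by field_simp
      rw [this]; simp
    rw [this]
    refine mul_le_mul_of_nonneg_left (h1.trans ?_) (by positivity)
    gcongr
  calc _ ≤ Real.exp (-c * |u|) *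
      ((2 / c) ^ M * (Real.exp (c / 2) * Real.exp (c / 2 * |u|) * M.factorial)) := by gcongr
    _ = _ := by
      have : Real.exp (-(c / 2) * |u|) = Real.exp (-c * |u|) * Real.exp (c / 2 * |u|) := by
        rw [← Real.exp_add]; ring_nf
      rw [this]; ring

/-- Complex powers of `s` grow at most polynomially along the contour, with a bound that depends on
the exponent only through `M`. This gives locally uniform domination in `b`. -/
lemma norm_cexp_mul_hankelLog_le {φ : ℝ} (hφ : 0 ≤ φ) (b : ℂ) {M : ℕ} (hM : ‖b‖ ≤ M) (u : ℝ) :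
    ‖Complex.exp (b * hankelLog φ u)‖ ≤ Real.exp (M * φ) * (max 1 |u|) ^ M := by
  have h0 : (0 : ℝ) < max 1 |u| := lt_of_lt_of_le zero_lt_one (le_max_left _ _)
  rw [Complex.norm_exp]
  have h1 : (b * hankelLog φ u).re ≤ M * (Real.log (max 1 |u|) + φ) := by
    refine (Complex.re_le_norm _).trans ?_
    rw [norm_mul]
    exact mul_le_mul hM (norm_hankelLog_le hφ u) (norm_nonneg _) (Nat.cast_nonneg _)
  refine (Real.exp_le_exp.2 h1).trans (le_of_eq ?_)
  rw [mul_add, Real.exp_add, Real.exp_nat_mul (Real.log _), Real.exp_log h0, mul_comm]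

lemma integrable_hankelWeight_mul {φ : ℝ} (hφ : 0 ≤ φ) (hc : Real.cos φ < 0) {f : ℝ → ℂ} {C : ℝ}
    {M : ℕ} (hf : Measurable f) (hb : ∀ u, ‖f u‖ ≤ C * (max 1 |u|) ^ M) :
    Integrable (fun u => hankelWeight φ u * f u) := by
  have hw := measurable_hankelWeight φ
  refine Integrable.mono' (((integrable_exp_neg_mul_abs_mul_pow (c := -Real.cos φ)
    (by linarith) M).const_mul ((1 + φ) * Real.exp (1 - Real.cos φ) * C)))
    (by fun_prop) (ae_of_all _ fun u => ?_)
  rw [norm_mul]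
  refine (mul_le_mul (norm_hankelWeight_le hφ hc u) (hb u) (norm_nonneg _) (by positivity)).trans
    (le_of_eq ?_)
  simp only [neg_neg]
  ring

lemma integrable_hankelWeight {φ : ℝ} (hφ : 0 ≤ φ) (hc : Real.cos φ < 0) :
    Integrable (hankelWeight φ) := by
  have := integrable_hankelWeight_mul hφ hc (f := fun _ => 1) (C := 1) (M := 0) measurable_const
    (fun u => by simp)
  simpa using this

/-- The Hankel integral `∫ e^s s^{-b} ds`. -/
noncomputable def hankelIntegral (φ : ℝ) (b : ℂ) : ℂ :=
  ∫ u, hankelWeight φ u * Complex.exp (-b * hankelLog φ u)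

lemma integrable_hankelIntegral {φ : ℝ} (hφ : 0 ≤ φ) (hc : Real.cos φ < 0) (b : ℂ) :
    Integrable (fun u => hankelWeight φ u * Complex.exp (-b * hankelLog φ u)) := by
  obtain ⟨M, hM⟩ := exists_nat_ge ‖-b‖
  have := measurable_hankelLog φ
  exact integrable_hankelWeight_mul hφ hc (by fun_prop) (norm_cexp_mul_hankelLog_le hφ (-b) hM)

/-- The contour avoids the origin, so the integral is entire in `b`. This carries Hankel's formula
beyond `0 < b < 1`, where it is computed directly. -/
lemma differentiable_hankelIntegral {φ : ℝ} (hφ : 0 ≤ φ) (hc : Real.cos φ < 0) :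
    Differentiable ℂ (hankelIntegral φ) := by
  intro b₀
  obtain ⟨M, hM⟩ := exists_nat_ge (‖b₀‖ + 1)
  have hw := measurable_hankelWeight φ
  have hL := measurable_hankelLog φ
  have key : ∀ b ∈ Metric.ball b₀ 1, ∀ u : ℝ,
      ‖Complex.exp (-b * hankelLog φ u) * (-hankelLog φ u)‖ ≤
        (Real.exp (M * φ) * (1 + φ)) * (max 1 |u|) ^ (M + 1) := by
    intro b hb u
    have hbM : ‖-b‖ ≤ M := by
      rw [norm_neg]
      have h1 := norm_sub_norm_le b b₀
      rw [mem_ball_iff_norm] at hb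
      linarith
    have h1 : (1 : ℝ) ≤ max 1 |u| := le_max_left _ _
    have h2 : ‖hankelLog φ u‖ ≤ (1 + φ) * max 1 |u| := by
      refine (norm_hankelLog_le hφ u).trans ?_
      have := Real.log_le_self (zero_le_one.trans h1)
      nlinarith
    rw [norm_mul, norm_neg, pow_succ]
    calc _ ≤ (Real.exp (M * φ) * (max 1 |u|) ^ M) * ((1 + φ) * max 1 |u|) :=
          mul_le_mul (norm_cexp_mul_hankelLog_le hφ (-b) hbM u) h2 (norm_nonneg _) (by positivity)
      _ = _ := by ring
  refine (hasDerivAt_integral_of_dominated_loc_of_deriv_le (μ := volume)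
    (F' := fun b u => hankelWeight φ u * (Complex.exp (-b * hankelLog φ u) * (-hankelLog φ u)))
    (bound := fun u => ((1 + φ) * Real.exp (1 - Real.cos φ) * (Real.exp (M * φ) * (1 + φ))) *
      (Real.exp (-(-Real.cos φ) * |u|) * (max 1 |u|) ^ (M + 1)))
    (Metric.ball_mem_nhds b₀ one_pos)
    (Eventually.of_forall fun b => by fun_prop)
    (integrable_hankelIntegral hφ hc b₀) (by fun_prop)
    (ae_of_all _ fun u b hb => ?_)
    ((integrable_exp_neg_mul_abs_mul_pow (by linarith) _).const_mul _)
    (ae_of_all _ fun u b _ => ?_)).2.differentiableAt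
  · rw [norm_mul]
    refine (mul_le_mul (norm_hankelWeight_le hφ hc u) (key b hb u) (norm_nonneg _)
      (by positivity)).trans (le_of_eq ?_)
    simp only [neg_neg]
    ring
  · have h : HasDerivAt (fun b : ℂ => -b * hankelLog φ u) (-1 * hankelLog φ u) b :=
      (hasDerivAt_neg b).mul_const _
    have h2 := (h.cexp).const_mul (hankelWeight φ u)
    refine h2.congr_deriv (by ring)

lemma hankelIntegrand_upper (φ b : ℝ) {u : ℝ} (hu : 1 < u) :
    hankelWeight φ u * Complex.exp (-(b : ℂ) * hankelLog φ u) = rayIntegrand b φ u := by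
  have hu0 : 0 < u := by linarith
  have h : hankelLog φ u = (Real.log u : ℂ) + φ * Complex.I := by
    rw [hankelLog, abs_of_nonneg hu0.le, max_eq_right hu.le, min_eq_left hu.le,
      max_eq_right (by norm_num)]
    simp
  rw [hankelWeight, cexp_hankelLog_of_one_le φ hu.le, hankelSpeed, if_neg (by linarith),
    if_neg (by linarith), h, rayIntegrand, Real.rpow_def_of_pos hu0]
  push_cast
  simp only [← Complex.exp_add]
  ring_nf

/-- The sign reflects that the lower ray is traversed towards the origin. -/
lemma hankelIntegrand_lower (φ b : ℝ) {u : ℝ} (hu : 1 < u) :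
    hankelWeight φ (-u) * Complex.exp (-(b : ℂ) * hankelLog φ (-u)) = -rayIntegrand b (-φ) u := by
  have hu0 : 0 < u := by linarith
  have h : hankelLog φ (-u) = (Real.log u : ℂ) - φ * Complex.I := by
    rw [hankelLog, abs_of_nonpos (by linarith), max_eq_right (by linarith),
      min_eq_right (by linarith), max_eq_left (by linarith)]
    simp; ring
  rw [hankelWeight, cexp_hankelLog_of_le_neg_one φ (by linarith), hankelSpeed,
    if_pos (by linarith), h, rayIntegrand, Real.rpow_def_of_pos hu0]
  push_cast
  rw [neg_neg, mul_neg, neg_mul]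
  simp only [← Complex.exp_add]
  ring_nf

lemma hankelIntegrand_arc (φ b : ℝ) {u : ℝ} (hu : -1 < u) (hu' : u ≤ 1) :
    hankelWeight φ u * Complex.exp (-(b : ℂ) * hankelLog φ u) =
      φ * rayPrimitive b (φ * u) 1 := by
  rw [hankelWeight, hankelLog_of_abs_le φ (abs_le.2 ⟨hu.le, hu'⟩), hankelSpeed,
    if_neg (by linarith), if_pos hu', rayPrimitive]
  simp only [Real.one_rpow, Complex.ofReal_one, mul_one, one_mul]
  have : Complex.exp ((φ * u : ℝ) * (1 - b) * Complex.I) =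
      Complex.exp ((φ * u : ℝ) * Complex.I) * Complex.exp (-(b : ℂ) * ((φ * u : ℝ) * Complex.I)) := by
    rw [← Complex.exp_add]; ring_nf
  rw [this]
  ring

/-- The arc is exchanged for two unit segments from the origin: along the arc the integrand is the
angular derivative of the integral over the segment, by `integral_rayDeriv_unit`. -/
lemma integral_hankel_arc {φ b : ℝ} (hb0 : 0 ≤ b) (hb : b < 1) :
    ∫ u in Ioc (-1 : ℝ) 1, (φ * rayPrimitive b (φ * u) 1 : ℂ) =
      (∫ r in Ioc 0 1, rayIntegrand b φ r) - ∫ r in Ioc 0 1, rayIntegrand b (-φ) r := by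
  have hd : ∀ u : ℝ, HasDerivAt (fun u : ℝ => ∫ r in Ioc 0 1, rayIntegrand b (φ * u) r)
      (φ * rayPrimitive b (φ * u) 1) u := by
    intro u
    have h1 := hasDerivAt_integral_rayIntegrand (ψ := φ * u) (A := 2) (c := 1) (S := Ioc 0 1)
      measurableSet_Ioc (fun r hr => hr.1) hb0 hb one_pos univ_mem
      (fun ψ _ r hr => by nlinarith [Real.cos_le_one ψ, hr.1, hr.2])
    rw [integral_rayDeriv_unit hb0 hb] at h1
    have h2 : HasDerivAt (fun u : ℝ => φ * u) φ u := by
      simpa using (hasDerivAt_id u).const_mul φ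
    have := h1.scomp u h2
    simpa [Function.comp_def] using this
  rw [← intervalIntegral.integral_of_le (by norm_num),
    intervalIntegral.integral_eq_sub_of_hasDerivAt (fun u _ => hd u)]
  · simp
  · refine Continuous.intervalIntegrable ?_ _ _
    unfold rayPrimitive
    fun_prop

/-- For `b < 1` the singularity of `s^{-b}` at the origin is integrable. The contour can then be
collapsed to two full rays, which `integral_rayIntegrand_sub` evaluates. -/
lemma hankelIntegral_of_real {φ b : ℝ} (hφ : Real.pi / 2 < φ) (hφ' : φ < Real.pi)
    (hb0 : 0 < b) (hb : b < 1) :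
    hankelIntegral φ b = 2 * Real.pi * Complex.I / Complex.Gamma b := by
  have hpi := Real.pi_pos
  have hφ0 : 0 ≤ φ := by linarith
  have hc : Real.cos φ < 0 := Real.cos_neg_of_pi_div_two_lt_of_lt hφ (by linarith)
  have hint := integrable_hankelIntegral hφ0 hc b
  have hray : ∀ ψ : ℝ, Real.cos ψ < 0 → ∫ r in Ioi 0, rayIntegrand b ψ r =
      (∫ r in Ioc 0 1, rayIntegrand b ψ r) + ∫ r in Ioi 1, rayIntegrand b ψ r := by
    intro ψ hψ
    have hi : IntegrableOn (rayIntegrand b ψ) (Ioi 0) :=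
      integrableOn_rayIntegrand (A := 0) (c := -Real.cos ψ) measurableSet_Ioi subset_rfl hb
        (by linarith) (fun r hr => by linarith)
    rw [← Ioc_union_Ioi_eq_Ioi (zero_le_one (α := ℝ)), setIntegral_union
      (Ioc_disjoint_Ioi le_rfl) measurableSet_Ioi
      (hi.mono_set Ioc_subset_Ioi_self) (hi.mono_set (Ioi_subset_Ioi zero_le_one))]
  have h1 : ∫ u in Ioi 1, hankelWeight φ u * Complex.exp (-(b : ℂ) * hankelLog φ u) =
      ∫ r in Ioi 1, rayIntegrand b φ r :=
    setIntegral_congr_fun measurableSet_Ioi fun u hu => hankelIntegrand_upper φ b hu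
  have h2 : ∫ u in Iic (-1), hankelWeight φ u * Complex.exp (-(b : ℂ) * hankelLog φ u) =
      -∫ r in Ioi 1, rayIntegrand b (-φ) r := by
    rw [← integral_neg, ← integral_comp_neg_Ioi]
    exact setIntegral_congr_fun measurableSet_Ioi fun u hu => hankelIntegrand_lower φ b hu
  have h3 : ∫ u in Ioc (-1) 1, hankelWeight φ u * Complex.exp (-(b : ℂ) * hankelLog φ u) =
      (∫ r in Ioc 0 1, rayIntegrand b φ r) - ∫ r in Ioc 0 1, rayIntegrand b (-φ) r := by
    rw [← integral_hankel_arc hb0.le hb]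
    exact setIntegral_congr_fun measurableSet_Ioc fun u hu => hankelIntegrand_arc φ b hu.1 hu.2
  rw [← integral_rayIntegrand_sub hb0 hb hφ hφ'.le, hray φ hc, hray (-φ) (by rwa [Real.cos_neg]),
    hankelIntegral, ← setIntegral_univ, ← Iic_union_Ioi (a := (-1 : ℝ)),
    setIntegral_union (Iic_disjoint_Ioi le_rfl) measurableSet_Ioi hint.integrableOn
      hint.integrableOn, ← Ioc_union_Ioi_eq_Ioi (show (-1 : ℝ) ≤ 1 by norm_num),
    setIntegral_union (Ioc_disjoint_Ioi le_rfl) measurableSet_Ioi hint.integrableOn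
      hint.integrableOn, h1, h2, h3]
  ring

/-- **Hankel's formula** for the reciprocal of the Gamma function. -/
theorem hankelIntegral_eq {φ : ℝ} (hφ : Real.pi / 2 < φ) (hφ' : φ < Real.pi) (b : ℂ) :
    hankelIntegral φ b = 2 * Real.pi * Complex.I * (Complex.Gamma b)⁻¹ := by
  have hpi := Real.pi_pos
  have hc : Real.cos φ < 0 := Real.cos_neg_of_pi_div_two_lt_of_lt hφ (by linarith)
  have hA := Complex.analyticOnNhd_univ_iff_differentiable.2
    (differentiable_hankelIntegral (by linarith : 0 ≤ φ) hc)
  have hB := Complex.analyticOnNhd_univ_iff_differentiable.2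
    (Complex.differentiable_one_div_Gamma.const_mul (2 * Real.pi * Complex.I))
  -- Identity theorem: two entire functions agree at real points that accumulate at `1/2`.
  have ht : Tendsto (fun x : ℝ => (x : ℂ)) (𝓝[≠] (1 / 2 : ℝ)) (𝓝[≠] ((1 / 2 : ℝ) : ℂ)) := by
    refine tendsto_nhdsWithin_iff.2
      ⟨(Complex.continuous_ofReal.tendsto _).mono_left nhdsWithin_le_nhds, ?_⟩
    filter_upwards [self_mem_nhdsWithin] with x hx
    exact fun h => hx (Complex.ofReal_injective h)
  have hev : ∀ᶠ x : ℝ in 𝓝[≠] (1 / 2 : ℝ), hankelIntegral φ x =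
      2 * Real.pi * Complex.I * (Complex.Gamma x)⁻¹ := by
    refine eventually_nhdsWithin_of_eventually_nhds ?_
    filter_upwards [Ioo_mem_nhds (show (0 : ℝ) < 1 / 2 by norm_num) (by norm_num : (1 / 2 : ℝ) < 1)]
      with x hx
    rw [hankelIntegral_of_real hφ hφ' hx.1 hx.2, div_eq_mul_inv]
  exact hA.eqOn_of_preconnected_of_frequently_eq hB isPreconnected_univ (mem_univ _)
    (ht.frequently hev.frequently) (mem_univ b)

end Hankel

/-! ### The Mittag-Leffler function: contour representation and decay in sectors -/

section MittagLeffler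

/-- Keep only `1 < t ≤ 2` in `Γ(x) T^{-x} = ∫ t^{x-1} e^{-Tt} dt`. As `T` is free, `Γ` outgrows
every exponential, which is all that the convergence of the series needs. -/
lemma rpow_mul_exp_le_Gamma {x T : ℝ} (hx : 0 < x) (hT : 0 < T) :
    T ^ x * (Real.exp (-(2 * T)) / 2) ≤ Real.Gamma x := by
  have h := Real.integral_rpow_mul_exp_neg_mul_Ioi hx hT
  have hint : IntegrableOn (fun t : ℝ => t ^ (x - 1) * Real.exp (-(T * t))) (Ioi 0) := by
    refine IntegrableOn.congr_fun (integrableOn_rpow_mul_exp_neg_mul_rpow (p := 1) (s := x - 1)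
      (b := T) (by linarith) one_pos hT) (fun t _ => by simp) measurableSet_Ioi
  have h1 : ∫ t in Ioc (1 : ℝ) 2, Real.exp (-(2 * T)) / 2 ≤
      ∫ t in Ioi (0 : ℝ), t ^ (x - 1) * Real.exp (-(T * t)) := by
    refine le_trans ?_ (setIntegral_mono_set hint ?_
      (ae_of_all _ (show Ioc (1 : ℝ) 2 ⊆ Ioi 0 from fun t ht => lt_trans one_pos ht.1)))
    · refine setIntegral_mono_on (by simp) (hint.mono_set fun t ht => lt_trans one_pos ht.1)
        measurableSet_Ioc fun t ht => ?_
      have ht0 : 0 < t := lt_trans one_pos ht.1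
      rw [Real.rpow_sub_one ht0.ne', div_eq_mul_inv, mul_comm]
      have h2 : (2 : ℝ)⁻¹ ≤ t ^ x / t := by
        rw [inv_eq_one_div]
        exact div_le_div₀ (by positivity) (Real.one_le_rpow ht.1.le hx.le) ht0 ht.2
      have h3 : Real.exp (-(2 * T)) ≤ Real.exp (-(T * t)) :=
        Real.exp_le_exp.2 (by nlinarith [ht.2])
      gcongr
    · refine (ae_restrict_iff' measurableSet_Ioi).2 (ae_of_all _ fun t ht => ?_)
      have ht : 0 < t := ht
      simp only [Pi.zero_apply]
      positivity
  rw [h] at h1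
  simp only [integral_const, MeasurableSet.univ, measureReal_restrict_apply, univ_inter,
    Real.volume_real_Ioc, smul_eq_mul] at h1
  norm_num at h1
  rw [Real.inv_rpow hT.le, inv_mul_eq_div, le_div_iff₀ (by positivity)] at h1
  linarith

/-- With `T = (2R)^{1/α}` the lower bound for `Γ(αk+α)` contains `(2R)^{k+1}`, which beats `R^k` by
the factor `2^{-k}`. -/
lemma norm_mittagLeffler_term_le {α R : ℝ} (hα : 0 < α) (hR : 0 < R) {z : ℂ} (hz : ‖z‖ ≤ R) (k : ℕ) :
    ‖z ^ k / (Real.Gamma (α * k + α) : ℂ)‖ ≤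
      (2 * Real.exp (2 * (2 * R) ^ (1 / α)) / (2 * R)) * (1 / 2) ^ k := by
  have hx : 0 < α * k + α := by positivity
  have hT : 0 < (2 * R) ^ (1 / α) := by positivity
  have h := rpow_mul_exp_le_Gamma hx hT
  have hpow : ((2 * R) ^ (1 / α)) ^ (α * k + α) = (2 * R) ^ k * (2 * R) := by
    rw [← Real.rpow_mul (by positivity), ← pow_succ, ← Real.rpow_natCast]
    congr 1
    push_cast
    field_simp
  rw [hpow, Real.exp_neg] at h
  rw [norm_div, norm_pow, Complex.norm_real, Real.norm_of_nonneg (Real.Gamma_pos_of_pos hx).le]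
  calc _ ≤ R ^ k / ((2 * R) ^ k * (2 * R) * ((Real.exp (2 * (2 * R) ^ (1 / α)))⁻¹ / 2)) := by
        gcongr
    _ = _ := by
        rw [mul_pow, one_div_pow]
        have : Real.exp (2 * (2 * R) ^ (1 / α)) ≠ 0 := (Real.exp_pos _).ne'
        field_simp

lemma summable_mittagLeffler_bound (A : ℝ) : Summable fun k : ℕ => A * (1 / 2 : ℝ) ^ k :=
  (summable_geometric_of_lt_one (by norm_num) (by norm_num)).mul_left A

lemma differentiable_mittagLeffler {α : ℝ} (hα : 0 < α) : Differentiable ℂ (mittagLeffler α α) := by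
  intro z
  have hR : 0 < ‖z‖ + 1 := by positivity
  have h := Complex.differentiableOn_tsum_of_summable_norm (U := Metric.ball (0 : ℂ) (‖z‖ + 1))
    (F := fun (k : ℕ) (z : ℂ) => z ^ k / (Real.Gamma (α * k + α) : ℂ))
    (summable_mittagLeffler_bound _)
    (fun k => ((differentiable_id.pow k).div_const _).differentiableOn) Metric.isOpen_ball
    (fun k w hw => norm_mittagLeffler_term_le hα hR (mem_ball_zero_iff.1 hw).le k)
  exact (h z (mem_ball_zero_iff.2 (by linarith))).differentiableAt
    (Metric.isOpen_ball.mem_nhds (mem_ball_zero_iff.2 (by linarith)))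

/-- Two complex numbers whose arguments differ by less than `π` do not cancel. -/
lemma add_mul_cos_le_norm (ρ r A B : ℝ) :
    (ρ + r) * Real.cos ((A - B) / 2) ≤
      ‖(ρ : ℂ) * Complex.exp (A * Complex.I) + r * Complex.exp (B * Complex.I)‖ := by
  have h : ‖(ρ : ℂ) * Complex.exp (A * Complex.I) + r * Complex.exp (B * Complex.I)‖ =
      ‖(ρ : ℂ) * Complex.exp (((A - B) / 2 : ℝ) * Complex.I) +
        r * Complex.exp ((-((A - B) / 2) : ℝ) * Complex.I)‖ := by
    -- Factoring out `e^{i(A+B)/2}` makes the two arguments opposite, and the real part then gives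
    -- the bound.
    rw [← mul_one ‖(ρ : ℂ) * Complex.exp (((A - B) / 2 : ℝ) * Complex.I) + _‖,
      ← Complex.norm_exp_ofReal_mul_I ((A + B) / 2), ← norm_mul, add_mul, mul_assoc, mul_assoc,
      ← Complex.exp_add, ← Complex.exp_add]
    congr 4 <;> (push_cast; ring_nf)
  rw [h]
  refine le_trans (le_of_eq ?_) (Complex.re_le_norm _)
  rw [Complex.add_re, Complex.re_ofReal_mul, Complex.re_ofReal_mul, Complex.exp_ofReal_mul_I_re,
    Complex.exp_ofReal_mul_I_re, Real.cos_neg]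
  ring

/-- The Hankel integral `∫ e^s / (s^α - z) ds`. -/
noncomputable def hankelResolvent (α φ : ℝ) (z : ℂ) : ℂ :=
  ∫ u, hankelWeight φ u * (Complex.exp (α * hankelLog φ u) - z)⁻¹

lemma cexp_mul_hankelLog_eq (α φ u : ℝ) :
    Complex.exp (α * hankelLog φ u) = (Real.exp (α * (hankelLog φ u).re) : ℂ) *
      Complex.exp ((α * (hankelLog φ u).im : ℝ) * Complex.I) := by
  rw [Complex.ofReal_exp, ← Complex.exp_add]
  congr 1
  apply Complex.ext <;> simp

lemma one_le_norm_cexp_mul_hankelLog {α : ℝ} (hα : 0 ≤ α) (φ u : ℝ) :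
    1 ≤ ‖Complex.exp (α * hankelLog φ u)‖ := by
  rw [Complex.norm_exp, Complex.re_ofReal_mul]
  exact Real.one_le_exp (mul_nonneg hα (hankelLog_re_nonneg φ u))

/-- On the contour `|arg s^α| ≤ αφ` and `|s^α| ≥ 1`, while `-z` has argument at most `η₀`. Since `αφ
+ η₀ < π` the terms of `s^α + (-z)` cannot cancel; the growth in `r` is the source of the decay of
`E_{α,α}`. -/
lemma le_norm_cexp_sub_of_arg {α φ η η₀ r : ℝ} (hα : 0 ≤ α) (hφ : 0 ≤ φ) (hη : |η| ≤ η₀)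
    (hη₀ : α * φ + η₀ < Real.pi) (hr : 0 ≤ r) (u : ℝ) :
    (1 + r) * Real.cos ((α * φ + η₀) / 2) ≤
      ‖Complex.exp (α * hankelLog φ u) - -(r * Complex.exp (η * Complex.I))‖ := by
  have hη₀0 := (abs_nonneg η).trans hη
  have him := abs_hankelLog_im_le hφ u
  have hA : |α * (hankelLog φ u).im - η| ≤ α * φ + η₀ := by
    refine (abs_sub _ _).trans (add_le_add ?_ hη)
    rw [abs_mul, abs_of_nonneg hα]
    gcongr
  have hcos : Real.cos ((α * φ + η₀) / 2) ≤
      Real.cos ((α * (hankelLog φ u).im - η) / 2) := by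
    rw [← Real.cos_abs ((α * (hankelLog φ u).im - η) / 2), abs_div, abs_of_pos (two_pos (α := ℝ))]
    exact Real.cos_le_cos_of_nonneg_of_le_pi (by positivity) (by linarith [Real.pi_pos]) (by linarith)
  have hpos : 0 < Real.cos ((α * φ + η₀) / 2) :=
    Real.cos_pos_of_mem_Ioo ⟨by linarith [mul_nonneg hα hφ, Real.pi_pos], by linarith⟩
  rw [sub_neg_eq_add, cexp_mul_hankelLog_eq]
  refine le_trans ?_ (add_mul_cos_le_norm _ _ _ _)
  have h1 : 1 ≤ Real.exp (α * (hankelLog φ u).re) :=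
    Real.one_le_exp (mul_nonneg hα (hankelLog_re_nonneg φ u))
  exact mul_le_mul (by linarith) hcos hpos.le (by positivity)

lemma integrable_hankelResolvent {α φ : ℝ} (hφ : 0 ≤ φ) (hc : Real.cos φ < 0) {z : ℂ} {m : ℝ}
    (hm : 0 < m) (h : ∀ u, m ≤ ‖Complex.exp (α * hankelLog φ u) - z‖) :
    Integrable fun u => hankelWeight φ u * (Complex.exp (α * hankelLog φ u) - z)⁻¹ := by
  have := measurable_hankelLog φ
  refine integrable_hankelWeight_mul hφ hc (C := m⁻¹) (M := 0) (by fun_prop) (fun u => ?_)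
  rw [norm_inv, pow_zero, mul_one]
  exact inv_anti₀ hm (h u)

lemma differentiableAt_hankelResolvent {α φ : ℝ} (hφ : 0 ≤ φ) (hc : Real.cos φ < 0) {z : ℂ} {m : ℝ}
    (hm : 0 < m) (h : ∀ u, m ≤ ‖Complex.exp (α * hankelLog φ u) - z‖) :
    DifferentiableAt ℂ (hankelResolvent α φ) z := by
  have hL := measurable_hankelLog φ
  have hw := measurable_hankelWeight φ
  have hball : ∀ z' ∈ Metric.ball z (m / 2), ∀ u,
      m / 2 ≤ ‖Complex.exp (α * hankelLog φ u) - z'‖ := by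
    intro z' hz' u
    rw [mem_ball_iff_norm] at hz'
    have h1 := h u
    have h2 := norm_sub_le (Complex.exp (α * hankelLog φ u) - z') (z - z')
    rw [sub_sub_sub_cancel_right, norm_sub_rev z z'] at h2
    linarith
  refine (hasDerivAt_integral_of_dominated_loc_of_deriv_le (μ := volume)
    (F' := fun z u => hankelWeight φ u * ((Complex.exp (α * hankelLog φ u) - z)⁻¹) ^ 2)
    (bound := fun u => ‖hankelWeight φ u‖ * ((m / 2)⁻¹) ^ 2)
    (Metric.ball_mem_nhds z (half_pos hm))
    (Eventually.of_forall fun b => by fun_prop)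
    (integrable_hankelResolvent hφ hc hm h) (by fun_prop)
    (ae_of_all _ fun u z' hz' => ?_)
    ((integrable_hankelWeight hφ hc).norm.mul_const _)
    (ae_of_all _ fun u z' hz' => ?_)).2.differentiableAt
  · rw [norm_mul, norm_pow, norm_inv]
    have := inv_anti₀ (half_pos hm) (hball z' hz' u)
    gcongr
  · have hne : Complex.exp (α * hankelLog φ u) - z' ≠ 0 :=
      norm_pos_iff.1 ((half_pos hm).trans_le (hball z' hz' u))
    have h1 := (((hasDerivAt_id z').const_sub (Complex.exp (α * hankelLog φ u))).inv hne).const_mul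
      (hankelWeight φ u)
    refine h1.congr_deriv ?_
    simp [div_eq_mul_inv]

/-- Since `|s^α| ≥ 1` on the contour, `1/(s^α - z)` is a geometric series in `z s^{-α}`, and
Hankel's formula integrates it term by term. -/
lemma hankelResolvent_eq_of_norm_lt_one {α φ : ℝ} (hα : 0 < α) (hφ : Real.pi / 2 < φ)
    (hφ' : φ < Real.pi) {z : ℂ} (hz : ‖z‖ < 1) :
    hankelResolvent α φ z = 2 * Real.pi * Complex.I * mittagLeffler α α z := by
  have hpi := Real.pi_pos
  have hφ0 : 0 ≤ φ := by linarith
  have hc : Real.cos φ < 0 := Real.cos_neg_of_pi_div_two_lt_of_lt hφ (by linarith)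
  let F : ℕ → ℝ → ℂ := fun k u =>
    z ^ k * (hankelWeight φ u * Complex.exp (-((α * k + α : ℝ) : ℂ) * hankelLog φ u))
  have hFi : ∀ k, Integrable (F k) := fun k => (integrable_hankelIntegral hφ0 hc _).const_mul _
  have hF : ∀ k u, ‖F k u‖ ≤ ‖z‖ ^ k * ‖hankelWeight φ u‖ := by
    intro k u
    simp only [F]
    rw [norm_mul, norm_pow, norm_mul]
    have : ‖Complex.exp (-((α * k + α : ℝ) : ℂ) * hankelLog φ u)‖ ≤ 1 := by
      rw [Complex.norm_exp, ← Complex.ofReal_neg, Complex.re_ofReal_mul]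
      refine Real.exp_le_one_iff.2 ?_
      have := hankelLog_re_nonneg φ u
      have : 0 ≤ α * k + α := by positivity
      nlinarith
    have h2 := mul_le_mul_of_nonneg_left this (norm_nonneg (hankelWeight φ u))
    rw [mul_one] at h2
    gcongr
  have hsum : Summable fun k => ∫ u, ‖F k u‖ := by
    refine Summable.of_nonneg_of_le (fun k => integral_nonneg fun u => norm_nonneg _) (fun k => ?_)
      ((summable_geometric_of_lt_one (norm_nonneg z) hz).mul_right (∫ u, ‖hankelWeight φ u‖))
    rw [← integral_const_mul]
    exact integral_mono (hFi k).norm ((integrable_hankelWeight hφ0 hc).norm.const_mul _) (hF k)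
  have hS := hasSum_integral_of_summable_integral_norm hFi hsum
  have h1 : (∫ u, ∑' k, F k u) = hankelResolvent α φ z := by
    refine integral_congr_ae (ae_of_all _ fun u => ?_)
    set a := Complex.exp (α * hankelLog φ u) with ha
    have hane : a ≠ 0 := Complex.exp_ne_zero _
    have hterm : ∀ k, F k u = hankelWeight φ u * a⁻¹ * (z * a⁻¹) ^ k := by
      intro k
      have : Complex.exp (-((α * k + α : ℝ) : ℂ) * hankelLog φ u) = a⁻¹ * a⁻¹ ^ k := by
        rw [ha, ← Complex.exp_neg, ← Complex.exp_nat_mul, ← Complex.exp_add]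
        push_cast; ring_nf
      simp only [F]
      rw [this, mul_pow]; ring
    have hlt : ‖z * a⁻¹‖ < 1 := by
      rw [norm_mul, norm_inv]
      refine lt_of_le_of_lt (mul_le_of_le_one_right (norm_nonneg z) ?_) hz
      exact inv_le_one_of_one_le₀ (one_le_norm_cexp_mul_hankelLog hα.le φ u)
    have hne2 : a - z ≠ 0 := by
      intro h0
      have h1 := one_le_norm_cexp_mul_hankelLog hα.le φ u
      rw [← ha, sub_eq_zero.1 h0] at h1
      linarith
    simp only [hterm, ← ha]
    rw [tsum_mul_left, tsum_geometric_of_norm_lt_one hlt]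
    have : 1 - z * a⁻¹ = (a - z) * a⁻¹ := by field_simp
    rw [this, mul_inv, inv_inv]
    field_simp
  rw [h1] at hS
  rw [← hS.tsum_eq, mittagLeffler, ← tsum_mul_left]
  refine tsum_congr fun k => ?_
  simp only [F]
  rw [integral_const_mul]
  have := hankelIntegral_eq hφ hφ' ((α * k + α : ℝ) : ℂ)
  rw [hankelIntegral, Complex.Gamma_ofReal] at this
  rw [this]
  ring

/-- The strict bound with `c ≤ π` keeps `-z` off the cut, where `arg` jumps. -/
lemma isOpen_sector {c : ℝ} (hc : c ≤ Real.pi) :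
    IsOpen {z : ℂ | z ≠ 0 ∧ |Complex.arg (-z)| < c} := by
  have h : {z : ℂ | z ≠ 0 ∧ |Complex.arg (-z)| < c} =
      (fun z : ℂ => -z) ⁻¹' (Complex.slitPlane ∩ {w | |Complex.arg w| < c}) := by
    ext z
    simp only [mem_ofPred_eq, mem_preimage, mem_inter_iff, Complex.mem_slitPlane_iff_arg]
    constructor
    · rintro ⟨h1, h2⟩
      refine ⟨⟨fun h => ?_, neg_ne_zero.2 h1⟩, h2⟩
      rw [h, abs_of_pos Real.pi_pos] at h2
      linarith
    · rintro ⟨⟨_, h1⟩, h2⟩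
      exact ⟨neg_ne_zero.1 h1, h2⟩
  rw [h]
  refine IsOpen.preimage continuous_neg ?_
  have hcont : ContinuousOn (fun w : ℂ => |Complex.arg w|) Complex.slitPlane :=
    fun w hw => (Complex.continuousAt_arg hw).abs.continuousWithinAt
  exact hcont.isOpen_inter_preimage Complex.isOpen_slitPlane isOpen_Iio

lemma isPreconnected_ball_union_sector (c : ℝ) :
    IsPreconnected (Metric.ball (0 : ℂ) 1 ∪ {z : ℂ | z ≠ 0 ∧ |Complex.arg (-z)| < c}) := by
  have h0 : (0 : ℂ) ∈ Metric.ball (0 : ℂ) 1 := Metric.mem_ball_self one_pos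
  refine (StarConvex.isPathConnected (E := ℂ) (starConvex_zero_iff.2 ?_) (mem_union_left _ h0)).isConnected.isPreconnected
  rintro z (hz | ⟨hz0, hz⟩) t ht ht1
  · left
    rw [mem_ball_zero_iff] at hz ⊢
    rw [norm_smul, Real.norm_of_nonneg ht]
    exact (mul_le_of_le_one_left (norm_nonneg z) ht1).trans_lt hz
  · rcases ht.eq_or_lt with rfl | ht
    · left; simp
    · right
      refine ⟨smul_ne_zero ht.ne' hz0, ?_⟩
      rwa [Complex.real_smul, ← mul_neg, Complex.arg_real_mul _ ht]

/-- Both sides are holomorphic on the union of the unit disc and the sector, which is star-shaped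
about `0`, and they agree on the disc. -/
lemma mittagLeffler_eq_hankelResolvent {α φ : ℝ} (hα : 0 < α) (hφ : Real.pi / 2 < φ)
    (hφ' : φ < Real.pi) {z : ℂ} (hz0 : z ≠ 0)
    (hz : |Complex.arg (-z)| < Real.pi - α * φ) :
    hankelResolvent α φ z = 2 * Real.pi * Complex.I * mittagLeffler α α z := by
  have hpi := Real.pi_pos
  have hφ0 : 0 ≤ φ := by linarith
  have hc : Real.cos φ < 0 := Real.cos_neg_of_pi_div_two_lt_of_lt hφ (by linarith)
  set U := Metric.ball (0 : ℂ) 1 ∪ {z : ℂ | z ≠ 0 ∧ |Complex.arg (-z)| < Real.pi - α * φ} with hU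
  have hUo : IsOpen U := Metric.isOpen_ball.union (isOpen_sector (by nlinarith))
  have hd : ∀ z ∈ U, DifferentiableAt ℂ (hankelResolvent α φ) z := by
    rintro z (hz | ⟨hz0, hz⟩)
    · rw [mem_ball_zero_iff] at hz
      refine differentiableAt_hankelResolvent hφ0 hc (m := 1 - ‖z‖) (by linarith) fun u => ?_
      have h1 := one_le_norm_cexp_mul_hankelLog hα.le φ u
      have h2 := norm_sub_norm_le (Complex.exp (α * hankelLog φ u)) z
      linarith
    · have hpos : 0 < Real.cos ((α * φ + |Complex.arg (-z)|) / 2) :=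
        Real.cos_pos_of_mem_Ioo ⟨by nlinarith [abs_nonneg (Complex.arg (-z))], by linarith⟩
      refine differentiableAt_hankelResolvent hφ0 hc (mul_pos (by positivity) hpos) (fun u =>
        (le_norm_cexp_sub_of_arg hα.le hφ0 le_rfl (by linarith) (norm_nonneg (-z)) u).trans
          (le_of_eq ?_))
      rw [Complex.norm_mul_exp_arg_mul_I, neg_neg]
  have hA : AnalyticOnNhd ℂ (hankelResolvent α φ) U :=
    DifferentiableOn.analyticOnNhd (fun z hz => (hd z hz).differentiableWithinAt) hUo
  have hB : AnalyticOnNhd ℂ (fun z => 2 * Real.pi * Complex.I * mittagLeffler α α z) U :=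
    DifferentiableOn.analyticOnNhd
      ((differentiable_mittagLeffler hα).const_mul _).differentiableOn hUo
  refine hA.eqOn_of_preconnected_of_eventuallyEq hB (isPreconnected_ball_union_sector _)
    (z₀ := 0) (Or.inl (Metric.mem_ball_self one_pos)) ?_ (Or.inr ⟨hz0, hz⟩)
  filter_upwards [Metric.ball_mem_nhds (0 : ℂ) one_pos] with w hw
  exact hankelResolvent_eq_of_norm_lt_one hα hφ hφ' (mem_ball_zero_iff.1 hw)

/-- Decay of `E_{α,α}` in closed sectors around the negative axis of half-opening less than
`π - απ/2`. -/
theorem exists_mittagLeffler_le {α η₀ : ℝ} (hα : 0 < α) (h0 : 0 ≤ η₀)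
    (hη₀ : η₀ < Real.pi - α * (Real.pi / 2)) :
    ∃ C : ℝ, 0 ≤ C ∧ ∀ r η : ℝ, 0 < r → |η| ≤ η₀ →
      ‖mittagLeffler α α (-(r * Complex.exp (η * Complex.I)))‖ ≤ C / (1 + r) := by
  have hpi := Real.pi_pos
  -- The contour angle must exceed `π/2`, for `e^s` to decay, and satisfy `αφ + η₀ < π`, for `s^α -
  -- z` not to vanish. The assumption on `η₀` leaves room for both.
  obtain ⟨φ, hφ, hφ2⟩ := exists_between
    (show Real.pi / 2 < min Real.pi ((Real.pi - η₀) / α) by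
      refine lt_min (by linarith) ?_
      rw [lt_div_iff₀ hα]
      linarith)
  have hφ' := hφ2.trans_le (min_le_left _ _)
  have hφ'' := hφ2.trans_le (min_le_right _ _)
  rw [lt_div_iff₀ hα] at hφ''
  have hαφ : α * φ + η₀ < Real.pi := by linarith
  have hφ0 : 0 ≤ φ := by linarith
  have hc : Real.cos φ < 0 := Real.cos_neg_of_pi_div_two_lt_of_lt hφ (by linarith)
  have hpos : 0 < Real.cos ((α * φ + η₀) / 2) :=
    Real.cos_pos_of_mem_Ioo ⟨by nlinarith, by linarith⟩
  set c := Real.cos ((α * φ + η₀) / 2)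
  refine ⟨(2 * Real.pi)⁻¹ * ((∫ u, ‖hankelWeight φ u‖) * c⁻¹),
    mul_nonneg (by positivity) (mul_nonneg (integral_nonneg fun u => norm_nonneg _)
      (inv_nonneg.2 hpos.le)), fun r η hr hη => ?_⟩
  have hη' : η ∈ Ioc (-Real.pi) Real.pi := by
    have := abs_le.1 hη
    constructor <;> nlinarith
  have hz0 : -(r * Complex.exp (η * Complex.I)) ≠ 0 :=
    neg_ne_zero.2 (mul_ne_zero (by exact_mod_cast hr.ne') (Complex.exp_ne_zero _))
  have hrep := mittagLeffler_eq_hankelResolvent hα hφ hφ' hz0 (by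
    rw [neg_neg, Complex.arg_real_mul _ hr, Complex.arg_exp_mul_I, toIocMod_eq_self _ |>.2 (by
      simpa [two_mul] using hη')]
    linarith)
  have hbound : ‖hankelResolvent α φ (-(r * Complex.exp (η * Complex.I)))‖ ≤
      (∫ u, ‖hankelWeight φ u‖) * ((1 + r) * c)⁻¹ := by
    rw [← integral_mul_const]
    refine norm_integral_le_of_norm_le ((integrable_hankelWeight hφ0 hc).norm.mul_const _)
      (ae_of_all _ fun u => ?_)
    rw [norm_mul, norm_inv]
    have := inv_anti₀ (mul_pos (by positivity) hpos)
      (le_norm_cexp_sub_of_arg hα.le hφ0 hη hαφ hr.le u)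
    gcongr
  rw [hrep, norm_mul, norm_mul, norm_mul, Complex.norm_I, Complex.norm_real,
    Real.norm_of_nonneg hpi.le, Complex.norm_ofNat, mul_one] at hbound
  rw [mul_inv] at hbound
  rw [div_eq_mul_inv, mul_assoc, inv_mul_eq_div, le_div_iff₀ (by positivity)]
  linarith

end MittagLeffler

/-! ### Cauchy's formula for a sector in logarithmic coordinates -/

section Strip

/-- The strip `|Im v| < π`. -/
def piStrip : Set ℂ := {v | |v.im| < Real.pi}

lemma isOpen_piStrip : IsOpen piStrip :=
  isOpen_lt (Complex.continuous_im.abs) continuous_const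

lemma mem_piStrip_line {a : ℝ} (ha : |a| < Real.pi) (x : ℝ) : (x + a * Complex.I : ℂ) ∈ piStrip := by
  simpa [piStrip] using ha

/-- Shifting the line of integration in a strip. -/
lemma integral_line_eq_of_tendsto_zero {q : ℂ → ℂ} {a : ℝ} (ha0 : 0 ≤ a) (ha : a < Real.pi)
    (hq : DifferentiableOn ℂ q piStrip) {B : ℝ → ℝ}
    (hB : ∀ᶠ x : ℝ in atTop, ∀ y : ℝ, |y| ≤ a → ‖q (x + y * Complex.I)‖ ≤ B x)
    (hB' : ∀ᶠ x : ℝ in atBot, ∀ y : ℝ, |y| ≤ a → ‖q (x + y * Complex.I)‖ ≤ B x)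
    (hBt : Tendsto B atTop (𝓝 0)) (hBb : Tendsto B atBot (𝓝 0))
    (hi : Integrable fun x : ℝ => q (x + a * Complex.I))
    (hi' : Integrable fun x : ℝ => q (x + (-a : ℝ) * Complex.I)) :
    ∫ x : ℝ, q (x + a * Complex.I) = ∫ x : ℝ, q (x + (-a : ℝ) * Complex.I) := by
  -- Cauchy's theorem on the rectangle `[-T,T] × [-a,a]`; the vertical sides disappear as `T → ∞`.
  have hrect : ∀ T : ℝ, ((∫ x in (-T)..T, q (x + (-a : ℝ) * Complex.I)) -
      ∫ x in (-T)..T, q (x + a * Complex.I)) +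
      Complex.I * (∫ y in (-a)..a, q (T + y * Complex.I)) -
      Complex.I * (∫ y in (-a)..a, q ((-T : ℝ) + y * Complex.I)) = 0 := by
    intro T
    have h := Complex.integral_boundary_rect_eq_zero_of_differentiableOn q ⟨-T, -a⟩ ⟨T, a⟩
      (hq.mono ?_)
    · simpa using h
    · intro v hv
      have h2 := hv.2
      simp only [mem_preimage] at h2
      rw [uIcc_of_le (by linarith)] at h2
      exact (abs_le.2 h2).trans_lt ha
  have hside : ∀ {l : Filter ℝ}, Tendsto B l (𝓝 0) →
      (∀ᶠ x : ℝ in l, ∀ y : ℝ, |y| ≤ a → ‖q (x + y * Complex.I)‖ ≤ B x) →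
      Tendsto (fun x : ℝ => ∫ y in (-a)..a, q (x + y * Complex.I)) l (𝓝 0) := by
    intro l hl hev
    have : Tendsto (fun x => B x * |a - -a|) l (𝓝 0) := by simpa using hl.mul_const |a - -a|
    refine squeeze_zero_norm' ?_ this
    filter_upwards [hev] with x hx
    refine intervalIntegral.norm_integral_le_of_norm_le_const fun y hy => hx y ?_
    rw [uIoc_of_le (by linarith)] at hy
    exact abs_le.2 ⟨hy.1.le, hy.2⟩
  have h1 := intervalIntegral_tendsto_integral hi tendsto_neg_atTop_atBot tendsto_id
  have h2 := intervalIntegral_tendsto_integral hi' tendsto_neg_atTop_atBot tendsto_id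
  have h3 := (hside hBt hB).const_mul Complex.I
  have h4 := ((hside hBb hB').comp tendsto_neg_atTop_atBot).const_mul Complex.I
  have h5 := ((h2.sub h1).add h3).sub h4
  have h6 := tendsto_nhds_unique (h5.congr fun T => hrect T) tendsto_const_nhds
  rw [mul_zero, add_zero, sub_zero, sub_eq_zero] at h6
  exact h6.symm

lemma cexp_line (x a : ℝ) : Complex.exp (x + a * Complex.I) =
    (Real.exp x : ℂ) * Complex.exp (a * Complex.I) := by
  rw [Complex.exp_add, Complex.ofReal_exp]

lemma norm_cexp_line (x a : ℝ) : ‖Complex.exp (x + a * Complex.I)‖ = Real.exp x := by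
  rw [Complex.norm_exp]; simp

lemma le_norm_one_add_cexp_line (x a : ℝ) :
    (1 + Real.exp x) * Real.cos (a / 2) ≤ ‖1 + Complex.exp (x + a * Complex.I)‖ := by
  have h := add_mul_cos_le_norm 1 (Real.exp x) 0 a
  rw [cexp_line]
  rw [zero_sub, neg_div, Real.cos_neg] at h
  simpa using h

/-- Turning the second term by `π`, in the direction given by the sign of `sin(a/2)`, makes the
difference a sum to which `add_mul_cos_le_norm` applies. -/
lemma le_norm_sub_cexp_line (y x a : ℝ) :
    (Real.exp y + Real.exp x) * |Real.sin (a / 2)| ≤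
      ‖(Real.exp y : ℂ) - Complex.exp (x + a * Complex.I)‖ := by
  have e1 : Complex.exp ((a + Real.pi : ℝ) * Complex.I) = -Complex.exp (a * Complex.I) := by
    push_cast; rw [add_mul, Complex.exp_add, Complex.exp_pi_mul_I]; ring
  have e2 : Complex.exp ((a - Real.pi : ℝ) * Complex.I) = -Complex.exp (a * Complex.I) := by
    push_cast
    rw [sub_mul, Complex.exp_sub, Complex.exp_pi_mul_I]; ring
  rcases le_total 0 (Real.sin (a / 2)) with hs | hs
  · have h := add_mul_cos_le_norm (Real.exp y) (Real.exp x) 0 (a - Real.pi)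
    rw [e2] at h
    have : Real.cos ((0 - (a - Real.pi)) / 2) = Real.sin (a / 2) := by
      rw [← Real.cos_pi_div_two_sub]; ring_nf
    rw [this] at h
    rw [abs_of_nonneg hs, cexp_line]
    refine h.trans (le_of_eq ?_)
    congr 1
    simp; ring
  · have h := add_mul_cos_le_norm (Real.exp y) (Real.exp x) 0 (a + Real.pi)
    rw [e1] at h
    have : Real.cos ((0 - (a + Real.pi)) / 2) = -Real.sin (a / 2) := by
      rw [← Real.sin_neg, ← Real.cos_pi_div_two_sub, ← Real.cos_neg]; ring_nf
    rw [this] at h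
    rw [abs_of_nonpos hs, cexp_line]
    refine h.trans (le_of_eq ?_)
    congr 1
    simp; ring

lemma one_add_cexp_ne_zero {v : ℂ} (hv : v ∈ piStrip) : 1 + Complex.exp v ≠ 0 := by
  have h := le_norm_one_add_cexp_line v.re v.im
  rw [Complex.re_add_im] at h
  have hv := abs_lt.1 (show |v.im| < Real.pi from hv)
  have : 0 < Real.cos (v.im / 2) := Real.cos_pos_of_mem_Ioo ⟨by linarith, by linarith⟩
  exact norm_pos_iff.1 (lt_of_lt_of_le (by positivity) h)

lemma cexp_injOn_piStrip {v : ℂ} (hv : v ∈ piStrip) {y : ℝ} (h : Complex.exp v = Complex.exp y) :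
    v = y := by
  have hv := abs_lt.1 (show |v.im| < Real.pi from hv)
  exact Complex.exp_inj_of_neg_pi_lt_of_le_pi hv.1 hv.2.le (by simpa using Real.pi_pos)
    (by simpa using Real.pi_pos.le) h

/-- The integral of the Cauchy kernel against `1 / (1 + e^v)` along a horizontal line. -/
lemma integral_cauchy_reference {a : ℝ} (ha0 : a ≠ 0) (ha : |a| < Real.pi) (y : ℝ)
    (hi : Integrable fun x : ℝ => (1 + Real.exp y : ℂ) / (1 + Complex.exp (x + a * Complex.I)) *
      (Complex.exp (x + a * Complex.I) / (Real.exp y - Complex.exp (x + a * Complex.I)))) :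
    ∫ x : ℝ, (1 + Real.exp y : ℂ) / (1 + Complex.exp (x + a * Complex.I)) *
      (Complex.exp (x + a * Complex.I) / (Real.exp y - Complex.exp (x + a * Complex.I))) =
      Complex.log (Complex.exp (a * Complex.I)) - Complex.log (-Complex.exp (a * Complex.I)) + y := by
  have ha' := abs_lt.1 ha
  have hsin : Real.sin a ≠ 0 := by
    rcases lt_or_gt_of_ne ha0 with h | h
    · exact (Real.sin_neg_of_neg_of_neg_pi_lt h ha'.1).ne
    · exact (Real.sin_pos_of_pos_of_lt_pi h ha'.2).ne'
  have him : ∀ x : ℝ, (Complex.exp (x + a * Complex.I)).im = Real.exp x * Real.sin a := by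
    intro x
    rw [Complex.exp_im]; simp
  have him0 : ∀ x : ℝ, (Complex.exp (x + a * Complex.I)).im ≠ 0 := fun x => by
    rw [him]; exact mul_ne_zero (Real.exp_pos x).ne' hsin
  have hs1 : ∀ x : ℝ, 1 + Complex.exp (x + a * Complex.I) ∈ Complex.slitPlane := fun x => by
    refine Complex.mem_slitPlane_iff.2 (Or.inr ?_)
    simpa using him0 x
  have hs2 : ∀ x : ℝ, (Real.exp y : ℂ) - Complex.exp (x + a * Complex.I) ∈ Complex.slitPlane :=
    fun x => by
      refine Complex.mem_slitPlane_iff.2 (Or.inr ?_)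
      rw [Complex.sub_im, Complex.ofReal_im, zero_sub]
      exact neg_ne_zero.2 (him0 x)
  -- Partial fractions: with `w = e^{x+ia}` the integrand is `w/(1+w) + w/(e^y-w)`. As `w` is never
  -- real, principal logarithms give a global primitive.
  have hd : ∀ x : ℝ, HasDerivAt (fun x : ℝ => Complex.log (1 + Complex.exp (x + a * Complex.I)) -
      Complex.log (Real.exp y - Complex.exp (x + a * Complex.I)))
      ((1 + Real.exp y : ℂ) / (1 + Complex.exp (x + a * Complex.I)) *
      (Complex.exp (x + a * Complex.I) / (Real.exp y - Complex.exp (x + a * Complex.I)))) x := by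
    intro x
    have h0 : HasDerivAt (fun x : ℝ => Complex.exp (x + a * Complex.I))
        (Complex.exp (x + a * Complex.I)) x := by
      simpa using ((Complex.ofRealCLM.hasDerivAt (x := x)).add_const (a * Complex.I)).cexp
    have h1 := (h0.const_add 1).clog_real (hs1 x)
    have h2 := (h0.const_sub (Real.exp y : ℂ)).clog_real (hs2 x)
    refine (h1.sub h2).congr_deriv ?_
    have n1 := Complex.slitPlane_ne_zero (hs1 x)
    have n2 := Complex.slitPlane_ne_zero (hs2 x)
    field_simp
    ring
  have hexp0 : Tendsto (fun x : ℝ => Complex.exp (x + a * Complex.I)) atBot (𝓝 0) := by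
    rw [tendsto_zero_iff_norm_tendsto_zero]
    simp only [norm_cexp_line]
    exact Real.tendsto_exp_atBot
  have hbot : Tendsto (fun x : ℝ => Complex.log (1 + Complex.exp (x + a * Complex.I)) -
      Complex.log (Real.exp y - Complex.exp (x + a * Complex.I))) atBot (𝓝 (-y)) := by
    have h1 : Tendsto (fun x : ℝ => 1 + Complex.exp (x + a * Complex.I)) atBot (𝓝 1) := by
      simpa using hexp0.const_add 1
    have h2 : Tendsto (fun x : ℝ => (Real.exp y : ℂ) - Complex.exp (x + a * Complex.I)) atBot
        (𝓝 (Real.exp y : ℂ)) := by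
      simpa using hexp0.const_sub (Real.exp y : ℂ)
    have h3 := (h1.clog Complex.one_mem_slitPlane).sub
      (h2.clog (Complex.ofReal_mem_slitPlane.2 (Real.exp_pos y)))
    rw [Complex.log_one, ← Complex.ofReal_log (Real.exp_pos y).le, Real.log_exp, zero_sub] at h3
    exact h3
  have htop : Tendsto (fun x : ℝ => Complex.log (1 + Complex.exp (x + a * Complex.I)) -
      Complex.log (Real.exp y - Complex.exp (x + a * Complex.I))) atTop
      (𝓝 (Complex.log (Complex.exp (a * Complex.I)) -
        Complex.log (-Complex.exp (a * Complex.I)))) := by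
    have himE : (Complex.exp (a * Complex.I)).im ≠ 0 := by
      rw [Complex.exp_ofReal_mul_I_im]; exact hsin
    have hneg : Tendsto (fun x : ℝ => (Real.exp (-x) : ℂ)) atTop (𝓝 0) := by
      have := (Complex.continuous_ofReal.tendsto 0).comp
        (Real.tendsto_exp_neg_atTop_nhds_zero)
      simpa [Function.comp_def] using this
    have h1 : Tendsto (fun x : ℝ => (Real.exp (-x) : ℂ) + Complex.exp (a * Complex.I)) atTop
        (𝓝 (Complex.exp (a * Complex.I))) := by simpa using hneg.add_const (Complex.exp (a * Complex.I))
    have h2 : Tendsto (fun x : ℝ => (Real.exp y : ℂ) * Real.exp (-x) - Complex.exp (a * Complex.I))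
        atTop (𝓝 (-Complex.exp (a * Complex.I))) := by
      simpa using (hneg.const_mul (Real.exp y : ℂ)).sub_const (Complex.exp (a * Complex.I))
    have h3 := (h1.clog (Complex.mem_slitPlane_iff.2 (Or.inr himE))).sub
      (h2.clog (Complex.mem_slitPlane_iff.2 (Or.inr (by simpa using himE))))
    refine h3.congr fun x => ?_
    have hx : (Real.exp x : ℂ) * Real.exp (-x) = 1 := by
      rw [← Complex.ofReal_mul, ← Real.exp_add]; simp
    have e1 : 1 + Complex.exp (x + a * Complex.I) =
        (Real.exp x : ℂ) * ((Real.exp (-x) : ℂ) + Complex.exp (a * Complex.I)) := by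
      rw [cexp_line, mul_add, hx]
    have e2 : (Real.exp y : ℂ) - Complex.exp (x + a * Complex.I) =
        (Real.exp x : ℂ) * ((Real.exp y : ℂ) * Real.exp (-x) - Complex.exp (a * Complex.I)) := by
      rw [cexp_line, mul_sub, mul_left_comm, hx, mul_one]
    have n1 := Complex.slitPlane_ne_zero (hs1 x)
    have n2 := Complex.slitPlane_ne_zero (hs2 x)
    rw [e1] at n1 ⊢
    rw [e2] at n2 ⊢
    rw [Complex.log_ofReal_mul (Real.exp_pos x) (right_ne_zero_of_mul n1),
      Complex.log_ofReal_mul (Real.exp_pos x) (right_ne_zero_of_mul n2)]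
    ring
  rw [integral_of_hasDerivAt_of_tendsto hd hi hbot htop, sub_neg_eq_add]

lemma integrable_of_norm_le_exp_neg_abs {f : ℝ → ℂ} (hf : AEStronglyMeasurable f) {c C : ℝ}
    (hc : 0 < c) (h : ∀ x, ‖f x‖ ≤ C * Real.exp (-c * |x|)) : Integrable f :=
  Integrable.mono' ((integrable_exp_neg_mul_abs hc).const_mul C) hf (ae_of_all _ h)

lemma norm_cauchy_kernel_le {a : ℝ} (hs : Real.sin (a / 2) ≠ 0) (y x : ℝ) :
    ‖Complex.exp (x + a * Complex.I) / (Real.exp y - Complex.exp (x + a * Complex.I))‖ ≤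
      Real.exp x / (Real.exp y + Real.exp x) * |Real.sin (a / 2)|⁻¹ := by
  rw [norm_div, norm_cexp_line, ← div_eq_mul_inv, div_div]
  have := le_norm_sub_cexp_line y x a
  have h0 : 0 < |Real.sin (a / 2)| := abs_pos.2 hs
  gcongr

lemma exp_div_add_exp_le_one (y x : ℝ) : Real.exp x / (Real.exp y + Real.exp x) ≤ 1 := by
  rw [div_le_one (by positivity)]
  linarith [Real.exp_pos y]

lemma integrable_cauchy_mul {f : ℝ → ℂ} {a : ℝ} (hs : Real.sin (a / 2) ≠ 0)
    (hfi : Integrable f) (y : ℝ) : Integrable fun x : ℝ => f x *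
      (Complex.exp (x + a * Complex.I) / (Real.exp y - Complex.exp (x + a * Complex.I))) := by
  have hne : ∀ x : ℝ, (Real.exp y : ℂ) - Complex.exp (x + a * Complex.I) ≠ 0 := fun x =>
    norm_pos_iff.1 (lt_of_lt_of_le (by have := abs_pos.2 hs; positivity)
      (le_norm_sub_cexp_line y x a))
  refine hfi.mul_bdd (c := |Real.sin (a / 2)|⁻¹) ?_ (ae_of_all _ fun x => ?_)
  · refine Continuous.aestronglyMeasurable (Continuous.div (by fun_prop) (by fun_prop) hne)
  · refine (norm_cauchy_kernel_le hs y x).trans (mul_le_of_le_one_left (by positivity) ?_)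
    exact exp_div_add_exp_le_one y x

lemma integrable_cauchy_reference {a : ℝ} (ha : |a| < Real.pi) (ha0 : a ≠ 0) (y : ℝ) :
    Integrable fun x : ℝ => (1 + Real.exp y : ℂ) / (1 + Complex.exp (x + a * Complex.I)) *
      (Complex.exp (x + a * Complex.I) / (Real.exp y - Complex.exp (x + a * Complex.I))) := by
  have ha' := abs_lt.1 ha
  have hs : Real.sin (a / 2) ≠ 0 := by
    rcases lt_or_gt_of_ne ha0 with h | h
    · exact (Real.sin_neg_of_neg_of_neg_pi_lt (by linarith) (by linarith)).ne
    · exact (Real.sin_pos_of_pos_of_lt_pi (by linarith) (by linarith)).ne'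
  have hc : 0 < Real.cos (a / 2) := Real.cos_pos_of_mem_Ioo ⟨by linarith, by linarith⟩
  have hs0 := abs_pos.2 hs
  have hne : ∀ x : ℝ, (Real.exp y : ℂ) - Complex.exp (x + a * Complex.I) ≠ 0 := fun x =>
    norm_pos_iff.1 (lt_of_lt_of_le (by positivity) (le_norm_sub_cexp_line y x a))
  refine integrable_of_norm_le_exp_neg_abs (c := 1)
    (C := (1 + Real.exp y) * (Real.cos (a / 2))⁻¹ * |Real.sin (a / 2)|⁻¹ *
      (1 + (Real.exp y)⁻¹)) ?_ one_pos fun x => ?_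
  · refine Continuous.aestronglyMeasurable (Continuous.mul (Continuous.div (by fun_prop)
      (by fun_prop) fun x => one_add_cexp_ne_zero (mem_piStrip_line ha x))
      (Continuous.div (by fun_prop) (by fun_prop) hne))
  · rw [norm_mul, norm_div]
    have h1 : ‖(1 + Real.exp y : ℂ)‖ = 1 + Real.exp y := by
      rw [← Complex.ofReal_one, ← Complex.ofReal_add, Complex.norm_real,
        Real.norm_of_nonneg (by positivity)]
    have h2 := le_norm_one_add_cexp_line x a
    have h3 := norm_cauchy_kernel_le hs y x
    have hx : (1 + Real.exp x)⁻¹ * (Real.exp x / (Real.exp y + Real.exp x)) ≤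
        (1 + (Real.exp y)⁻¹) * Real.exp (-1 * |x|) := by
      have hy := Real.exp_pos y
      have hx := Real.exp_pos x
      rcases le_total 0 x with h | h
      · rw [abs_of_nonneg h]
        calc _ ≤ (Real.exp x)⁻¹ * 1 := by
              gcongr
              · linarith
              · exact exp_div_add_exp_le_one y x
          _ ≤ _ := by
              rw [mul_one, neg_one_mul, ← Real.exp_neg]
              exact le_mul_of_one_le_left (Real.exp_pos _).le (by
                have := inv_pos.2 hy; linarith)
      · rw [abs_of_nonpos h]
        calc _ ≤ 1 * (Real.exp x / Real.exp y) := by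
              gcongr
              · exact inv_le_one_of_one_le₀ (by linarith)
              · linarith
          _ ≤ _ := by
              rw [one_mul, neg_mul_neg, one_mul, div_eq_inv_mul]
              gcongr
              linarith
    rw [h1]
    calc (1 + Real.exp y) / ‖1 + Complex.exp (x + a * Complex.I)‖ * _ ≤
        (1 + Real.exp y) / ((1 + Real.exp x) * Real.cos (a / 2)) *
          (Real.exp x / (Real.exp y + Real.exp x) * |Real.sin (a / 2)|⁻¹) := by gcongr
      _ = (1 + Real.exp y) * (Real.cos (a / 2))⁻¹ * |Real.sin (a / 2)|⁻¹ *
          ((1 + Real.exp x)⁻¹ * (Real.exp x / (Real.exp y + Real.exp x))) := by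
        rw [div_eq_mul_inv, mul_inv]; ring
      _ ≤ (1 + Real.exp y) * (Real.cos (a / 2))⁻¹ * |Real.sin (a / 2)|⁻¹ *
          ((1 + (Real.exp y)⁻¹) * Real.exp (-1 * |x|)) := by gcongr
      _ = _ := by ring

/-- Cauchy's integral formula for a sector, in logarithmic coordinates. -/
lemma cauchy_strip {Φ : ℂ → ℂ} {a γ C : ℝ} (ha0 : 0 < a) (ha : a < Real.pi) (hγ : 0 < γ)
    (hΦ : DifferentiableOn ℂ Φ piStrip)
    (hb : ∀ x y : ℝ, |y| ≤ a → ‖Φ (x + y * Complex.I)‖ ≤ C * Real.exp (-γ * |x|)) (y : ℝ) :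
    (∫ x : ℝ, Φ (x + a * Complex.I) *
      (Complex.exp (x + a * Complex.I) / (Real.exp y - Complex.exp (x + a * Complex.I)))) -
    ∫ x : ℝ, Φ (x + (-a : ℝ) * Complex.I) * (Complex.exp (x + (-a : ℝ) * Complex.I) /
      (Real.exp y - Complex.exp (x + (-a : ℝ) * Complex.I))) =
      2 * Real.pi * Complex.I * Φ y := by
  have hπ := Real.pi_pos
  have hyS : (y : ℂ) ∈ piStrip := by simpa [piStrip] using hπ
  have habs : |a| < Real.pi := by rwa [abs_of_pos ha0]
  have habs' : |-a| < Real.pi := by rwa [abs_neg]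
  have hC : 0 ≤ C := by
    have := (norm_nonneg _).trans (hb 0 0 (by simpa using ha0.le))
    simpa using this
  have hs : Real.sin (a / 2) ≠ 0 :=
    (Real.sin_pos_of_pos_of_lt_pi (by linarith) (by linarith)).ne'
  have hs' : Real.sin (-a / 2) ≠ 0 := by rwa [neg_div, Real.sin_neg, neg_ne_zero]
  have hcont : ∀ b : ℝ, |b| < Real.pi → Continuous fun x : ℝ => Φ (x + b * Complex.I) :=
    fun b hb => hΦ.continuousOn.comp_continuous (by fun_prop) (mem_piStrip_line hb)
  -- A reference function equal to `1` at `y` and holomorphic in the strip. Subtracting `Φ(y) R`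
  -- cancels the pole of the Cauchy kernel, and the integral with `R` is known explicitly, so no
  -- residue has to be computed.
  let R : ℂ → ℂ := fun v => (1 + Real.exp y : ℂ) / (1 + Complex.exp v)
  have hR : DifferentiableOn ℂ R piStrip := fun v hv =>
    ((differentiableAt_const _).div (Complex.differentiable_exp.const_add 1 v)
      (one_add_cexp_ne_zero hv)).differentiableWithinAt
  let Ψ : ℂ → ℂ := fun v => Φ v - Φ y * R v
  have hΨ : DifferentiableOn ℂ Ψ piStrip := hΦ.sub (hR.const_mul _)
  have hΨy : Ψ y = 0 := by
    have : (1 + Complex.exp y : ℂ) ≠ 0 := one_add_cexp_ne_zero hyS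
    simp only [Ψ, R, Complex.ofReal_exp, div_self this, mul_one, sub_self]
  -- The quotient `Ψ(v) e^v/(e^y - e^v)` with its singularity removed. The denominator has no zero
  -- because `exp` takes the value `e^y` in the strip only at `y`.
  let q : ℂ → ℂ := fun v => -Complex.exp v * dslope Ψ y v / dslope Complex.exp y v
  have hnhds : piStrip ∈ 𝓝 (y : ℂ) := isOpen_piStrip.mem_nhds hyS
  have hq : DifferentiableOn ℂ q piStrip := by
    refine DifferentiableOn.div ((Complex.differentiable_exp.neg.differentiableOn).mul
      ((Complex.differentiableOn_dslope hnhds).2 hΨ))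
      ((Complex.differentiableOn_dslope hnhds).2 Complex.differentiable_exp.differentiableOn) ?_
    intro v hv
    rcases eq_or_ne v y with rfl | hvy
    · rw [dslope_same, Complex.deriv_exp]; exact Complex.exp_ne_zero _
    · rw [dslope_of_ne _ hvy, slope_def_field]
      exact div_ne_zero (sub_ne_zero.2 fun h => hvy (cexp_injOn_piStrip hv h)) (sub_ne_zero.2 hvy)
  have hqv : ∀ v : ℂ, v ≠ y → q v = Ψ v * (Complex.exp v / (Real.exp y - Complex.exp v)) := by
    intro v hvy
    simp only [q]
    rw [dslope_of_ne _ hvy, dslope_of_ne _ hvy, slope_def_field, slope_def_field, hΨy, sub_zero,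
      Complex.ofReal_exp, ← neg_sub (Complex.exp v) (Complex.exp y)]
    have := sub_ne_zero.2 hvy
    rcases eq_or_ne (Complex.exp v - Complex.exp y) 0 with h0 | h0
    · simp [h0]
    · field_simp
  have hneq : ∀ b : ℝ, b ≠ 0 → ∀ x : ℝ, (x + b * Complex.I : ℂ) ≠ y := by
    intro b hb x h
    have := congrArg Complex.im h
    simp at this
    exact hb this
  have hline : ∀ b : ℝ, |b| < Real.pi → b ≠ 0 → (∀ x : ℝ, ‖Φ (x + b * Complex.I)‖ ≤
      C * Real.exp (-γ * |x|)) → Real.sin (b / 2) ≠ 0 →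
      Integrable (fun x : ℝ => q (x + b * Complex.I)) ∧
      ∫ x : ℝ, q (x + b * Complex.I) = (∫ x : ℝ, Φ (x + b * Complex.I) *
      (Complex.exp (x + b * Complex.I) / (Real.exp y - Complex.exp (x + b * Complex.I)))) -
      Φ y * (Complex.log (Complex.exp (b * Complex.I)) -
        Complex.log (-Complex.exp (b * Complex.I)) + y) := by
    intro b hb hb0 hbd hsb
    have i1 := integrable_cauchy_mul hsb
      (integrable_of_norm_le_exp_neg_abs (hcont b hb).aestronglyMeasurable hγ hbd) y
    have i2 := integrable_cauchy_reference hb hb0 y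
    have e : (fun x : ℝ => q (x + b * Complex.I)) = fun x : ℝ => Φ (x + b * Complex.I) *
        (Complex.exp (x + b * Complex.I) / (Real.exp y - Complex.exp (x + b * Complex.I))) -
        Φ y * ((1 + Real.exp y : ℂ) / (1 + Complex.exp (x + b * Complex.I)) *
        (Complex.exp (x + b * Complex.I) / (Real.exp y - Complex.exp (x + b * Complex.I)))) := by
      funext x
      rw [hqv _ (hneq b hb0 x)]
      simp only [Ψ, R]
      ring
    rw [e]
    refine ⟨i1.sub (i2.const_mul _), ?_⟩
    rw [integral_sub i1 (i2.const_mul _), integral_const_mul, integral_cauchy_reference hb0 hb y i2]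
  obtain ⟨hi, he⟩ := hline a habs ha0.ne' (fun x => hb x a (abs_of_pos ha0).le) hs
  obtain ⟨hi', he'⟩ := hline (-a) habs' (neg_ne_zero.2 ha0.ne')
    (fun x => hb x (-a) (by rw [abs_neg, abs_of_pos ha0])) hs'
  have hcpos : 0 < Real.cos (a / 2) := Real.cos_pos_of_mem_Ioo ⟨by linarith, by linarith⟩
  set D := ‖Φ y‖ * ((1 + Real.exp y) * (Real.cos (a / 2))⁻¹) with hD
  have hbound : ∀ x : ℝ, x ≠ y → ∀ t : ℝ, |t| ≤ a → ‖q (x + t * Complex.I)‖ ≤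
      (C * Real.exp (-γ * |x|) + D * (1 + Real.exp x)⁻¹) *
        (Real.exp x / |Real.exp y - Real.exp x|) := by
    intro x hxy t ht
    have hne : (x + t * Complex.I : ℂ) ≠ y := fun h => hxy (by simpa using congrArg Complex.re h)
    have hpos : 0 < |Real.exp y - Real.exp x| :=
      abs_pos.2 (sub_ne_zero.2 fun h => hxy (Real.exp_injective h).symm)
    rw [hqv _ hne, norm_mul, norm_div, norm_cexp_line]
    have h1 : ‖Ψ (x + t * Complex.I)‖ ≤ C * Real.exp (-γ * |x|) + D * (1 + Real.exp x)⁻¹ := by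
      refine (norm_sub_le _ _).trans (add_le_add (hb x t ht) ?_)
      rw [norm_mul, hD, mul_assoc]
      refine mul_le_mul_of_nonneg_left ?_ (norm_nonneg _)
      simp only [R]
      rw [norm_div, div_eq_mul_inv, mul_assoc, ← mul_inv]
      have h2 : ‖(1 + Real.exp y : ℂ)‖ = 1 + Real.exp y := by
        rw [← Complex.ofReal_one, ← Complex.ofReal_add, Complex.norm_real,
          Real.norm_of_nonneg (by positivity)]
      rw [h2]
      have h3 : Real.cos (a / 2) ≤ Real.cos (t / 2) := by
        rw [← Real.cos_abs (t / 2), abs_div, abs_of_pos (two_pos (α := ℝ))]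
        exact Real.cos_le_cos_of_nonneg_of_le_pi (by positivity) (by linarith) (by linarith)
      have h4 : Real.cos (a / 2) * (1 + Real.exp x) ≤ ‖1 + Complex.exp (x + t * Complex.I)‖ := by
        refine le_trans ?_ (le_norm_one_add_cexp_line x t)
        rw [mul_comm]; gcongr
      gcongr
    have h2 : |Real.exp y - Real.exp x| ≤ ‖(Real.exp y : ℂ) - Complex.exp (x + t * Complex.I)‖ := by
      have := abs_norm_sub_norm_le (Real.exp y : ℂ) (Complex.exp (x + t * Complex.I))
      rwa [norm_cexp_line, Complex.norm_real, Real.norm_of_nonneg (Real.exp_pos y).le] at this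
    gcongr
  have hexpabs : Tendsto (fun x : ℝ => Real.exp (-γ * |x|)) (cocompact ℝ) (𝓝 0) := by
    have h1 : Tendsto (fun x : ℝ => -γ * |x|) (cocompact ℝ) atBot :=
      (tendsto_const_mul_atBot_of_neg (by linarith)).2 (tendsto_norm_cocompact_atTop (E := ℝ))
    exact Real.tendsto_exp_atBot.comp h1
  -- The factors share the work: at `+∞` the kernel is bounded and `Ψ` decays, while at `-∞` the
  -- part with `R` need not decay but the kernel is `O(e^x)`.
  have hBt : Tendsto (fun x : ℝ => (C * Real.exp (-γ * |x|) + D * (1 + Real.exp x)⁻¹) *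
        (Real.exp x / |Real.exp y - Real.exp x|)) atTop (𝓝 0) := by
    have h1 : Tendsto (fun x : ℝ => C * Real.exp (-γ * |x|)) atTop (𝓝 0) := by
      simpa using (hexpabs.mono_left (atTop_le_cocompact (α := ℝ))).const_mul C
    have h2 : Tendsto (fun x : ℝ => D * (1 + Real.exp x)⁻¹) atTop (𝓝 0) := by
      have := tendsto_inv_atTop_zero.comp (tendsto_const_nhds.add_atTop Real.tendsto_exp_atTop
        (f := fun _ => (1 : ℝ)))
      simpa [Function.comp_def] using this.const_mul D
    have h3 : Tendsto (fun x : ℝ => Real.exp x / |Real.exp y - Real.exp x|) atTop (𝓝 1) := by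
      have h4 : Tendsto (fun x : ℝ => |Real.exp y * Real.exp (-x) - 1|⁻¹) atTop (𝓝 1) := by
        have := ((Real.tendsto_exp_neg_atTop_nhds_zero.const_mul (Real.exp y)).sub_const 1).abs.inv₀
          (by simp)
        simpa using this
      refine h4.congr fun x => ?_
      have : Real.exp y - Real.exp x = Real.exp x * (Real.exp y * Real.exp (-x) - 1) := by
        rw [mul_sub, mul_left_comm, ← Real.exp_add]; simp
      rw [this, abs_mul, abs_of_pos (Real.exp_pos x), div_mul_eq_div_div,
        div_self (Real.exp_pos x).ne', one_div]
    simpa using (h1.add h2).mul h3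
  have hBb : Tendsto (fun x : ℝ => (C * Real.exp (-γ * |x|) + D * (1 + Real.exp x)⁻¹) *
        (Real.exp x / |Real.exp y - Real.exp x|)) atBot (𝓝 0) := by
    have h1 : Tendsto (fun x : ℝ => C * Real.exp (-γ * |x|)) atBot (𝓝 0) := by
      simpa using (hexpabs.mono_left (atBot_le_cocompact (α := ℝ))).const_mul C
    have h2 : Tendsto (fun x : ℝ => D * (1 + Real.exp x)⁻¹) atBot (𝓝 D) := by
      have := ((Real.tendsto_exp_atBot.const_add 1).inv₀ (by norm_num)).const_mul D
      simpa using this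
    have h3 : Tendsto (fun x : ℝ => Real.exp x / |Real.exp y - Real.exp x|) atBot (𝓝 0) := by
      have := Real.tendsto_exp_atBot.div ((Real.tendsto_exp_atBot.const_sub (Real.exp y)).abs)
        (by simp [(Real.exp_pos y).ne'])
      rw [zero_div] at this
      exact this
    simpa using (h1.add h2).mul h3
  have hkey := integral_line_eq_of_tendsto_zero ha0.le ha hq
    ((eventually_ne_atTop y).mono hbound) ((eventually_ne_atBot y).mono hbound) hBt hBb hi hi'
  rw [he, he'] at hkey
  -- The differences of logarithms are `iπ` on the upper line and `-iπ` on the lower one; together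
  -- they give the factor `2πi`.
  have l1 : Complex.log (Complex.exp (a * Complex.I)) = a * Complex.I :=
    Complex.log_exp (by simp; linarith) (by simp; linarith)
  have l2 : Complex.log (-Complex.exp (a * Complex.I)) = (a - Real.pi) * Complex.I := by
    have : -Complex.exp (a * Complex.I) = Complex.exp ((a - Real.pi) * Complex.I) := by
      rw [sub_mul, Complex.exp_sub, Complex.exp_pi_mul_I]; ring
    rw [this]
    exact Complex.log_exp (by simp; linarith) (by simp; linarith)
  have l3 : Complex.log (Complex.exp ((-a : ℝ) * Complex.I)) = -a * Complex.I := by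
    rw [Complex.log_exp (by simp; linarith) (by simp; linarith)]; push_cast; rfl
  have l4 : Complex.log (-Complex.exp ((-a : ℝ) * Complex.I)) = (Real.pi - a) * Complex.I := by
    have : -Complex.exp ((-a : ℝ) * Complex.I) = Complex.exp ((Real.pi - a) * Complex.I) := by
      rw [sub_mul, Complex.exp_sub, Complex.exp_pi_mul_I]
      push_cast
      rw [neg_mul, Complex.exp_neg]; ring
    rw [this]
    exact Complex.log_exp (by simp; linarith) (by simp; linarith)
  rw [l1, l2, l3, l4] at hkey
  linear_combination hkey

end Strip

/-! ### Laplace representation of functions holomorphic in a sector -/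

section Laplace

/-- The integrand, at the point `e^{x+ia}` of a ray, of the inverse Laplace transform at `l`. -/
noncomputable def laplaceKernel (f : ℝ → ℂ) (a x l : ℝ) : ℂ :=
  Complex.exp (l * Complex.exp (x + a * Complex.I)) * (f x * Complex.exp (x + a * Complex.I))

lemma continuous_laplaceKernel {f : ℝ → ℂ} (hf : Continuous f) (a : ℝ) :
    Continuous fun z : ℝ × ℝ => laplaceKernel f a z.1 z.2 := by
  unfold laplaceKernel; fun_prop

lemma norm_laplaceKernel (f : ℝ → ℂ) (a x l : ℝ) :
    ‖laplaceKernel f a x l‖ = Real.exp (-(-Real.cos a * Real.exp x * l)) * (‖f x‖ * Real.exp x) := by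
  rw [laplaceKernel, norm_mul, norm_mul, norm_cexp_line, Complex.norm_exp, Complex.re_ofReal_mul,
    cexp_line, Complex.re_ofReal_mul, Complex.exp_ofReal_mul_I_re]
  congr 2
  ring

/-- By Tonelli, the integral in `l` is a Gamma integral (hence `κ < 1`) that leaves a multiple of
`|f(x)| e^{κx}`, integrable as `|κ| < γ`. The decay of `f` thus becomes moments of the inverse
transform. -/
lemma integrable_laplaceKernel {f : ℝ → ℂ} (hf : Continuous f) {a γ C κ : ℝ} (hc : Real.cos a < 0)
    (hb : ∀ x, ‖f x‖ ≤ C * Real.exp (-γ * |x|)) (hκ : |κ| < γ) (hκ1 : κ < 1) :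
    Integrable (fun z : ℝ × ℝ => ((z.2 ^ (-κ) : ℝ) : ℂ) * laplaceKernel f a z.1 z.2)
      (volume.prod (volume.restrict (Ioi 0))) := by
  have hmeas : AEStronglyMeasurable
      (fun z : ℝ × ℝ => ((z.2 ^ (-κ) : ℝ) : ℂ) * laplaceKernel f a z.1 z.2)
      (volume.prod (volume.restrict (Ioi 0))) := by
    have := (continuous_laplaceKernel hf a).measurable
    refine Measurable.aestronglyMeasurable ?_
    fun_prop
  have hnorm : ∀ x l : ℝ, 0 < l → ‖((l ^ (-κ) : ℝ) : ℂ) * laplaceKernel f a x l‖ =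
      l ^ (1 - κ - 1) * Real.exp (-(-Real.cos a * Real.exp x * l)) * (‖f x‖ * Real.exp x) := by
    intro x l hl
    rw [norm_mul, Complex.norm_real, Real.norm_of_nonneg (Real.rpow_nonneg hl.le _),
      norm_laplaceKernel, mul_assoc]
    ring_nf
  have hpos : ∀ x : ℝ, 0 < -Real.cos a * Real.exp x := fun x =>
    mul_pos (by linarith) (Real.exp_pos x)
  rw [integrable_prod_iff hmeas]
  constructor
  · refine ae_of_all _ fun x => ?_
    have h1 : IntegrableOn (fun l : ℝ => l ^ (-κ) * Real.exp (-(-Real.cos a * Real.exp x) * l ^ (1 : ℝ)) *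
        (‖f x‖ * Real.exp x)) (Ioi 0) :=
      Integrable.mul_const (integrableOn_rpow_mul_exp_neg_mul_rpow (p := 1) (s := -κ)
        (by linarith) one_pos (hpos x)) _
    refine Integrable.mono' h1 ?_ ?_
    · have := (continuous_laplaceKernel hf a).measurable
      have h2 : Measurable (fun l => laplaceKernel f a x l) := this.comp measurable_prodMk_left
      refine Measurable.aestronglyMeasurable ?_
      fun_prop
    · refine (ae_restrict_iff' measurableSet_Ioi).2 (ae_of_all _ fun l hl => ?_)
      rw [hnorm x l hl, Real.rpow_one]
      exact le_of_eq (by ring_nf)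
  · have hval : ∀ x, ∫ l in Ioi 0, ‖((l ^ (-κ) : ℝ) : ℂ) * laplaceKernel f a x l‖ =
        ((-Real.cos a)⁻¹ ^ (1 - κ) * Real.Gamma (1 - κ)) * (‖f x‖ * Real.exp (κ * x)) := by
      intro x
      rw [setIntegral_congr_fun measurableSet_Ioi (fun l hl => hnorm x l hl), integral_mul_const,
        Real.integral_rpow_mul_exp_neg_mul_Ioi (by linarith) (hpos x), one_div, mul_inv,
        Real.mul_rpow (by rw [inv_nonneg]; linarith) (by positivity), ← Real.exp_neg,
        ← Real.exp_mul]
      have : Real.exp (κ * x) = Real.exp (-x * (1 - κ)) * Real.exp x := by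
        rw [← Real.exp_add]; ring_nf
      rw [this]; ring
    simp only [hval]
    refine Integrable.const_mul ?_ _
    refine Integrable.mono' ((integrable_exp_neg_mul_abs (c := γ - |κ|) (by linarith)).const_mul C)
      (by fun_prop) (ae_of_all _ fun x => ?_)
    rw [Real.norm_of_nonneg (by positivity)]
    have hC : 0 ≤ C := by
      have := (norm_nonneg _).trans (hb 0)
      simpa using this
    have h1 : Real.exp (κ * x) ≤ Real.exp (|κ| * |x|) :=
      Real.exp_le_exp.2 ((le_abs_self _).trans (abs_mul _ _).le)
    calc _ ≤ C * Real.exp (-γ * |x|) * Real.exp (|κ| * |x|) :=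
          mul_le_mul (hb x) h1 (Real.exp_pos _).le (by positivity)
      _ = _ := by rw [mul_assoc, ← Real.exp_add]; ring_nf

/-- The inverse Laplace transform along one ray. -/
noncomputable def rayLaplace (f : ℝ → ℂ) (a l : ℝ) : ℂ := ∫ x, laplaceKernel f a x l

lemma stronglyMeasurable_rayLaplace {f : ℝ → ℂ} (hf : Continuous f) (a : ℝ) :
    StronglyMeasurable (rayLaplace f a) := by
  have h := (continuous_laplaceKernel hf a).comp continuous_swap
  exact StronglyMeasurable.integral_prod_right' (f := fun z : ℝ × ℝ => laplaceKernel f a z.2 z.1)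
    h.stronglyMeasurable

lemma integrableOn_rayLaplace {f : ℝ → ℂ} (hf : Continuous f) {a γ C κ : ℝ} (hc : Real.cos a < 0)
    (hb : ∀ x, ‖f x‖ ≤ C * Real.exp (-γ * |x|)) (hκ : |κ| < γ) (hκ1 : κ < 1) :
    IntegrableOn (fun l => ((l ^ (-κ) : ℝ) : ℂ) * rayLaplace f a l) (Ioi 0) := by
  have h := (integrable_laplaceKernel hf hc hb hκ hκ1).integral_prod_right
  simp only [integral_const_mul] at h
  exact h

/-- For `Re w < 0`, `∫ e^{-l(e^y - w)} dl = 1/(e^y - w)`: Fubini turns the Laplace transform into a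
Cauchy integral over the ray. -/
lemma integral_exp_mul_rayLaplace {f : ℝ → ℂ} (hf : Continuous f) {a γ C : ℝ} (hc : Real.cos a < 0)
    (hb : ∀ x, ‖f x‖ ≤ C * Real.exp (-γ * |x|)) (hγ : 0 < γ) (y : ℝ) :
    ∫ l in Ioi (0 : ℝ), ((Real.exp (-(l * Real.exp y)) : ℝ) : ℂ) * rayLaplace f a l =
      ∫ x, f x * (Complex.exp (x + a * Complex.I) /
        (Real.exp y - Complex.exp (x + a * Complex.I))) := by
  have h0 := integrable_laplaceKernel hf hc hb (κ := 0) (by simpa using hγ) one_pos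
  have hint : Integrable (fun z : ℝ × ℝ => ((Real.exp (-(z.2 * Real.exp y)) : ℝ) : ℂ) *
      laplaceKernel f a z.1 z.2) (volume.prod (volume.restrict (Ioi 0))) := by
    refine h0.mono ?_ ?_
    · have := (continuous_laplaceKernel hf a)
      refine Continuous.aestronglyMeasurable ?_
      fun_prop
    · have hz : ∀ᵐ z : ℝ × ℝ ∂(volume.prod (volume.restrict (Ioi 0))), z.2 ∈ Ioi (0 : ℝ) :=
        Measure.quasiMeasurePreserving_snd.ae (ae_restrict_mem measurableSet_Ioi)
      filter_upwards [hz] with z hz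
      have hz : 0 < z.2 := hz
      rw [norm_mul, norm_mul]
      refine mul_le_mul_of_nonneg_right ?_ (norm_nonneg _)
      rw [neg_zero, Real.rpow_zero, Complex.ofReal_one, norm_one, Complex.norm_real,
        Real.norm_of_nonneg (Real.exp_pos _).le]
      exact Real.exp_le_one_iff.2 (by have := Real.exp_pos y; nlinarith)
  simp only [rayLaplace, ← integral_const_mul]
  rw [← integral_integral_swap hint]
  refine integral_congr_ae (ae_of_all _ fun x => ?_)
  set w := Complex.exp (x + a * Complex.I) with hw
  have hre : (w - Real.exp y).re < 0 := by
    rw [hw, cexp_line, Complex.sub_re, Complex.re_ofReal_mul, Complex.exp_ofReal_mul_I_re,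
      Complex.ofReal_re]
    nlinarith [Real.exp_pos x, Real.exp_pos y]
  have hne : w - Real.exp y ≠ 0 := fun h => by rw [h] at hre; simp at hre
  have h1 : ∀ l : ℝ, ((Real.exp (-(l * Real.exp y)) : ℝ) : ℂ) * laplaceKernel f a x l =
      Complex.exp ((w - Real.exp y) * l) * (f x * w) := by
    intro l
    rw [laplaceKernel, ← hw, Complex.ofReal_exp, ← mul_assoc, ← Complex.exp_add]
    congr 2
    push_cast
    ring
  simp only [h1]
  rw [integral_mul_const, integral_exp_mul_complex_Ioi hre]
  have hne' : (Real.exp y : ℂ) - w ≠ 0 := by rw [← neg_sub]; exact neg_ne_zero.2 hne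
  rw [Complex.ofReal_zero, mul_zero, Complex.exp_zero, ← neg_sub (Real.exp y : ℂ) w, ← hw, neg_div_neg_eq]
  ring

/-- A function that is holomorphic in a sector of opening larger than `π` and decays at `0` and
`∞` is a Laplace transform (in logarithmic coordinates). -/
theorem exists_laplace_of_strip {Φ : ℂ → ℂ} {a γ C : ℝ} (ha0 : Real.pi / 2 < a) (ha : a < Real.pi)
    (hγ : 0 < γ) (hΦ : DifferentiableOn ℂ Φ piStrip)
    (hb : ∀ x y : ℝ, |y| ≤ a → ‖Φ (x + y * Complex.I)‖ ≤ C * Real.exp (-γ * |x|)) :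
    ∃ h : ℝ → ℂ, Measurable h ∧
      (∀ κ : ℝ, |κ| < γ → κ < 1 →
        IntegrableOn (fun l => ((l ^ (-κ) : ℝ) : ℂ) * h l) (Ioi 0)) ∧
      ∀ y : ℝ, Φ y = ∫ l in Ioi (0 : ℝ), ((Real.exp (-(l * Real.exp y)) : ℝ) : ℂ) * h l := by
  have hπ := Real.pi_pos
  have habs : |a| = a := abs_of_pos (by linarith)
  have hc : Real.cos a < 0 := Real.cos_neg_of_pi_div_two_lt_of_lt ha0 (by linarith)
  have hc' : Real.cos (-a) < 0 := by rwa [Real.cos_neg]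
  have hcont : ∀ b : ℝ, |b| < Real.pi → Continuous fun x : ℝ => Φ (x + b * Complex.I) :=
    fun b hb => hΦ.continuousOn.comp_continuous (by fun_prop) (mem_piStrip_line hb)
  have c1 := hcont a (by rwa [habs])
  have c2 := hcont (-a) (by rwa [abs_neg, habs])
  have b1 := fun x => hb x a habs.le
  have b2 := fun x => hb x (-a) (by rw [abs_neg, habs])
  set f₁ : ℝ → ℂ := fun x => Φ (x + a * Complex.I) with hf₁
  set f₂ : ℝ → ℂ := fun x => Φ (x + (-a : ℝ) * Complex.I) with hf₂
  have hint : ∀ κ : ℝ, |κ| < γ → κ < 1 → IntegrableOn (fun l => ((l ^ (-κ) : ℝ) : ℂ) *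
      ((2 * Real.pi * Complex.I)⁻¹ * (rayLaplace f₁ a l - rayLaplace f₂ (-a) l))) (Ioi 0) := by
    intro κ hκ hκ1
    have h1 := integrableOn_rayLaplace c1 hc b1 hκ hκ1
    have h2 := integrableOn_rayLaplace c2 hc' b2 hκ hκ1
    refine IntegrableOn.congr_fun ((Integrable.sub h1 h2).const_mul (2 * Real.pi * Complex.I)⁻¹)
      (fun l _ => ?_) measurableSet_Ioi
    simp only [Pi.sub_apply]
    ring
  -- The Bromwich integral over the boundary of the sector. Since `a > π/2`, the factor `e^{lw}`
  -- decays on both rays.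
  refine ⟨fun l => (2 * Real.pi * Complex.I)⁻¹ * (rayLaplace f₁ a l - rayLaplace f₂ (-a) l),
    ?_, hint, fun y => ?_⟩
  · exact ((stronglyMeasurable_rayLaplace c1 a).measurable.sub
      (stronglyMeasurable_rayLaplace c2 (-a)).measurable).const_mul _
  · have hexpi : ∀ (f : ℝ → ℂ) (b : ℝ), Continuous f → Real.cos b < 0 →
        (∀ x, ‖f x‖ ≤ C * Real.exp (-γ * |x|)) → IntegrableOn (fun l : ℝ =>
          ((Real.exp (-(l * Real.exp y)) : ℝ) : ℂ) * rayLaplace f b l) (Ioi 0) := by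
      intro f b hf hcb hbd
      have h := integrableOn_rayLaplace hf hcb hbd (κ := 0) (by simpa using hγ) one_pos
      simp only [neg_zero, Real.rpow_zero, Complex.ofReal_one, one_mul] at h
      refine Integrable.bdd_mul (c := 1) h (by fun_prop) ?_
      refine (ae_restrict_iff' measurableSet_Ioi).2 (ae_of_all _ fun l hl => ?_)
      have hl : 0 < l := hl
      rw [Complex.norm_real, Real.norm_of_nonneg (Real.exp_pos _).le]
      exact Real.exp_le_one_iff.2 (by have := Real.exp_pos y; nlinarith)
    have e1 := integral_exp_mul_rayLaplace c1 hc b1 hγ y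
    have e2 := integral_exp_mul_rayLaplace c2 hc' b2 hγ y
    have hk := cauchy_strip (by linarith) ha hγ hΦ hb y
    have hsum : ∀ l : ℝ, ((Real.exp (-(l * Real.exp y)) : ℝ) : ℂ) *
        ((2 * Real.pi * Complex.I)⁻¹ * (rayLaplace f₁ a l - rayLaplace f₂ (-a) l)) =
        (2 * Real.pi * Complex.I)⁻¹ * (((Real.exp (-(l * Real.exp y)) : ℝ) : ℂ) * rayLaplace f₁ a l -
          ((Real.exp (-(l * Real.exp y)) : ℝ) : ℂ) * rayLaplace f₂ (-a) l) := fun l => by ring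
    simp only [hsum]
    rw [integral_const_mul, integral_sub (hexpi _ _ c1 hc b1) (hexpi _ _ c2 hc' b2), e1, e2, hk,
      inv_mul_cancel_left₀ Complex.two_pi_I_ne_zero]

end Laplace

/-! ### `E_{α,α}` as a Laplace transform -/

section Subordination

/-- `E_{α,α}` along the negative axis, in logarithmic coordinates and with its value at the origin
removed. -/
noncomputable def mittagLefflerStrip (α θ γ : ℝ) (v : ℂ) : ℂ :=
  mittagLeffler α α (-Complex.exp (θ * Complex.I + γ * v)) -
    mittagLeffler α α 0 / (1 + Complex.exp v)

lemma differentiableOn_mittagLefflerStrip {α : ℝ} (hα : 0 < α) (θ γ : ℝ) :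
    DifferentiableOn ℂ (mittagLefflerStrip α θ γ) piStrip := by
  intro v hv
  have h1 : DifferentiableAt ℂ (fun v : ℂ =>
      mittagLeffler α α (-Complex.exp (θ * Complex.I + γ * v))) v := by
    refine (differentiable_mittagLeffler hα _).comp v ?_
    fun_prop
  have h2 : DifferentiableAt ℂ (fun v : ℂ => mittagLeffler α α 0 / (1 + Complex.exp v)) v :=
    (differentiableAt_const _).div (Complex.differentiable_exp.const_add 1 v)
      (one_add_cexp_ne_zero hv)
  exact (h1.sub h2).differentiableWithinAt

lemma exists_norm_mittagLeffler_sub_le {α : ℝ} (hα : 0 < α) :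
    ∃ M : ℝ, 0 ≤ M ∧ ∀ z : ℂ, ‖z‖ ≤ 1 → ‖mittagLeffler α α z - mittagLeffler α α 0‖ ≤ M * ‖z‖ := by
  have hd := differentiable_mittagLeffler hα
  obtain ⟨M, hM⟩ := (isCompact_closedBall (0 : ℂ) 1).exists_bound_of_continuousOn
    (hd.deriv.continuous.continuousOn)
  refine ⟨M, (norm_nonneg _).trans (hM 0 (Metric.mem_closedBall_self zero_le_one)), fun z hz => ?_⟩
  have := (convex_closedBall (0 : ℂ) 1).norm_image_sub_le_of_norm_deriv_le
    (fun w _ => hd w) hM (Metric.mem_closedBall_self zero_le_one) (mem_closedBall_zero_iff.2 hz)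
  simpa using this

/-- The condition `|θ| + γa ≤ η₀` keeps the argument of `E_{α,α}` in the sector of decay, which
settles `x ≥ 0`. For `x ≤ 0` the subtracted term cancels `E_{α,α}(0)` and the remainder is
`O(e^{γx})`. -/
lemma exists_norm_mittagLefflerStrip_le {α θ γ η₀ a : ℝ} (hα : 0 < α)
    (hη₀ : η₀ < Real.pi - α * (Real.pi / 2)) (hγ : 0 < γ) (hγ1 : γ ≤ 1) (ha0 : 0 ≤ a)
    (ha : a < Real.pi) (hθ : |θ| + γ * a ≤ η₀) :
    ∃ C : ℝ, ∀ x y : ℝ, |y| ≤ a →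
      ‖mittagLefflerStrip α θ γ (x + y * Complex.I)‖ ≤ C * Real.exp (-γ * |x|) := by
  have hη0 : 0 ≤ η₀ := le_trans (by positivity) hθ
  obtain ⟨C, hC0, hC⟩ := exists_mittagLeffler_le hα hη0 hη₀
  obtain ⟨M, hM0, hM⟩ := exists_norm_mittagLeffler_sub_le hα
  have hcpos : 0 < Real.cos (a / 2) := Real.cos_pos_of_mem_Ioo ⟨by linarith, by linarith⟩
  set A := ‖mittagLeffler α α 0‖ * (Real.cos (a / 2))⁻¹ with hA
  have hA0 : 0 ≤ A := by positivity
  refine ⟨C + M + A, fun x y hy => ?_⟩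
  have hz : -Complex.exp (θ * Complex.I + γ * (x + y * Complex.I)) =
      -((Real.exp (γ * x) : ℂ) * Complex.exp ((θ + γ * y : ℝ) * Complex.I)) := by
    rw [Complex.ofReal_exp, ← Complex.exp_add]
    congr 2
    push_cast
    ring
  have hnz : ‖-Complex.exp (θ * Complex.I + γ * (x + y * Complex.I))‖ = Real.exp (γ * x) := by
    rw [norm_neg, Complex.norm_exp]; simp
  have hden : Real.cos (a / 2) * (1 + Real.exp x) ≤ ‖1 + Complex.exp (x + y * Complex.I)‖ := by
    refine le_trans ?_ (le_norm_one_add_cexp_line x y)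
    have : Real.cos (a / 2) ≤ Real.cos (y / 2) := by
      rw [← Real.cos_abs (y / 2), abs_div, abs_of_pos (two_pos (α := ℝ))]
      exact Real.cos_le_cos_of_nonneg_of_le_pi (by positivity) (by linarith) (by linarith)
    rw [mul_comm]; gcongr
  have hden' : ‖1 + Complex.exp (x + y * Complex.I)‖⁻¹ ≤
      (Real.cos (a / 2))⁻¹ * (1 + Real.exp x)⁻¹ := by
    rw [← mul_inv]
    exact inv_anti₀ (by positivity) hden
  rcases le_total 0 x with hx | hx
  · rw [abs_of_nonneg hx]
    have h1 : ‖mittagLeffler α α (-Complex.exp (θ * Complex.I + γ * (x + y * Complex.I)))‖ ≤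
        C * Real.exp (-γ * x) := by
      rw [hz]
      refine (hC _ _ (Real.exp_pos _) ?_).trans ?_
      · refine (abs_add_le _ _).trans (le_trans (add_le_add le_rfl ?_) hθ)
        rw [abs_mul, abs_of_pos hγ]; gcongr
      · rw [div_eq_mul_inv, neg_mul, Real.exp_neg]
        gcongr
        linarith
    have h2 : (1 + Real.exp x)⁻¹ ≤ Real.exp (-γ * x) := by
      rw [neg_mul, Real.exp_neg]
      refine inv_anti₀ (Real.exp_pos _) ?_
      have : Real.exp (γ * x) ≤ Real.exp x := Real.exp_le_exp.2 (by nlinarith)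
      linarith
    refine (norm_sub_le _ _).trans ?_
    rw [norm_div, div_eq_mul_inv]
    calc _ ≤ C * Real.exp (-γ * x) + ‖mittagLeffler α α 0‖ *
          ((Real.cos (a / 2))⁻¹ * Real.exp (-γ * x)) := by
          refine add_le_add h1 (mul_le_mul_of_nonneg_left (hden'.trans ?_) (norm_nonneg _))
          gcongr
      _ ≤ _ := by
          rw [← mul_assoc, ← hA]
          have := mul_nonneg hM0 (Real.exp_pos (-γ * x)).le
          nlinarith
  · rw [abs_of_nonpos hx, neg_mul_neg]
    have hγx : Real.exp (γ * x) ≤ 1 := Real.exp_le_one_iff.2 (mul_nonpos_of_nonneg_of_nonpos hγ.le hx)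
    have h1 := hM _ (hnz.trans_le hγx)
    rw [hnz] at h1
    have hne : 1 + Complex.exp (x + y * Complex.I) ≠ 0 :=
      norm_pos_iff.1 (lt_of_lt_of_le (by positivity) hden)
    have e : mittagLefflerStrip α θ γ (x + y * Complex.I) =
        (mittagLeffler α α (-Complex.exp (θ * Complex.I + γ * (x + y * Complex.I))) -
          mittagLeffler α α 0) + mittagLeffler α α 0 *
          (Complex.exp (x + y * Complex.I) / (1 + Complex.exp (x + y * Complex.I))) := by
      have e0 : Complex.exp (x + y * Complex.I) / (1 + Complex.exp (x + y * Complex.I)) =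
          1 - 1 / (1 + Complex.exp (x + y * Complex.I)) := by
        rw [eq_sub_iff_add_eq, ← add_div, add_comm, div_self hne]
      rw [mittagLefflerStrip, e0]
      ring
    rw [e]
    refine (norm_add_le _ _).trans ?_
    rw [norm_mul, norm_div, norm_cexp_line, div_eq_mul_inv]
    have hex : Real.exp x ≤ Real.exp (γ * x) := Real.exp_le_exp.2 (by nlinarith)
    have h2 : Real.exp x * ‖1 + Complex.exp (x + y * Complex.I)‖⁻¹ ≤
        Real.exp (γ * x) * (Real.cos (a / 2))⁻¹ := by
      refine mul_le_mul hex (hden'.trans (mul_le_of_le_one_right (by positivity) ?_)) (by positivity)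
        (Real.exp_pos _).le
      exact inv_le_one_of_one_le₀ (by linarith [Real.exp_pos x])
    calc _ ≤ M * Real.exp (γ * x) + ‖mittagLeffler α α 0‖ *
          (Real.exp (γ * x) * (Real.cos (a / 2))⁻¹) := by gcongr
      _ ≤ _ := by
          have := mul_nonneg hC0 (Real.exp_pos (γ * x)).le
          rw [hA]
          nlinarith

/-- `ρ ↦ E_{α,α}(-e^{iθ} ρ^γ)` is the Laplace transform of a function with integrable moments, for
small `γ`. -/
theorem exists_laplace_mittagLeffler {α θ : ℝ} (hα : 0 < α)
    (hθ : |θ| < Real.pi - α * (Real.pi / 2)) :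
    ∃ γ₀ : ℝ, 0 < γ₀ ∧ ∀ γ : ℝ, 0 < γ → γ < γ₀ → ∃ h : ℝ → ℂ, Measurable h ∧
      (∀ κ : ℝ, 0 ≤ κ → κ < γ → IntegrableOn (fun l => ((l ^ (-κ) : ℝ) : ℂ) * h l) (Ioi 0)) ∧
      ∀ ρ : ℝ, 0 < ρ → mittagLeffler α α (-(Complex.exp (θ * Complex.I) * (ρ ^ γ : ℝ))) =
        ∫ l in Ioi (0 : ℝ), ((Real.exp (-(l * ρ)) : ℝ) : ℂ) * h l := by
  have hπ := Real.pi_pos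
  obtain ⟨η₀, h1, h2⟩ := exists_between hθ
  -- A small `γ` compresses the sector of half-opening `3π/4` in `ρ`, wider than the `π/2` needed
  -- for inversion, into the sector of decay of `E_{α,α}`.
  refine ⟨min 1 ((η₀ - |θ|) / Real.pi), lt_min one_pos (div_pos (by linarith) hπ),
    fun γ hγ hγ₀ => ?_⟩
  have hγ1 := hγ₀.trans_le (min_le_left _ _)
  have hγ2 := hγ₀.trans_le (min_le_right _ _)
  rw [lt_div_iff₀ hπ] at hγ2
  obtain ⟨C, hC⟩ := exists_norm_mittagLefflerStrip_le (θ := θ) (a := 3 * Real.pi / 4) hα h2 hγ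
    hγ1.le (by positivity) (by linarith) (by nlinarith)
  obtain ⟨h, hm, hi, hL⟩ := exists_laplace_of_strip (by linarith) (by linarith) hγ
    (differentiableOn_mittagLefflerStrip hα θ γ) hC
  have hexp : ∀ s : ℝ, 0 ≤ s → ∀ κ : ℝ, κ < 1 → IntegrableOn (fun l : ℝ =>
      ((l ^ (-κ) : ℝ) : ℂ) * ((Real.exp (-((s + 1) * l)) : ℝ) : ℂ)) (Ioi 0) := by
    intro s hs κ hκ
    have := integrableOn_rpow_mul_exp_neg_mul_rpow (p := 1) (s := -κ) (b := s + 1)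
      (by linarith) one_pos (by linarith)
    have h2 : IntegrableOn (fun l : ℝ =>
        ((l ^ (-κ) * Real.exp (-(s + 1) * l ^ (1 : ℝ)) : ℝ) : ℂ)) (Ioi 0) := Integrable.ofReal this
    refine IntegrableOn.congr_fun h2 (fun l _ => ?_) measurableSet_Ioi
    simp only [Real.rpow_one, neg_mul]
    push_cast
    rfl
  -- The transform of `e^{-l}` is `1/(1+ρ)`, so this restores the term removed in
  -- `mittagLefflerStrip`.
  refine ⟨fun l => h l + mittagLeffler α α 0 * ((Real.exp (-l) : ℝ) : ℂ), by fun_prop,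
    fun κ hκ0 hκ => ?_, fun ρ hρ => ?_⟩
  · have e1 := hi κ (by rwa [abs_of_nonneg hκ0]) (by linarith)
    have e2 := (hexp 0 le_rfl κ (by linarith)).const_mul (mittagLeffler α α 0)
    refine IntegrableOn.congr_fun (Integrable.add e1 e2) (fun l _ => ?_) measurableSet_Ioi
    simp only [Pi.add_apply, zero_add, one_mul]
    ring
  · have hl := hL (Real.log ρ)
    rw [Real.exp_log hρ] at hl
    have e3 : mittagLefflerStrip α θ γ (Real.log ρ : ℝ) =
        mittagLeffler α α (-(Complex.exp (θ * Complex.I) * (ρ ^ γ : ℝ))) -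
        mittagLeffler α α 0 / (1 + ρ) := by
      rw [mittagLefflerStrip, Complex.exp_add, ← Complex.ofReal_exp (Real.log ρ),
        Real.exp_log hρ, ← Complex.ofReal_mul, ← Complex.ofReal_exp, Real.rpow_def_of_pos hρ,
        mul_comm γ]
    rw [e3, sub_eq_iff_eq_add] at hl
    rw [hl]
    have i0 := hi 0 (by simpa using hγ) one_pos
    simp only [neg_zero, Real.rpow_zero, Complex.ofReal_one, one_mul] at i0
    have i1 : IntegrableOn (fun l : ℝ => ((Real.exp (-(l * ρ)) : ℝ) : ℂ) * h l) (Ioi 0) := by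
      refine Integrable.bdd_mul (c := 1) i0 (by fun_prop) ?_
      refine (ae_restrict_iff' measurableSet_Ioi).2 (ae_of_all _ fun l hl => ?_)
      have hl : 0 < l := hl
      rw [Complex.norm_real, Real.norm_of_nonneg (Real.exp_pos _).le]
      exact Real.exp_le_one_iff.2 (by nlinarith)
    have e4 : ∀ l : ℝ, ((Real.exp (-(l * ρ)) : ℝ) : ℂ) *
        (h l + mittagLeffler α α 0 * ((Real.exp (-l) : ℝ) : ℂ)) =
        ((Real.exp (-(l * ρ)) : ℝ) : ℂ) * h l +
          mittagLeffler α α 0 * ((Real.exp (-(ρ + 1) * l) : ℝ) : ℂ) := by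
      intro l
      have : Real.exp (-(ρ + 1) * l) = Real.exp (-(l * ρ)) * Real.exp (-l) := by
        rw [← Real.exp_add]; ring_nf
      rw [this]; push_cast; ring
    have i2 : IntegrableOn (fun l : ℝ => mittagLeffler α α 0 *
        ((Real.exp (-(ρ + 1) * l) : ℝ) : ℂ)) (Ioi 0) := by
      have := (hexp ρ hρ.le 0 one_pos).const_mul (mittagLeffler α α 0)
      simp only [neg_zero, Real.rpow_zero, Complex.ofReal_one, one_mul, ← neg_mul] at this
      exact this
    simp only [e4]
    rw [integral_add i1 i2, integral_const_mul, integral_complex_ofReal,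
      integral_exp_mul_Ioi (by linarith)]
    congr 1
    simp only [mul_zero, Real.exp_zero]
    rw [neg_div_neg_eq]
    push_cast
    rw [add_comm (ρ : ℂ)]
    ring

end Subordination

/-! ### Heat kernels of order `4k` -/

section Profile

lemma exists_abs_eval_mul_gaussian_le (P : Polynomial ℝ) :
    ∃ C : ℝ, ∀ x : ℝ, |P.eval x| * Real.exp (-(x ^ 2 / 2)) ≤ C := by
  induction P using Polynomial.induction_on' with
  | add p q hp hq =>
    obtain ⟨C, hC⟩ := hp
    obtain ⟨D, hD⟩ := hq
    refine ⟨C + D, fun x => ?_⟩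
    rw [Polynomial.eval_add]
    have h := mul_le_mul_of_nonneg_right (abs_add_le (p.eval x) (q.eval x))
      (Real.exp_pos (-(x ^ 2 / 2))).le
    linarith [hC x, hD x]
  | monomial n a =>
    refine ⟨|a| * (1 + 2 ^ n * n.factorial), fun x => ?_⟩
    rw [Polynomial.eval_monomial, abs_mul, mul_assoc]
    refine mul_le_mul_of_nonneg_left ?_ (abs_nonneg a)
    have hf : (0 : ℝ) < n.factorial := by exact_mod_cast n.factorial_pos
    have h1 := Real.pow_div_factorial_le_exp (x ^ 2 / 2) (by positivity) n
    rw [div_le_iff₀ hf, div_pow, div_le_iff₀ (by positivity)] at h1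
    have h2 : |x ^ n| ≤ 1 + (x ^ 2) ^ n := by
      rw [abs_pow, ← sq_abs, ← pow_mul, mul_comm, pow_mul]
      nlinarith [sq_nonneg (|x| ^ n - 1)]
    have h3 : (1 : ℝ) ≤ Real.exp (x ^ 2 / 2) := Real.one_le_exp (by positivity)
    rw [Real.exp_neg, ← div_eq_mul_inv, div_le_iff₀ (Real.exp_pos _)]
    nlinarith

/-- The Gaussian `e^{-x²/2}` as a Schwartz function. -/
noncomputable def gaussianSchwartz : 𝓢(ℝ, ℝ) where
  toFun x := Real.exp (-(x ^ 2 / 2))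
  smooth' := by fun_prop
  decay' k n := by
    obtain ⟨C, hC⟩ := exists_abs_eval_mul_gaussian_le
      (Polynomial.X ^ k * (Polynomial.hermite n).map (Int.castRingHom ℝ))
    refine ⟨C, fun x => le_trans (le_of_eq ?_) (hC x)⟩
    rw [norm_iteratedFDeriv_eq_norm_iteratedDeriv, iteratedDeriv_eq_iterate,
      Polynomial.deriv_gaussian_eq_hermite_mul_gaussian, Polynomial.eval_mul, Polynomial.eval_pow,
      Polynomial.eval_X, Polynomial.eval_map, norm_mul, norm_mul, norm_pow, norm_neg, norm_one,
      one_pow, one_mul, abs_mul, abs_pow, Real.norm_eq_abs, Real.norm_eq_abs, Real.norm_eq_abs,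
      abs_of_pos (Real.exp_pos _), ← mul_assoc]
    rfl

variable {d : ℕ}

/-- The stretched exponential `e^{-s |ξ|^{4k}}` is a Schwartz function. -/
lemma exists_schwartz_stretched {k : ℕ} (hk : 0 < k) {s : ℝ} (hs : 0 < s) :
    ∃ ψ : 𝓢(Space d, ℂ), ∀ ξ, ψ ξ = ((Real.exp (-(s * ‖ξ‖ ^ (4 * k))) : ℝ) : ℂ) := by
  -- The function is the Gaussian `e^{-x²/2}` composed with the polynomial `c|ξ|^{2k}`, where `c²/2
  -- = s`. The order `4k` makes `|ξ|^{2k}` smooth as well as its square.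
  set c := Real.sqrt (2 * s) with hc
  have hc0 : 0 < c := Real.sqrt_pos.2 (by linarith)
  have hcs : c ^ 2 = 2 * s := Real.sq_sqrt (by linarith)
  let g : Space d → ℝ := fun ξ => c * (‖ξ‖ ^ 2) ^ k
  have hg : g.HasTemperateGrowth :=
    (Function.HasTemperateGrowth.const c).mul
      ((Function.hasTemperateGrowth_norm_sq (Space d)).pow k)
  have hgu : ∃ (j : ℕ) (C : ℝ), ∀ x, ‖x‖ ≤ C * (1 + ‖g x‖) ^ j := by
    refine ⟨1, 1 + c⁻¹, fun x => ?_⟩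
    have h0 : 0 ≤ (‖x‖ ^ 2) ^ k := by positivity
    have h1 : ‖x‖ ≤ 1 + (‖x‖ ^ 2) ^ k := by
      rcases le_total ‖x‖ 1 with h | h
      · linarith
      · have : ‖x‖ ^ 1 ≤ ‖x‖ ^ (2 * k) := pow_le_pow_right₀ h (by omega)
        rw [pow_one, pow_mul] at this
        linarith
    have h2 : ‖g x‖ = c * (‖x‖ ^ 2) ^ k := Real.norm_of_nonneg (by positivity)
    rw [h2, pow_one]
    have h3 : c⁻¹ * (c * (‖x‖ ^ 2) ^ k) = (‖x‖ ^ 2) ^ k := by field_simp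
    have : 0 < c⁻¹ := inv_pos.2 hc0
    nlinarith [mul_nonneg hc0.le h0]
  refine ⟨(SchwartzMap.compCLM ℝ hg hgu gaussianSchwartz).postcompCLM Complex.ofRealCLM, fun ξ => ?_⟩
  change ((Real.exp (-(g ξ ^ 2 / 2)) : ℝ) : ℂ) = _
  congr 3
  simp only [g]
  rw [mul_pow, hcs, ← pow_mul, ← pow_mul]
  ring_nf

/-- The inverse Fourier transform of `e^{-|ξ|^{4k}}`. -/
noncomputable def heatBase (d k : ℕ) : Space d → ℂ :=
  𝓕⁻ (fun ξ : Space d => ((Real.exp (-‖ξ‖ ^ (4 * k)) : ℝ) : ℂ))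

/-- The inverse Fourier transform of `e^{-s|ξ|^{4k}}`, as a dilation of `heatBase`. -/
noncomputable def heatKernel (d k : ℕ) (s : ℝ) (x : Space d) : ℂ :=
  ((s ^ (-(d / (4 * k) : ℝ)) : ℝ) : ℂ) * heatBase d k (s ^ (-(1 / (4 * k) : ℝ)) • x)

lemma exists_schwartz_heatBase {k : ℕ} (hk : 0 < k) : ∃ G : 𝓢(Space d, ℂ), ⇑G = heatBase d k := by
  obtain ⟨ψ, hψ⟩ := exists_schwartz_stretched (d := d) hk one_pos
  refine ⟨𝓕⁻ ψ, ?_⟩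
  rw [SchwartzMap.fourierInv_coe, heatBase]
  congr 1
  funext ξ
  rw [hψ, one_mul]

lemma continuous_heatBase {k : ℕ} (hk : 0 < k) : Continuous (heatBase d k) := by
  obtain ⟨G, hG⟩ := exists_schwartz_heatBase (d := d) hk
  rw [← hG]; exact G.continuous

/-- The dilation formula gives joint measurability in `(s,x)` at once; the later uses of Tonelli
rest on it. -/
lemma measurable_heatKernel {k : ℕ} (hk : 0 < k) :
    Measurable fun z : ℝ × Space d => heatKernel d k z.1 z.2 := by
  have h := (continuous_heatBase (d := d) hk).measurable
  unfold heatKernel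
  have h1 : Measurable fun z : ℝ × Space d => z.1 ^ (-(1 / (4 * k) : ℝ)) := by fun_prop
  have h2 : Measurable fun z : ℝ × Space d => ((z.1 ^ (-(d / (4 * k) : ℝ)) : ℝ) : ℂ) := by fun_prop
  exact h2.mul (h.comp (h1.smul measurable_snd))

lemma fourierInv_stretched {k : ℕ} (hk : 0 < k) {s : ℝ} (hs : 0 < s) (x : Space d) :
    𝓕⁻ (fun ξ : Space d => ((Real.exp (-(s * ‖ξ‖ ^ (4 * k))) : ℝ) : ℂ)) x = heatKernel d k s x := by
  have hk' : (k : ℝ) ≠ 0 := by exact_mod_cast hk.ne'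
  set c := s ^ (1 / (4 * k) : ℝ) with hc
  have hc0 : 0 < c := Real.rpow_pos_of_pos hs _
  have hcs : c ^ (4 * k) = s := by
    rw [hc, ← Real.rpow_natCast, ← Real.rpow_mul hs.le]
    push_cast
    rw [one_div_mul_cancel (by positivity), Real.rpow_one]
  have hcinv : s ^ (-(1 / (4 * k) : ℝ)) = c⁻¹ := by rw [Real.rpow_neg hs.le]
  have hcd : s ^ (-(d / (4 * k) : ℝ)) = (c ^ d)⁻¹ := by
    rw [Real.rpow_neg hs.le, hc, ← Real.rpow_natCast, ← Real.rpow_mul hs.le]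
    congr 2
    field_simp
  rw [heatKernel, heatBase, Real.fourierInv_eq, Real.fourierInv_eq, hcinv, hcd]
  have h := Measure.integral_comp_smul (volume : Measure (Space d))
    (fun v : Space d => (Real.fourierChar (inner ℝ v (c⁻¹ • x))) •
      ((Real.exp (-‖v‖ ^ (4 * k)) : ℝ) : ℂ)) c
  rw [finrank_euclideanSpace_fin, abs_of_pos (by positivity)] at h
  rw [← Complex.real_smul, ← h]
  refine integral_congr_ae (ae_of_all _ fun v => ?_)
  simp only
  rw [inner_smul_left, inner_smul_right, norm_smul, mul_pow, Real.norm_of_nonneg hc0.le, hcs]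
  simp only [conj_trivial]
  rw [mul_inv_cancel_left₀ hc0.ne']

lemma integral_heatKernel_mul {k : ℕ} (hk : 0 < k) {s : ℝ} (hs : 0 < s) (φ : 𝓢(Space d, ℂ)) :
    ∫ x, heatKernel d k s x * φ x =
      ∫ ξ, ((Real.exp (-(s * ‖ξ‖ ^ (4 * k))) : ℝ) : ℂ) * (𝓕⁻ φ) ξ := by
  obtain ⟨ψ, hψ⟩ := exists_schwartz_stretched (d := d) hk hs
  have h := SchwartzMap.integral_fourierInv_mul_eq ψ φ
  rw [SchwartzMap.fourierInv_coe ψ] at h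
  have hψ' : (ψ : Space d → ℂ) = fun ξ => ((Real.exp (-(s * ‖ξ‖ ^ (4 * k))) : ℝ) : ℂ) :=
    funext hψ
  have e : 𝓕⁻ (ψ : Space d → ℂ) = heatKernel d k s := by
    rw [hψ']
    exact funext fun x => fourierInv_stretched hk hs x
  rw [e] at h
  rw [h]
  simp only [hψ]

lemma eLpNorm_heatBase_lt_top {k : ℕ} (hk : 0 < k) (a : ℝ≥0∞) :
    eLpNorm (heatBase d k) a < ∞ := by
  obtain ⟨G, hG⟩ := exists_schwartz_heatBase (d := d) hk
  have := G.eLpNorm_lt_top a (volume : Measure (Space d))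
  rwa [hG] at this

/-- Change of variables in the dilation. This power of `s` determines both the required moment of
`h` and the kernel's contribution to the power of `t`. -/
lemma eLpNorm_heatKernel {k : ℕ} (hk : 0 < k) {s : ℝ} (hs : 0 < s) (a : ℝ≥0∞) :
    eLpNorm (heatKernel d k s) a =
      ENNReal.ofReal (s ^ (-(d / (4 * k) : ℝ) * (1 - (1 / a).toReal))) *
        eLpNorm (heatBase d k) a := by
  set b := s ^ (-(1 / (4 * k) : ℝ)) with hb
  have hb0 : 0 < b := Real.rpow_pos_of_pos hs _
  have hbd : |(b ^ d)⁻¹| = s ^ (d / (4 * k) : ℝ) := by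
    rw [abs_of_pos (by positivity), hb, ← Real.rpow_natCast, ← Real.rpow_mul hs.le,
      ← Real.rpow_neg hs.le]
    congr 1
    ring
  have h1 : heatKernel d k s = ((s ^ (-(d / (4 * k) : ℝ)) : ℝ) : ℂ) •
      (heatBase d k ∘ fun x : Space d => b • x) := by
    funext x; rfl
  have hsd : 0 < s ^ (d / (4 * k) : ℝ) := Real.rpow_pos_of_pos hs _
  rw [h1, eLpNorm_const_smul, ← eLpNorm_map_measure (continuous_heatBase hk).aestronglyMeasurable
    (by fun_prop), Measure.map_addHaar_smul _ hb0.ne', finrank_euclideanSpace_fin, hbd,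
    eLpNorm_smul_measure_of_ne_zero (by simpa using hsd), smul_eq_mul, ← mul_assoc]
  congr 1
  rw [ENNReal.ofReal_rpow_of_pos hsd, ← ofReal_norm, Complex.norm_real,
    Real.norm_of_nonneg (Real.rpow_pos_of_pos hs _).le, ← ENNReal.ofReal_mul
      (Real.rpow_pos_of_pos hs _).le, ← Real.rpow_mul hs.le, ← Real.rpow_add hs]
  congr 2
  ring

end Profile

/-! ### The kernel `W` as a superposition of heat kernels -/

section Kernel

variable {d : ℕ}

/-- The superposition of heat kernels with density `h`. -/
noncomputable def heatSuperposition (d k : ℕ) (h : ℝ → ℂ) (σ : ℝ) (x : Space d) : ℂ :=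
  ∫ l in Ioi (0 : ℝ), h l * heatKernel d k (l * σ) x

lemma lintegral_enorm_heatKernel {k : ℕ} (hk : 0 < k) {s : ℝ} (hs : 0 < s) :
    ∫⁻ x, ‖heatKernel d k s x‖ₑ = eLpNorm (heatBase d k) 1 := by
  rw [← eLpNorm_one_eq_lintegral_enorm, eLpNorm_heatKernel hk hs]
  simp

lemma measurable_mul_heatKernel {k : ℕ} (hk : 0 < k) {h : ℝ → ℂ} (hm : Measurable h) (σ : ℝ) :
    Measurable fun z : ℝ × Space d => h z.1 * heatKernel d k (z.1 * σ) z.2 := by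
  have h1 := (measurable_heatKernel (d := d) hk).comp
    (show Measurable fun z : ℝ × Space d => (z.1 * σ, z.2) by fun_prop)
  exact (hm.comp measurable_fst).mul h1

/-- The `L^1` norm of a heat kernel does not depend on its time, so the double integral is a
product. -/
lemma integrable_mul_heatKernel {k : ℕ} (hk : 0 < k) {h : ℝ → ℂ} (hm : Measurable h)
    (hi : IntegrableOn h (Ioi 0)) {σ : ℝ} (hσ : 0 < σ) :
    Integrable (fun z : ℝ × Space d => h z.1 * heatKernel d k (z.1 * σ) z.2)
      ((volume.restrict (Ioi 0)).prod volume) := by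
  have hM := measurable_mul_heatKernel (d := d) hk hm σ
  refine ⟨hM.aestronglyMeasurable, ?_⟩
  rw [hasFiniteIntegral_iff_enorm, lintegral_prod _ hM.enorm.aemeasurable]
  have : ∀ l ∈ Ioi (0 : ℝ), ∫⁻ x : Space d, ‖h l * heatKernel d k (l * σ) x‖ₑ =
      ‖h l‖ₑ * eLpNorm (heatBase d k) 1 := by
    intro l hl
    simp only [enorm_mul]
    rw [lintegral_const_mul' _ _ enorm_ne_top,
      lintegral_enorm_heatKernel hk (mul_pos hl hσ)]
  rw [setLIntegral_congr_fun measurableSet_Ioi this,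
    lintegral_mul_const' _ _ (eLpNorm_heatBase_lt_top hk 1).ne]
  exact ENNReal.mul_lt_top hi.2 (eLpNorm_heatBase_lt_top hk 1)

lemma integrable_heatSuperposition {k : ℕ} (hk : 0 < k) {h : ℝ → ℂ} (hm : Measurable h)
    (hi : IntegrableOn h (Ioi 0)) {σ : ℝ} (hσ : 0 < σ) :
    Integrable (heatSuperposition d k h σ) :=
  (integrable_mul_heatKernel hk hm hi hσ).integral_prod_right

/-- For each `l` the pairing identity is `integral_heatKernel_mul`; Fubini on either side integrates
it against `h`. -/
lemma isInverseFourier_heatSuperposition {k : ℕ} (hk : 0 < k) {h : ℝ → ℂ} (hm : Measurable h)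
    (hi : IntegrableOn h (Ioi 0)) {σ : ℝ} (hσ : 0 < σ) {m : Space d → ℂ}
    (hmul : ∀ᵐ ξ, m ξ = ∫ l in Ioi (0 : ℝ),
      ((Real.exp (-(l * (σ * ‖ξ‖ ^ (4 * k)))) : ℝ) : ℂ) * h l) :
    IsInverseFourier m (heatSuperposition d k h σ) := by
  have hK := integrable_heatSuperposition (d := d) hk hm hi hσ
  refine ⟨hK.locallyIntegrable, fun φ => ?_⟩
  obtain ⟨C, hC⟩ : ∃ C, ∀ x, ‖φ x‖ ≤ C := by
    obtain ⟨C, -, hC⟩ := φ.decay 0 0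
    exact ⟨C, fun x => by simpa using hC x⟩
  have hKφ : Integrable fun x => heatSuperposition d k h σ x * φ x :=
    hK.mul_bdd (c := C) φ.continuous.aestronglyMeasurable (ae_of_all _ hC)
  have hP1 : Integrable (fun z : ℝ × Space d => h z.1 * heatKernel d k (z.1 * σ) z.2 * φ z.2)
      ((volume.restrict (Ioi 0)).prod volume) :=
    (integrable_mul_heatKernel hk hm hi hσ).mul_bdd (c := C)
      (φ.continuous.comp continuous_snd).aestronglyMeasurable (ae_of_all _ fun z => hC z.2)
  have hP2 : Integrable (fun z : ℝ × Space d =>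
      ((Real.exp (-(z.1 * (σ * ‖z.2‖ ^ (4 * k)))) : ℝ) : ℂ) * (h z.1 * (𝓕⁻ φ) z.2))
      ((volume.restrict (Ioi 0)).prod volume) := by
    refine (Integrable.mul_prod (f := h) (g := (𝓕⁻ φ : 𝓢(Space d, ℂ))) hi
      (SchwartzMap.integrable _)).bdd_mul (c := 1) ?_ ?_
    · refine Continuous.aestronglyMeasurable ?_
      fun_prop
    · have hz : ∀ᵐ z : ℝ × Space d ∂((volume.restrict (Ioi 0)).prod volume), z.1 ∈ Ioi (0 : ℝ) :=
        Measure.quasiMeasurePreserving_fst.ae (ae_restrict_mem measurableSet_Ioi)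
      filter_upwards [hz] with z hz
      have hz : 0 < z.1 := hz
      rw [Complex.norm_real, Real.norm_of_nonneg (Real.exp_pos _).le]
      exact Real.exp_le_one_iff.2 (by rw [neg_nonpos]; positivity)
  have hmφ : (fun ξ => m ξ * (𝓕⁻ φ) ξ) =ᵐ[volume] fun ξ => ∫ l in Ioi (0 : ℝ),
      ((Real.exp (-(l * (σ * ‖ξ‖ ^ (4 * k)))) : ℝ) : ℂ) * (h l * (𝓕⁻ φ) ξ) := by
    filter_upwards [hmul] with ξ hξ
    rw [hξ, ← integral_mul_const]
    simp only [mul_assoc]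
  refine ⟨hKφ, hP2.integral_prod_right.congr hmφ.symm, ?_⟩
  rw [integral_congr_ae hmφ, ← integral_integral_swap hP2]
  have e1 : ∀ x, heatSuperposition d k h σ x * φ x =
      ∫ l in Ioi (0 : ℝ), h l * heatKernel d k (l * σ) x * φ x := fun x => by
    rw [heatSuperposition, integral_mul_const]
  simp only [e1]
  rw [← integral_integral_swap hP1]
  refine setIntegral_congr_fun measurableSet_Ioi fun l hl => ?_
  have e2 := integral_heatKernel_mul (d := d) hk (mul_pos hl hσ) φ
  simp only [mul_assoc] at e2 ⊢
  rw [integral_const_mul, e2, ← integral_const_mul]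
  refine integral_congr_ae (ae_of_all _ fun ξ => ?_)
  simp only
  ring

/-- Compactly supported smooth functions determine a locally integrable function. Thus the function
chosen in `kernelW` may be replaced by the explicit superposition. -/
lemma IsInverseFourier.ae_eq {m K K' : Space d → ℂ} (h : IsInverseFourier m K)
    (h' : IsInverseFourier m K') : K =ᵐ[volume] K' := by
  refine ae_eq_of_integral_contDiff_smul_eq h.1 h'.1 fun g hg hgs => ?_
  have hg' : ContDiff ℝ (⊤ : ℕ∞) (fun x => (g x : ℂ)) := Complex.ofRealCLM.contDiff.comp hg
  have hgs' : HasCompactSupport (fun x => (g x : ℂ)) :=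
    hgs.comp_left (g := fun t : ℝ => (t : ℂ)) Complex.ofReal_zero
  have e1 := (h.2 (hgs'.toSchwartzMap hg')).2.2
  have e2 := (h'.2 (hgs'.toSchwartzMap hg')).2.2
  rw [← e2] at e1
  simp only [HasCompactSupport.toSchwartzMap_toFun] at e1
  simp only [Complex.real_smul, mul_comm]
  convert! e1 using 1

lemma isInverseFourier_kernelW {α β μ ν t : ℝ} {K : Space d → ℂ}
    (h : IsInverseFourier (symbolW α β μ ν t) K) :
    IsInverseFourier (symbolW α β μ ν t) (kernelW (d := d) α β μ ν t) := by
  have hex : ∃ K : Space d → ℂ, IsInverseFourier (symbolW α β μ ν t) K := ⟨K, h⟩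
  rw [kernelW, dif_pos hex]
  exact hex.choose_spec

end Kernel

/-! ### Minkowski's integral inequality -/

section Minkowski

variable {X ι : Type*} [MeasurableSpace X] [MeasurableSpace ι] {μ : Measure X} {κ : Measure ι}

lemma lintegral_rpow_le_of_eLpNorm_le {f : X → ℝ≥0∞} {q : ℝ≥0∞} (hq : 1 ≤ q) (hq' : q ≠ ∞)
    {M : ℝ≥0∞} (h : eLpNorm f q μ ≤ M) : ∫⁻ x, f x ^ q.toReal ∂μ ≤ M ^ q.toReal := by
  have hq0 : 0 < q.toReal := ENNReal.toReal_pos (zero_lt_one.trans_le hq).ne' hq'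
  rw [eLpNorm_eq_lintegral_rpow_enorm_toReal (zero_lt_one.trans_le hq).ne' hq', one_div,
    ENNReal.rpow_inv_le_iff hq0] at h
  simpa only [enorm_eq_self] using h

lemma eLpNorm_le_of_lintegral_rpow_le {f : X → ℝ≥0∞} {q : ℝ≥0∞} (hq : 1 ≤ q) (hq' : q ≠ ∞)
    {M : ℝ≥0∞} (h : ∫⁻ x, f x ^ q.toReal ∂μ ≤ M ^ q.toReal) : eLpNorm f q μ ≤ M := by
  have hq0 : 0 < q.toReal := ENNReal.toReal_pos (zero_lt_one.trans_le hq).ne' hq'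
  rw [eLpNorm_eq_lintegral_rpow_enorm_toReal (zero_lt_one.trans_le hq).ne' hq', one_div,
    ENNReal.rpow_inv_le_iff hq0]
  simpa only [enorm_eq_self] using h

/-- The splitting to which Hölder's inequality is applied below. For `M = 0` the cancellation of
powers fails, so `f = 0` is required there. -/
lemma le_rpow_mul_rpow {M f : ℝ≥0∞} {q : ℝ} (hq : 1 ≤ q) (hM : M ≠ ∞) (h0 : M = 0 → f = 0) :
    f ≤ (M ^ (1 - q) * f ^ q) ^ (1 / q) * M ^ (1 - 1 / q) := by
  have hq0 : 0 < q := by linarith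
  rcases eq_or_ne M 0 with h | h
  · rw [h0 h]; exact zero_le
  · rw [ENNReal.mul_rpow_of_nonneg _ _ (by positivity), ← ENNReal.rpow_mul, ← ENNReal.rpow_mul,
      mul_one_div_cancel hq0.ne', ENNReal.rpow_one, mul_right_comm, ← ENNReal.rpow_add _ _ h hM]
    have : (1 - q) * (1 / q) + (1 - 1 / q) = 0 := by field_simp; ring
    rw [this, ENNReal.rpow_zero, one_mul]

lemma rpow_one_sub_mul_rpow_le {M : ℝ≥0∞} {q : ℝ} (hq : 1 ≤ q) (hM : M ≠ ∞) :
    M ^ (1 - q) * M ^ q ≤ M := by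
  rcases eq_or_ne M 0 with h | h
  · rw [h, ENNReal.zero_rpow_of_pos (by linarith : 0 < q), mul_zero]
  · rw [← ENNReal.rpow_add _ _ h hM, sub_add_cancel, ENNReal.rpow_one]

/-- **Minkowski's integral inequality**, with a measurable bound for the norms of the slices. -/
theorem eLpNorm_lintegral_le [SFinite μ] [SFinite κ] {f : ι → X → ℝ≥0∞}
    (hf : Measurable (Function.uncurry f)) {M : ι → ℝ≥0∞} (hM : Measurable M) {q : ℝ≥0∞}
    (hq : 1 ≤ q) (h : ∀ᵐ i ∂κ, eLpNorm (f i) q μ ≤ M i) :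
    eLpNorm (fun x => ∫⁻ i, f i x ∂κ) q μ ≤ ∫⁻ i, M i ∂κ := by
  have hfi : ∀ i, Measurable (f i) := fun i => hf.comp measurable_prodMk_left
  have hfx : ∀ x, Measurable fun i => f i x := fun x => hf.comp measurable_prodMk_right
  rcases eq_or_ne (∫⁻ i, M i ∂κ) ∞ with htop | htop
  · rw [htop]; exact le_top
  rcases eq_or_ne q ∞ with rfl | hq'
  · have h1 : ∀ᵐ i ∂κ, ∀ᵐ x ∂μ, f i x ≤ M i := by
      filter_upwards [h] with i hi
      rw [eLpNorm_exponent_top] at hi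
      filter_upwards [ae_le_eLpNormEssSup (f := f i) (μ := μ)] with x hx
      rw [enorm_eq_self] at hx
      exact hx.trans hi
    have hset : MeasurableSet {z : ι × X | f z.1 z.2 ≤ M z.1} :=
      measurableSet_le hf (hM.comp measurable_fst)
    rw [Measure.ae_ae_comm hset] at h1
    rw [eLpNorm_exponent_top]
    refine essSup_le_of_ae_le _ ?_
    filter_upwards [h1] with x hx
    rw [enorm_eq_self]
    exact lintegral_mono_ae hx
  · have hq1 : 1 ≤ q.toReal := by
      rw [← ENNReal.toReal_one]
      exact (ENNReal.toReal_le_toReal ENNReal.one_ne_top hq').2 hq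
    set Q := q.toReal with hQ
    have hQ0 : 0 < Q := by linarith
    have hle : ∀ᵐ i ∂κ, ∫⁻ x, f i x ^ Q ∂μ ≤ M i ^ Q := by
      filter_upwards [h] with i hi
      exact lintegral_rpow_le_of_eLpNorm_le hq hq' hi
    have hMfin : ∀ᵐ i ∂κ, M i ≠ ∞ := (ae_lt_top hM htop).mono fun i hi => hi.ne
    have hzero : ∀ᵐ i ∂κ, ∀ᵐ x ∂μ, M i = 0 → f i x = 0 := by
      filter_upwards [hle] with i hi
      by_cases h0 : M i = 0
      · rw [h0, ENNReal.zero_rpow_of_pos hQ0, nonpos_iff_eq_zero,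
          lintegral_eq_zero_iff ((hfi i).pow_const _)] at hi
        filter_upwards [hi] with x hx _
        simpa [hQ0.not_gt, ENNReal.rpow_eq_zero_iff, hQ0] using hx
      · exact ae_of_all _ fun x h => absurd h h0
    have hset : MeasurableSet {z : ι × X | M z.1 = 0 → f z.1 z.2 = 0} := by
      have h1 : MeasurableSet {z : ι × X | M z.1 = 0} :=
        (hM.comp measurable_fst) (measurableSet_singleton 0)
      have h2 : MeasurableSet {z : ι × X | f z.1 z.2 = 0} := hf (measurableSet_singleton 0)
      exact h1.imp h2
    rw [Measure.ae_ae_comm hset] at hzero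
    set m := ∫⁻ i, M i ∂κ with hm
    refine eLpNorm_le_of_lintegral_rpow_le hq hq' ?_
    -- Hölder with the weight `M`, in place of duality. The integral in `x` then replaces `f^Q` by
    -- at most `M^Q`, and `M^{1-Q} M^Q ≤ M` closes the estimate.
    have hpt : ∀ᵐ x ∂μ, (∫⁻ i, f i x ∂κ) ^ Q ≤
        (∫⁻ i, M i ^ (1 - Q) * f i x ^ Q ∂κ) * m ^ (Q - 1) := by
      filter_upwards [hzero] with x hx
      have h1 : ∫⁻ i, f i x ∂κ ≤
          ∫⁻ i, (M i ^ (1 - Q) * f i x ^ Q) ^ (1 / Q) * M i ^ (1 - 1 / Q) ∂κ := by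
        refine lintegral_mono_ae ?_
        filter_upwards [hx, hMfin] with i h0 hfin
        exact le_rpow_mul_rpow hq1 hfin h0
      have h2 := ENNReal.lintegral_mul_norm_pow_le (μ := κ) (p := 1 / Q) (q := 1 - 1 / Q)
        (((hM.pow_const (1 - Q)).mul ((hfx x).pow_const Q)).aemeasurable) hM.aemeasurable
        (by positivity) (by rw [sub_nonneg, div_le_one hQ0]; exact hq1) (by ring)
      have h3 := ENNReal.rpow_le_rpow (h1.trans h2) hQ0.le
      rw [ENNReal.mul_rpow_of_nonneg _ _ hQ0.le, ← ENNReal.rpow_mul, ← ENNReal.rpow_mul,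
        one_div_mul_cancel hQ0.ne', ENNReal.rpow_one, sub_mul, one_mul,
        one_div_mul_cancel hQ0.ne'] at h3
      exact h3
    have hmeas2 : Measurable (Function.uncurry fun (x : X) (i : ι) => M i ^ (1 - Q) * f i x ^ Q) := by
      have h1 : Measurable fun z : X × ι => f z.2 z.1 := hf.comp measurable_swap
      have h2 : Measurable fun z : X × ι => M z.2 := hM.comp measurable_snd
      exact (h2.pow_const _).mul (h1.pow_const _)
    calc ∫⁻ x, (∫⁻ i, f i x ∂κ) ^ Q ∂μ
        ≤ ∫⁻ x, (∫⁻ i, M i ^ (1 - Q) * f i x ^ Q ∂κ) * m ^ (Q - 1) ∂μ := lintegral_mono_ae hpt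
      _ = (∫⁻ x, ∫⁻ i, M i ^ (1 - Q) * f i x ^ Q ∂κ ∂μ) * m ^ (Q - 1) :=
          lintegral_mul_const' _ _ (ENNReal.rpow_ne_top_of_nonneg (by linarith) htop)
      _ = (∫⁻ i, ∫⁻ x, M i ^ (1 - Q) * f i x ^ Q ∂μ ∂κ) * m ^ (Q - 1) := by
          rw [lintegral_lintegral_swap hmeas2.aemeasurable]
      _ ≤ (∫⁻ i, M i ∂κ) * m ^ (Q - 1) := by
          gcongr ?_ * _
          refine lintegral_mono_ae ?_
          filter_upwards [hle, hMfin] with i hi hfin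
          rw [lintegral_const_mul _ ((hfi i).pow_const _)]
          exact (mul_le_mul_right hi _).trans (rpow_one_sub_mul_rpow_le hq1 hfin)
      _ = m ^ Q := by
          rw [← hm]
          nth_rewrite 1 [← ENNReal.rpow_one m]
          rw [← ENNReal.rpow_add_of_nonneg _ _ zero_le_one (by linarith)]
          congr 1
          ring

end Minkowski

/-! ### Young's convolution inequality -/

section Young

variable {d : ℕ}

/-- **Young's convolution inequality**, in terms of the convolution of the absolute values. -/
theorem eLpNorm_lconvolution_le {u v : Space d → ℂ} (hu : Measurable u) (hv : Measurable v)
    {a p q : ℝ≥0∞} (ha : 1 ≤ a) (hp : 1 ≤ p) (hq : 1 ≤ q) (hpq : p ≤ q)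
    (h : a⁻¹ + p⁻¹ = 1 + q⁻¹) :
    eLpNorm (fun x => ∫⁻ y, ‖u (x - y)‖ₑ * ‖v y‖ₑ) q volume ≤ eLpNorm u a * eLpNorm v p := by
  have hux : ∀ x, Measurable fun y => u (x - y) := fun x => hu.comp (measurable_const.sub measurable_id)
  -- For `q = ∞` the exponents are conjugate and this is Hölder's inequality; otherwise all three
  -- exponents are finite.
  rcases eq_or_ne q ∞ with rfl | hq'
  · have hT : ENNReal.HolderTriple a p 1 := ⟨by simpa using h⟩
    rw [eLpNorm_exponent_top]
    refine essSup_le_of_ae_le _ (ae_of_all _ fun x => ?_)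
    simp only [enorm_eq_self]
    have h1 := eLpNorm_smul_le_mul_eLpNorm (μ := (volume : Measure (Space d))) (p := a) (q := p)
      (r := 1) hv.aestronglyMeasurable (hux x).aestronglyMeasurable
    have h2 : eLpNorm (fun y => u (x - y)) a = eLpNorm u a :=
      eLpNorm_comp_measurePreserving hu.aestronglyMeasurable (Measure.measurePreserving_sub_left volume x)
    rw [h2, eLpNorm_one_eq_lintegral_enorm] at h1
    simpa only [Pi.smul_apply', smul_eq_mul, enorm_mul] using h1
  · have hp' : p ≠ ∞ := ne_top_of_le_ne_top hq' hpq
    have ha' : a ≠ ∞ := by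
      rintro rfl
      rw [ENNReal.inv_top, zero_add] at h
      have h1 : p⁻¹ ≤ 1 := ENNReal.inv_le_one.2 hp
      have h2 : q⁻¹ ≠ 0 := ENNReal.inv_ne_zero.2 hq'
      rw [h] at h1
      exact h2 (by
        have h3 : (1 : ℝ≥0∞) + q⁻¹ ≤ 1 + 0 := by simpa using h1
        simpa using (ENNReal.add_le_add_iff_left ENNReal.one_ne_top).1 h3)
    have ha0 := (zero_lt_one.trans_le ha).ne'
    have hp0 := (zero_lt_one.trans_le hp).ne'
    have hq0 := (zero_lt_one.trans_le hq).ne'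
    set A := a.toReal with hA
    set P := p.toReal with hP
    set Q := q.toReal with hQ
    have hApos : 0 < A := ENNReal.toReal_pos ha0 ha'
    have hPpos : 0 < P := ENNReal.toReal_pos hp0 hp'
    have hQpos : 0 < Q := ENNReal.toReal_pos hq0 hq'
    have hP1 : 1 ≤ P := by
      rw [← ENNReal.toReal_one]; exact (ENNReal.toReal_le_toReal ENNReal.one_ne_top hp').2 hp
    have hPQ : P ≤ Q := (ENNReal.toReal_le_toReal hp' hq').2 hpq
    have hrel : 1 / A + 1 / P = 1 + 1 / Q := by
      have := congrArg ENNReal.toReal h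
      rw [ENNReal.toReal_add (ENNReal.inv_ne_top.2 ha0) (ENNReal.inv_ne_top.2 hp0),
        ENNReal.toReal_add ENNReal.one_ne_top (ENNReal.inv_ne_top.2 hq0), ENNReal.toReal_inv,
        ENNReal.toReal_inv, ENNReal.toReal_inv, ENNReal.toReal_one] at this
      simpa only [one_div] using this
    have hP1' : 0 ≤ 1 - 1 / P := by rw [sub_nonneg, div_le_one hPpos]; exact hP1
    have hδ : 0 ≤ 1 / P - 1 / Q := sub_nonneg.2 (one_div_le_one_div_of_le hPpos hPQ)
    set x₀ := ∫⁻ y, ‖u y‖ₑ ^ A with hx₀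
    set y₀ := ∫⁻ y, ‖v y‖ₑ ^ P with hy₀
    have hXm : ∀ x, Measurable fun y => ‖u (x - y)‖ₑ ^ A := fun x => (hux x).enorm.pow_const _
    have hYm : Measurable fun y => ‖v y‖ₑ ^ P := hv.enorm.pow_const _
    have hpt : ∀ x, (∫⁻ y, ‖u (x - y)‖ₑ * ‖v y‖ₑ) ^ Q ≤
        (∫⁻ y, ‖u (x - y)‖ₑ ^ A * ‖v y‖ₑ ^ P) *
          (x₀ ^ (Q * (1 - 1 / P)) * y₀ ^ (Q * (1 / P - 1 / Q))) := by
      intro x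
      -- Three-factor splitting with weights `1/Q`, `1 - 1/P` and `1/P - 1/Q`, which sum to one.
      -- Only the first factor couples `x` and `y` after integration in `y`.
      have e : ∀ y, ‖u (x - y)‖ₑ * ‖v y‖ₑ = (‖u (x - y)‖ₑ ^ A * ‖v y‖ₑ ^ P) ^ (1 / Q) *
          ((‖u (x - y)‖ₑ ^ A) ^ (1 - 1 / P) * (‖v y‖ₑ ^ P) ^ (1 / P - 1 / Q)) := by
        intro y
        rw [ENNReal.mul_rpow_of_nonneg _ _ (by positivity), mul_mul_mul_comm,
          ← ENNReal.rpow_add_of_nonneg _ _ (by positivity) hP1',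
          ← ENNReal.rpow_add_of_nonneg _ _ (by positivity) hδ, ← ENNReal.rpow_mul,
          ← ENNReal.rpow_mul]
        have e1 : A * (1 / Q + (1 - 1 / P)) = 1 := by
          have : 1 / Q + (1 - 1 / P) = 1 / A := by linarith
          rw [this]; field_simp
        have e2 : P * (1 / Q + (1 / P - 1 / Q)) = 1 := by
          have : 1 / Q + (1 / P - 1 / Q) = 1 / P := by ring
          rw [this]; field_simp
        rw [e1, e2, ENNReal.rpow_one, ENNReal.rpow_one]
      have h3 := ENNReal.lintegral_prod_norm_pow_le (μ := (volume : Measure (Space d)))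
        (Finset.univ : Finset (Fin 3))
        (f := ![fun y => ‖u (x - y)‖ₑ ^ A * ‖v y‖ₑ ^ P, fun y => ‖u (x - y)‖ₑ ^ A,
          fun y => ‖v y‖ₑ ^ P]) (p := ![1 / Q, 1 - 1 / P, 1 / P - 1 / Q])
        (fun i _ => by
          fin_cases i
          · exact ((hXm x).mul hYm).aemeasurable
          · exact (hXm x).aemeasurable
          · exact hYm.aemeasurable)
        (by rw [Fin.sum_univ_three]; simp; ring)
        (fun i _ => by
          fin_cases i
          · simp; positivity
          · exact hP1'
          · exact hδ)
      simp only [Fin.prod_univ_three, Matrix.cons_val_zero, Matrix.cons_val_one, Matrix.cons_val,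
        mul_assoc] at h3
      have h4 : ∫⁻ y, ‖u (x - y)‖ₑ ^ A = x₀ :=
        lintegral_sub_left_eq_self (μ := (volume : Measure (Space d))) (fun y => ‖u y‖ₑ ^ A) x
      simp only [← e, h4] at h3
      have h5 := ENNReal.rpow_le_rpow h3 hQpos.le
      rw [ENNReal.mul_rpow_of_nonneg _ _ hQpos.le, ENNReal.mul_rpow_of_nonneg _ _ hQpos.le,
        ← ENNReal.rpow_mul, ← ENNReal.rpow_mul, ← ENNReal.rpow_mul, one_div_mul_cancel hQpos.ne',
        ENNReal.rpow_one, mul_comm _ Q, mul_comm _ Q] at h5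
      exact h5
    have hswap : ∫⁻ x, ∫⁻ y, ‖u (x - y)‖ₑ ^ A * ‖v y‖ₑ ^ P = x₀ * y₀ := by
      have hm : Measurable (Function.uncurry fun x y : Space d => ‖u (x - y)‖ₑ ^ A * ‖v y‖ₑ ^ P) := by
        have h1 : Measurable fun z : Space d × Space d => u (z.1 - z.2) :=
          hu.comp (measurable_fst.sub measurable_snd)
        have h2 : Measurable fun z : Space d × Space d => v z.2 := hv.comp measurable_snd
        exact (h1.enorm.pow_const _).mul (h2.enorm.pow_const _)
      rw [lintegral_lintegral_swap hm.aemeasurable]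
      have : ∀ y, ∫⁻ x, ‖u (x - y)‖ₑ ^ A * ‖v y‖ₑ ^ P = x₀ * ‖v y‖ₑ ^ P := by
        intro y
        have hmy : Measurable fun x => ‖u (x - y)‖ₑ ^ A :=
          (hu.comp (measurable_id.sub_const y)).enorm.pow_const _
        rw [lintegral_mul_const _ hmy]
        congr 1
        exact lintegral_sub_right_eq_self (μ := (volume : Measure (Space d)))
          (fun x => ‖u x‖ₑ ^ A) y
      simp only [this]
      rw [lintegral_const_mul _ hYm]
    rw [eLpNorm_eq_lintegral_rpow_enorm_toReal hq0 hq', eLpNorm_eq_lintegral_rpow_enorm_toReal ha0 ha',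
      eLpNorm_eq_lintegral_rpow_enorm_toReal hp0 hp']
    simp only [enorm_eq_self]
    have hIm : Measurable fun x : Space d => ∫⁻ y, ‖u (x - y)‖ₑ ^ A * ‖v y‖ₑ ^ P := by
      have h1 : Measurable fun z : Space d × Space d => u (z.1 - z.2) :=
        hu.comp (measurable_fst.sub measurable_snd)
      have h2 : Measurable fun z : Space d × Space d => v z.2 := hv.comp measurable_snd
      exact ((h1.enorm.pow_const _).mul (h2.enorm.pow_const _)).lintegral_prod_right'
    calc (∫⁻ x, (∫⁻ y, ‖u (x - y)‖ₑ * ‖v y‖ₑ) ^ Q) ^ (1 / Q)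
        ≤ (x₀ * y₀ * (x₀ ^ (Q * (1 - 1 / P)) * y₀ ^ (Q * (1 / P - 1 / Q)))) ^ (1 / Q) := by
          refine ENNReal.rpow_le_rpow ?_ (by positivity)
          rw [← hswap, ← lintegral_mul_const _ hIm]
          exact lintegral_mono hpt
      _ = x₀ ^ (1 / A) * y₀ ^ (1 / P) := by
          have e3 : x₀ * y₀ * (x₀ ^ (Q * (1 - 1 / P)) * y₀ ^ (Q * (1 / P - 1 / Q))) =
              x₀ ^ (1 + Q * (1 - 1 / P)) * y₀ ^ (1 + Q * (1 / P - 1 / Q)) := by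
            rw [ENNReal.rpow_add_of_nonneg _ _ zero_le_one (by positivity),
              ENNReal.rpow_add_of_nonneg _ _ zero_le_one (by positivity), ENNReal.rpow_one,
              ENNReal.rpow_one, mul_mul_mul_comm]
          rw [e3, ENNReal.mul_rpow_of_nonneg _ _ (by positivity), ← ENNReal.rpow_mul,
            ← ENNReal.rpow_mul]
          congr 2
          · have : 1 / A = 1 + 1 / Q - 1 / P := by linarith
            rw [this]; field_simp; ring
          · field_simp; ring

end Young

/-! ### Hölder's inequality in time against a power weight -/

section Time

lemma ae_lt_top_of_eLpNorm_lt_top {X : Type*} [MeasurableSpace X] {μ : Measure X} {f : X → ℝ≥0∞}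
    (hf : Measurable f) {q : ℝ≥0∞} (hq : q ≠ 0) (h : eLpNorm f q μ < ∞) : ∀ᵐ x ∂μ, f x < ∞ := by
  rcases eq_or_ne q ∞ with rfl | hq'
  · rw [eLpNorm_exponent_top] at h
    filter_upwards [enorm_ae_le_eLpNormEssSup f μ] with x hx
    exact lt_of_le_of_lt hx h
  · have h1 := lintegral_rpow_enorm_lt_top_of_eLpNorm_lt_top hq hq' h
    simp only [enorm_eq_self] at h1
    filter_upwards [ae_lt_top (hf.pow_const _) h1.ne] with x hx
    exact (ENNReal.rpow_lt_top_iff_of_pos (ENNReal.toReal_pos hq hq')).1 hx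

lemma lintegral_sub_rpow {m : ℝ} (hm : -1 < m) {t : ℝ} (ht : 0 < t) :
    ∫⁻ s in Ioo 0 t, ENNReal.ofReal ((t - s) ^ m) = ENNReal.ofReal (t ^ (m + 1) / (m + 1)) := by
  have h0 : IntervalIntegrable (fun s : ℝ => (t - s) ^ m) volume 0 t := by
    have := (intervalIntegral.intervalIntegrable_rpow' (a := t) (b := 0) hm).comp_sub_left t
    simpa using this
  have h1 : IntegrableOn (fun s : ℝ => (t - s) ^ m) (Ioo 0 t) := by
    rw [intervalIntegrable_iff_integrableOn_Ioo_of_le ht.le] at h0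
    exact h0
  rw [← ofReal_integral_eq_lintegral_ofReal h1]
  · rw [← integral_Ioc_eq_integral_Ioo, ← intervalIntegral.integral_of_le ht.le,
      intervalIntegral.integral_comp_sub_left (fun s => s ^ m) t, sub_self, sub_zero,
      integral_rpow (Or.inl hm), Real.zero_rpow (by linarith), sub_zero]
  · filter_upwards [ae_restrict_mem measurableSet_Ioo] with s hs
    exact Real.rpow_nonneg (sub_nonneg.2 hs.2.le) _

/-- The `L^a(0,t)` norm of `s ↦ (t-s)^e` is at most a constant multiple of `t^{e+1/a}`. -/
lemma exists_eLpNorm_sub_rpow_le {a : ℝ≥0∞} (ha : a ≠ 0) {e : ℝ} (he : 0 < e + (a⁻¹).toReal) :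
    ∃ C : ℝ≥0, ∀ t, 0 < t → eLpNorm (fun s : ℝ => (t - s) ^ e) a (volume.restrict (Ioo 0 t)) ≤
      C * ENNReal.ofReal (t ^ (e + (a⁻¹).toReal)) := by
  rcases eq_or_ne a ∞ with rfl | ha'
  · refine ⟨1, fun t ht => ?_⟩
    simp only [ENNReal.inv_top, ENNReal.toReal_zero, add_zero] at he ⊢
    rw [eLpNorm_exponent_top, ENNReal.coe_one, one_mul]
    refine essSup_le_of_ae_le _ ?_
    filter_upwards [ae_restrict_mem measurableSet_Ioo] with s hs
    have hs0 : 0 ≤ t - s := sub_nonneg.2 hs.2.le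
    rw [Real.enorm_of_nonneg (Real.rpow_nonneg hs0 _)]
    exact ENNReal.ofReal_le_ofReal (Real.rpow_le_rpow hs0 (by linarith [hs.1]) he.le)
  · set A := a.toReal with hA
    have hApos : 0 < A := ENNReal.toReal_pos ha ha'
    rw [ENNReal.toReal_inv, ← hA] at he ⊢
    have hm : 0 < e * A + 1 := by
      have := mul_pos he hApos
      rwa [add_mul, inv_mul_cancel₀ hApos.ne'] at this
    refine ⟨Real.toNNReal ((e * A + 1)⁻¹ ^ (1 / A)), fun t ht => le_of_eq ?_⟩
    rw [eLpNorm_eq_lintegral_rpow_enorm_toReal ha ha', ← hA]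
    have h1 : ∫⁻ s in Ioo 0 t, ‖(t - s) ^ e‖ₑ ^ A =
        ∫⁻ s in Ioo 0 t, ENNReal.ofReal ((t - s) ^ (e * A)) := by
      refine setLIntegral_congr_fun measurableSet_Ioo fun s hs => ?_
      have hs0 : 0 ≤ t - s := sub_nonneg.2 hs.2.le
      rw [Real.enorm_of_nonneg (Real.rpow_nonneg hs0 _),
        ENNReal.ofReal_rpow_of_nonneg (Real.rpow_nonneg hs0 _) hApos.le, Real.rpow_mul hs0]
    rw [h1, lintegral_sub_rpow (by linarith) ht, ENNReal.ofReal_rpow_of_nonneg (by positivity)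
      (by positivity), div_eq_inv_mul, Real.mul_rpow (by positivity) (by positivity),
      ENNReal.ofReal_mul (by positivity), ← Real.rpow_mul ht.le]
    have h2 : (e * A + 1) * (1 / A) = e + A⁻¹ := by field_simp
    rw [h2]
    rfl

/-- **Hölder's inequality** against the weight `(t-s)^e` on `(0,t)`. -/
lemma exists_lintegral_sub_rpow_mul_le {r : ℝ≥0∞} (hr : 1 ≤ r) {e : ℝ}
    (he : 0 < e + 1 - (1 / r).toReal) :
    ∃ C : ℝ≥0, ∀ t, 0 < t → ∀ N : ℝ → ℝ≥0∞, Measurable N →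
      eLpNorm N r (volume.restrict (Ioo 0 t)) < ∞ →
      ∫⁻ s in Ioo 0 t, ENNReal.ofReal ((t - s) ^ e) * N s ≤
        C * ENNReal.ofReal (t ^ (e + 1 - (1 / r).toReal)) *
          eLpNorm N r (volume.restrict (Ioo 0 t)) := by
  have hr1 : r⁻¹ ≤ 1 := ENNReal.inv_le_one.2 hr
  -- The conjugate exponent of `r`; for `r = 1` it is `∞`, and the assumption on `e` then makes the
  -- weight bounded.
  set a : ℝ≥0∞ := (1 - r⁻¹)⁻¹ with ha
  have ha0 : a ≠ 0 := by
    rw [ha, Ne, ENNReal.inv_eq_zero]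
    exact (tsub_le_self.trans_lt ENNReal.one_lt_top).ne
  have hainv : (a⁻¹).toReal = 1 - (1 / r).toReal := by
    rw [ha, inv_inv, ENNReal.toReal_sub_of_le hr1 ENNReal.one_ne_top, one_div, ENNReal.toReal_one]
  have hT : ENNReal.HolderTriple a r 1 := ⟨by
    rw [ha, inv_inv, inv_one]; exact tsub_add_cancel_of_le hr1⟩
  obtain ⟨C, hC⟩ := exists_eLpNorm_sub_rpow_le ha0 (e := e) (by rw [hainv]; linarith)
  refine ⟨C, fun t ht N hN hfin => ?_⟩
  have hae := ae_lt_top_of_eLpNorm_lt_top hN (zero_lt_one.trans_le hr).ne' hfin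
  have e1 : ∫⁻ s in Ioo 0 t, ENNReal.ofReal ((t - s) ^ e) * N s =
      eLpNorm ((fun s : ℝ => (t - s) ^ e) • fun s => (N s).toReal) 1
        (volume.restrict (Ioo 0 t)) := by
    rw [eLpNorm_one_eq_lintegral_enorm]
    refine lintegral_congr_ae ?_
    filter_upwards [ae_restrict_mem measurableSet_Ioo, hae] with s hs hNs
    rw [Pi.smul_apply', smul_eq_mul, enorm_mul,
      Real.enorm_of_nonneg (Real.rpow_nonneg (sub_nonneg.2 hs.2.le) _),
      Real.enorm_of_nonneg ENNReal.toReal_nonneg, ENNReal.ofReal_toReal hNs.ne]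
  have e2 : eLpNorm (fun s => (N s).toReal) r (volume.restrict (Ioo 0 t)) =
      eLpNorm N r (volume.restrict (Ioo 0 t)) := by
    refine eLpNorm_congr_enorm_ae ?_
    filter_upwards [hae] with s hs
    rw [Real.enorm_of_nonneg ENNReal.toReal_nonneg, ENNReal.ofReal_toReal hs.ne, enorm_eq_self]
  rw [e1, ← e2]
  refine (eLpNorm_smul_le_mul_eLpNorm (p := a) (q := r) hN.ennreal_toReal.aestronglyMeasurable
    ?_).trans ?_
  · exact ((measurable_const.sub measurable_id).pow_const _).aestronglyMeasurable
  · have := hC t ht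
    rw [hainv, ← add_sub_assoc] at this
    exact mul_le_mul_left this _

end Time

/-! ### The nonnegative majorant and its mixed-norm estimate -/

section Majorant

variable {d k : ℕ} {h : ℝ → ℂ} {ε e₀ : ℝ} {F : ℝ → Space d → ℂ}

lemma enorm_ofReal_rpow {x : ℝ} (hx : 0 ≤ x) (m : ℝ) :
    ‖((x ^ m : ℝ) : ℂ)‖ₑ = ENNReal.ofReal (x ^ m) := by
  rw [← ofReal_norm, Complex.norm_real, Real.norm_of_nonneg (Real.rpow_nonneg hx _)]

/-- The integrand of `duhamelMajorant`: the heat kernel at `(s,l)` convolved with `F(s,·)`, in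
absolute values and with its weight. -/
noncomputable def majorantIntegrand (k : ℕ) (h : ℝ → ℂ) (ε e₀ : ℝ) (F : ℝ → Space d → ℂ) (t : ℝ)
    (z : ℝ × ℝ) (x : Space d) : ℝ≥0∞ :=
  ENNReal.ofReal ((t - z.1) ^ e₀) * (‖h z.2‖ₑ *
    ∫⁻ y, ‖F z.1 (x - y)‖ₑ * ‖heatKernel d k (z.2 * (t - z.1) ^ ε) y‖ₑ)

/-- A majorant of Duhamel's integral with the kernel `heatSuperposition d k h ((t-s)^ε)`. -/
noncomputable def duhamelMajorant (k : ℕ) (h : ℝ → ℂ) (ε e₀ : ℝ) (F : ℝ → Space d → ℂ) (t : ℝ)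
    (x : Space d) : ℝ≥0∞ :=
  ∫⁻ z, majorantIntegrand k h ε e₀ F t z x
    ∂((volume.restrict (Ioo 0 t)).prod (volume.restrict (Ioi 0)))

lemma measurable_enorm_mul_heatKernel (hk : 0 < k) (hF : Measurable (Function.uncurry F)) (t ε : ℝ) :
    Measurable fun w : ((ℝ × ℝ) × Space d) × Space d => ‖F w.1.1.1 (w.1.2 - w.2)‖ₑ *
      ‖heatKernel d k (w.1.1.2 * (t - w.1.1.1) ^ ε) w.2‖ₑ := by
  have h1 : Measurable fun w : ((ℝ × ℝ) × Space d) × Space d => (w.1.1.1, w.1.2 - w.2) := by fun_prop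
  have h2 : Measurable fun w : ((ℝ × ℝ) × Space d) × Space d =>
      (w.1.1.2 * (t - w.1.1.1) ^ ε, w.2) := by fun_prop
  exact (hF.comp h1).enorm.mul ((measurable_heatKernel hk).comp h2).enorm

lemma measurable_majorantIntegrand (hk : 0 < k) (hm : Measurable h)
    (hF : Measurable (Function.uncurry F)) (t : ℝ) :
    Measurable (Function.uncurry (majorantIntegrand k h ε e₀ F t)) := by
  have h1 := (measurable_enorm_mul_heatKernel hk hF t ε).lintegral_prod_right' (ν := volume)
  have h2 : Measurable fun w : (ℝ × ℝ) × Space d => ENNReal.ofReal ((t - w.1.1) ^ e₀) := by fun_prop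
  have h3 : Measurable fun w : (ℝ × ℝ) × Space d => ‖h w.1.2‖ₑ :=
    (hm.comp (measurable_snd.comp measurable_fst)).enorm
  exact h2.mul (h3.mul h1)

lemma measurable_duhamelMajorant (hk : 0 < k) (hm : Measurable h)
    (hF : Measurable (Function.uncurry F)) (t : ℝ) :
    Measurable (duhamelMajorant k h ε e₀ F t) :=
  (measurable_majorantIntegrand hk hm hF t).lintegral_prod_left'

lemma measurable_eLpNorm_section (hF : Measurable (Function.uncurry F)) {p : ℝ≥0∞} (hp0 : p ≠ 0)
    (hp : p ≠ ∞) : Measurable fun s => eLpNorm (F s) p volume := by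
  simp only [eLpNorm_eq_lintegral_rpow_enorm_toReal hp0 hp]
  exact ((hF.enorm.pow_const _).lintegral_prod_right').pow_const _

/-- Young's inequality and the scaling of the heat kernel in `l (t-s)^ε`. The bound separates into a
function of `s` and a function of `l`. -/
lemma eLpNorm_majorantIntegrand_le (hk : 0 < k) (hF : Measurable (Function.uncurry F))
    {a p q : ℝ≥0∞} (ha : 1 ≤ a) (hp : 1 ≤ p) (haq : a ≤ q) (hapq : a⁻¹ + p⁻¹ = 1 + q⁻¹)
    {t : ℝ} {z : ℝ × ℝ} (hz1 : z.1 < t) (hz2 : 0 < z.2) :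
    eLpNorm (majorantIntegrand k h ε e₀ F t z) q volume ≤
      (ENNReal.ofReal ((t - z.1) ^ (e₀ - ε * (d / (4 * k) * (1 - (1 / a).toReal)))) *
        eLpNorm (F z.1) p volume) *
      (ENNReal.ofReal (z.2 ^ (-(d / (4 * k) * (1 - (1 / a).toReal)))) * ‖h z.2‖ₑ *
        eLpNorm (heatBase d k) a) := by
  have hτ : 0 < t - z.1 := sub_pos.2 hz1
  have hσ : 0 < z.2 * (t - z.1) ^ ε := mul_pos hz2 (Real.rpow_pos_of_pos hτ _)
  have hFz : Measurable (F z.1) := hF.comp measurable_prodMk_left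
  have hH : Measurable (heatKernel d k (z.2 * (t - z.1) ^ ε)) :=
    (measurable_heatKernel hk).comp measurable_prodMk_left
  have hY := eLpNorm_lconvolution_le hFz hH hp ha (ha.trans haq) haq (by rw [add_comm, hapq])
  rw [eLpNorm_heatKernel hk hσ] at hY
  have e1 : eLpNorm (majorantIntegrand k h ε e₀ F t z) q volume ≤
      ENNReal.ofReal ((t - z.1) ^ e₀) * (‖h z.2‖ₑ * eLpNorm (fun x =>
        ∫⁻ y, ‖F z.1 (x - y)‖ₑ * ‖heatKernel d k (z.2 * (t - z.1) ^ ε) y‖ₑ) q volume) := by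
    rw [← mul_assoc]
    have h1 := eLpNorm_le_nnreal_smul_eLpNorm_of_ae_le_mul' (μ := (volume : Measure (Space d)))
      (f := majorantIntegrand k h ε e₀ F t z) (g := fun x =>
        ∫⁻ y, ‖F z.1 (x - y)‖ₑ * ‖heatKernel d k (z.2 * (t - z.1) ^ ε) y‖ₑ)
      (c := Real.toNNReal ((t - z.1) ^ e₀) * ‖h z.2‖₊) (ae_of_all _ fun x => ?_) q
    · rwa [ENNReal.smul_def, smul_eq_mul, ENNReal.coe_mul] at h1
    · rw [enorm_eq_self, enorm_eq_self, ENNReal.coe_mul, mul_assoc]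
      rfl
  refine (e1.trans (mul_le_mul_right (mul_le_mul_right hY _) _)).trans (le_of_eq ?_)
  rw [neg_mul, Real.mul_rpow hz2.le (Real.rpow_nonneg hτ.le _), ← Real.rpow_mul hτ.le,
    sub_eq_add_neg e₀, Real.rpow_add hτ, mul_neg, ENNReal.ofReal_mul (by positivity),
    ENNReal.ofReal_mul (by positivity)]
  ring

/-- The `L^r(L^p) → L^q` estimate for the majorant. -/
lemma exists_eLpNorm_duhamelMajorant_le (hk : 0 < k) (hm : Measurable h)
    {a p q r : ℝ≥0∞} (ha : 1 ≤ a) (hp : 1 ≤ p) (hp' : p ≠ ∞) (haq : a ≤ q)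
    (hapq : a⁻¹ + p⁻¹ = 1 + q⁻¹) (hr : 1 ≤ r) {c : ℝ} (hc : c = d / (4 * k) * (1 - (1 / a).toReal))
    (hi : IntegrableOn (fun l => ((l ^ (-c) : ℝ) : ℂ) * h l) (Ioi 0))
    (he : 0 < e₀ - ε * c + 1 - (1 / r).toReal) :
    ∃ C : ℝ≥0, ∀ F : ℝ → Space d → ℂ, Measurable (Function.uncurry F) → ∀ t, 0 < t →
      eLpNorm (fun s => eLpNorm (F s) p volume) r (volume.restrict (Ioo 0 t)) < ∞ →
      eLpNorm (duhamelMajorant k h ε e₀ F t) q volume ≤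
        C * ENNReal.ofReal (t ^ (e₀ - ε * c + 1 - (1 / r).toReal)) *
          eLpNorm (fun s => eLpNorm (F s) p volume) r (volume.restrict (Ioo 0 t)) := by
  obtain ⟨C, hC⟩ := exists_lintegral_sub_rpow_mul_le hr he
  -- The `l`-factor is the moment of `h` of order `c`; it enters only the constant.
  have hL : ∫⁻ l in Ioi 0, ENNReal.ofReal (l ^ (-c)) * ‖h l‖ₑ * eLpNorm (heatBase d k) a < ∞ := by
    rw [lintegral_mul_const' _ _ (eLpNorm_heatBase_lt_top hk a).ne]
    refine ENNReal.mul_lt_top ?_ (eLpNorm_heatBase_lt_top hk a)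
    refine lt_of_le_of_lt (le_of_eq ?_) hi.2
    refine setLIntegral_congr_fun measurableSet_Ioi fun l hl => ?_
    have hl0 : (0 : ℝ) < l := hl
    simp only
    rw [enorm_mul, enorm_ofReal_rpow hl0.le]
  obtain ⟨L, hL'⟩ := ENNReal.lt_iff_exists_coe.1 hL
  refine ⟨C * L, fun F hF t ht hfin => ?_⟩
  have hN := measurable_eLpNorm_section hF (zero_lt_one.trans_le hp).ne' hp'
  have hM1 : Measurable fun s => ENNReal.ofReal ((t - s) ^ (e₀ - ε * c)) *
      eLpNorm (F s) p volume := by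
    refine Measurable.mul ?_ hN
    fun_prop
  have hM2 : Measurable fun l => ENNReal.ofReal (l ^ (-c)) * ‖h l‖ₑ * eLpNorm (heatBase d k) a := by
    refine Measurable.mul_const (Measurable.mul ?_ hm.enorm) _
    fun_prop
  have hae : ∀ᵐ z ∂(volume.restrict (Ioo 0 t)).prod (volume.restrict (Ioi (0 : ℝ))),
      eLpNorm (majorantIntegrand k h ε e₀ F t z) q volume ≤
        (ENNReal.ofReal ((t - z.1) ^ (e₀ - ε * c)) * eLpNorm (F z.1) p volume) *
          (ENNReal.ofReal (z.2 ^ (-c)) * ‖h z.2‖ₑ * eLpNorm (heatBase d k) a) := by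
    have hz1 := Measure.quasiMeasurePreserving_fst (μ := volume.restrict (Ioo 0 t))
      (ν := volume.restrict (Ioi (0 : ℝ))) |>.ae (ae_restrict_mem measurableSet_Ioo)
    have hz2 := Measure.quasiMeasurePreserving_snd (μ := volume.restrict (Ioo 0 t))
      (ν := volume.restrict (Ioi (0 : ℝ))) |>.ae (ae_restrict_mem measurableSet_Ioi)
    filter_upwards [hz1, hz2] with z h1 h2
    rw [hc]
    exact eLpNorm_majorantIntegrand_le hk hF ha hp haq hapq h1.2 h2
  have hMm : Measurable fun z : ℝ × ℝ => (ENNReal.ofReal ((t - z.1) ^ (e₀ - ε * c)) *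
      eLpNorm (F z.1) p volume) *
        (ENNReal.ofReal (z.2 ^ (-c)) * ‖h z.2‖ₑ * eLpNorm (heatBase d k) a) :=
    (hM1.comp measurable_fst).mul (hM2.comp measurable_snd)
  have hM := eLpNorm_lintegral_le (μ := (volume : Measure (Space d)))
    (κ := (volume.restrict (Ioo 0 t)).prod (volume.restrict (Ioi 0)))
    (measurable_majorantIntegrand (ε := ε) (e₀ := e₀) hk hm hF t) hMm (ha.trans haq) hae
  refine hM.trans ?_
  rw [lintegral_prod_mul hM1.aemeasurable hM2.aemeasurable, hL'.1]
  refine (mul_le_mul_left (hC t ht _ hN hfin) _).trans (le_of_eq ?_)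
  push_cast
  ring

lemma duhamelMajorant_eq (hk : 0 < k) (hm : Measurable h) (hF : Measurable (Function.uncurry F))
    (t : ℝ) (x : Space d) :
    duhamelMajorant k h ε e₀ F t x = ∫⁻ s in Ioo 0 t, ENNReal.ofReal ((t - s) ^ e₀) *
      ∫⁻ l in Ioi 0, ‖h l‖ₑ *
        ∫⁻ y, ‖F s (x - y)‖ₑ * ‖heatKernel d k (l * (t - s) ^ ε) y‖ₑ := by
  have hmx : Measurable fun z => majorantIntegrand k h ε e₀ F t z x :=
    (measurable_majorantIntegrand hk hm hF t).of_uncurry_right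
  rw [duhamelMajorant, lintegral_prod _ hmx.aemeasurable]
  refine lintegral_congr fun s => ?_
  rw [← lintegral_const_mul' _ _ ENNReal.ofReal_ne_top]
  rfl

lemma lintegral_heatSuperposition_mul_le (hk : 0 < k) (hm : Measurable h) {g : Space d → ℂ}
    (hg : Measurable g) (σ : ℝ) (x : Space d) :
    ∫⁻ y, ‖heatSuperposition d k h σ y * g (x - y)‖ₑ ≤
      ∫⁻ l in Ioi 0, ‖h l‖ₑ * ∫⁻ y, ‖g (x - y)‖ₑ * ‖heatKernel d k (l * σ) y‖ₑ := by
  have hgx : Measurable fun y => g (x - y) := hg.comp (measurable_const.sub measurable_id)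
  have hM := measurable_mul_heatKernel (d := d) hk hm σ
  calc ∫⁻ y, ‖heatSuperposition d k h σ y * g (x - y)‖ₑ
      ≤ ∫⁻ y, ∫⁻ l in Ioi 0, ‖h l * heatKernel d k (l * σ) y‖ₑ * ‖g (x - y)‖ₑ := by
        refine lintegral_mono fun y => ?_
        rw [enorm_mul, lintegral_mul_const' _ _ enorm_ne_top]
        exact mul_le_mul_left (enorm_integral_le_lintegral_enorm _) _
    _ = ∫⁻ l in Ioi 0, ∫⁻ y, ‖h l * heatKernel d k (l * σ) y‖ₑ * ‖g (x - y)‖ₑ := by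
        refine (lintegral_lintegral_swap ?_).symm
        exact (hM.enorm.mul (hgx.comp measurable_snd).enorm).aemeasurable
    _ = _ := by
        refine lintegral_congr fun l => ?_
        rw [← lintegral_const_mul' _ _ enorm_ne_top]
        refine lintegral_congr fun y => ?_
        rw [enorm_mul]
        ring

/-- Duhamel's integrand with the kernel `heatSuperposition d k h ((t-s)^ε)`. -/
noncomputable def heatDuhamelIntegrand (k : ℕ) (h : ℝ → ℂ) (ε e₀ : ℝ) (F : ℝ → Space d → ℂ) (t : ℝ)
    (x : Space d) (s : ℝ) : ℂ :=
  (((t - s) ^ e₀ : ℝ) : ℂ) * ∫ y, heatSuperposition d k h ((t - s) ^ ε) y * F s (x - y)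

lemma stronglyMeasurable_heatDuhamelIntegrand (hk : 0 < k) (hm : Measurable h)
    (hF : Measurable (Function.uncurry F)) (t : ℝ) :
    StronglyMeasurable fun w : Space d × ℝ => heatDuhamelIntegrand k h ε e₀ F t w.1 w.2 := by
  have h1 : Measurable fun w : ((Space d × ℝ) × Space d) × ℝ => h w.2 *
      heatKernel d k (w.2 * (t - w.1.1.2) ^ ε) w.1.2 := by
    have h2 : Measurable fun w : ((Space d × ℝ) × Space d) × ℝ =>
        (w.2 * (t - w.1.1.2) ^ ε, w.1.2) := by fun_prop
    exact (hm.comp measurable_snd).mul ((measurable_heatKernel hk).comp h2)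
  have h3 : StronglyMeasurable fun w : (Space d × ℝ) × Space d =>
      heatSuperposition d k h ((t - w.1.2) ^ ε) w.2 :=
    h1.stronglyMeasurable.integral_prod_right' (ν := volume.restrict (Ioi (0 : ℝ)))
  have h4 : Measurable fun w : (Space d × ℝ) × Space d => F w.1.2 (w.1.1 - w.2) :=
    hF.comp (show Measurable fun w : (Space d × ℝ) × Space d => (w.1.2, w.1.1 - w.2) by fun_prop)
  have h5 := (h3.mul h4.stronglyMeasurable).integral_prod_right' (ν := (volume : Measure (Space d)))
  have h6 : Measurable fun w : Space d × ℝ => (((t - w.2) ^ e₀ : ℝ) : ℂ) := by fun_prop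
  exact h6.stronglyMeasurable.mul h5

lemma lintegral_heatDuhamelIntegrand_le (hk : 0 < k) (hm : Measurable h)
    (hF : Measurable (Function.uncurry F)) (t : ℝ) (x : Space d) :
    ∫⁻ s in Ioo 0 t, ‖heatDuhamelIntegrand k h ε e₀ F t x s‖ₑ ≤ duhamelMajorant k h ε e₀ F t x := by
  rw [duhamelMajorant_eq hk hm hF]
  refine setLIntegral_mono' measurableSet_Ioo fun s hs => ?_
  rw [heatDuhamelIntegrand, enorm_mul, enorm_ofReal_rpow (sub_nonneg.2 hs.2.le)]
  exact mul_le_mul_right ((enorm_integral_le_lintegral_enorm _).trans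
    (lintegral_heatSuperposition_mul_le hk hm (hF.comp measurable_prodMk_left) _ x)) _

/-- A finite integral over `s` has an almost everywhere finite integrand, and the weight
`(t-s)^{e₀}` is positive, so the spatial integral is finite too. -/
lemma ae_integrable_heatSuperposition_mul (hk : 0 < k) (hm : Measurable h)
    (hF : Measurable (Function.uncurry F)) {t : ℝ} {x : Space d}
    (hx : duhamelMajorant k h ε e₀ F t x < ∞) :
    ∀ᵐ s ∂(volume.restrict (Ioo 0 t)),
      Integrable fun y => heatSuperposition d k h ((t - s) ^ ε) y * F s (x - y) := by
  rw [duhamelMajorant_eq hk hm hF] at hx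
  have hmeas : Measurable fun s => ENNReal.ofReal ((t - s) ^ e₀) * ∫⁻ l in Ioi 0, ‖h l‖ₑ *
      ∫⁻ y, ‖F s (x - y)‖ₑ * ‖heatKernel d k (l * (t - s) ^ ε) y‖ₑ := by
    have h1 := (measurable_enorm_mul_heatKernel hk hF t ε).lintegral_prod_right' (ν := volume)
    have h2 : Measurable fun z : ℝ × ℝ => ((z, x) : (ℝ × ℝ) × Space d) := measurable_prodMk_right
    have h3 : Measurable fun z : ℝ × ℝ => ‖h z.2‖ₑ := (hm.comp measurable_snd).enorm
    refine Measurable.mul (by fun_prop) ?_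
    exact (h3.mul (h1.comp h2)).lintegral_prod_right'
  filter_upwards [ae_lt_top hmeas hx.ne, ae_restrict_mem measurableSet_Ioo] with s hs hst
  have hτ : 0 < t - s := sub_pos.2 hst.2
  have hFs : Measurable (F s) := hF.comp measurable_prodMk_left
  have hw : ENNReal.ofReal ((t - s) ^ e₀) ≠ 0 :=
    (ENNReal.ofReal_pos.2 (Real.rpow_pos_of_pos hτ _)).ne'
  refine ⟨?_, (lintegral_heatSuperposition_mul_le hk hm hFs _ x).trans_lt
    (ENNReal.lt_top_of_mul_ne_top_right hs.ne hw)⟩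
  have hK : StronglyMeasurable (heatSuperposition d k h ((t - s) ^ ε)) :=
    (measurable_mul_heatKernel (d := d) hk hm _).stronglyMeasurable.integral_prod_left'
  exact (hK.mul (hFs.comp (measurable_const.sub measurable_id)).stronglyMeasurable).aestronglyMeasurable

end Majorant

/-! ### Application to `W` and the Duhamel estimate -/

section Final

variable {d : ℕ}

/-- Turning by `π` towards the negative axis gives `|θ| = π ||μ-ν| - 1|`. The two assumptions
together say that this is less than `π(1 - α/2)`. -/
lemma exists_angle {α μ ν : ℝ} (hlow : α / 2 < |μ - ν|) (hupp : |μ - ν| < 2 - α / 2) :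
    ∃ θ : ℝ, |θ| < Real.pi - α * (Real.pi / 2) ∧
      Complex.exp (((ν - μ) * Real.pi : ℝ) * Complex.I) = -Complex.exp (θ * Complex.I) := by
  have hπ := Real.pi_pos
  rcases le_total (μ - ν) 0 with h0 | h0
  · rw [abs_of_nonpos h0] at hlow hupp
    refine ⟨(ν - μ - 1) * Real.pi, ?_, ?_⟩
    · rw [abs_lt]
      constructor <;> nlinarith
    · have : (((ν - μ - 1) * Real.pi : ℝ) : ℂ) * Complex.I =
          ((ν - μ) * Real.pi : ℝ) * Complex.I - Real.pi * Complex.I := by push_cast; ring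
      rw [this, Complex.exp_sub, Complex.exp_pi_mul_I]
      ring
  · rw [abs_of_nonneg h0] at hlow hupp
    refine ⟨(ν - μ + 1) * Real.pi, ?_, ?_⟩
    · rw [abs_lt]
      constructor <;> nlinarith
    · have : (((ν - μ + 1) * Real.pi : ℝ) : ℂ) * Complex.I =
          ((ν - μ) * Real.pi : ℝ) * Complex.I + Real.pi * Complex.I := by push_cast; ring
      rw [this, Complex.exp_add, Complex.exp_pi_mul_I]
      ring

/-- The kernel `W` is a superposition of heat kernels of order `4k`, for `k` large, whose density
is integrable against the weights `l^{-κ}` with `0 ≤ κ < β/(4k)`. -/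
lemma exists_kernelW_ae_eq_heatSuperposition (hd : 0 < d) {α β μ ν : ℝ} (hα : 0 < α) (hβ : 0 < β)
    (hlow : α / 2 < |μ - ν|) (hupp : |μ - ν| < 2 - α / 2) :
    ∃ k : ℕ, 0 < k ∧ ∃ h : ℝ → ℂ, Measurable h ∧
      (∀ κ, 0 ≤ κ → κ < β / (4 * k) →
        IntegrableOn (fun l => ((l ^ (-κ) : ℝ) : ℂ) * h l) (Ioi 0)) ∧
      ∀ t, 0 < t → IsInverseFourier (d := d) (symbolW α β μ ν t) (kernelW α β μ ν t) ∧
        kernelW (d := d) α β μ ν t =ᵐ[volume]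
          heatSuperposition d k h (t ^ (α / (β / (4 * k)))) := by
  obtain ⟨θ, hθ, hexp⟩ := exists_angle hlow hupp
  obtain ⟨γ₀, hγ₀, H⟩ := exists_laplace_mittagLeffler hα hθ
  -- A large `k` puts `γ = β/(4k)` below the threshold `γ₀`. With `ρ = t^{α/γ}|ξ|^{4k}` one has `ρ^γ
  -- = t^α|ξ|^β`.
  obtain ⟨k, hk⟩ := exists_nat_gt (β / γ₀)
  have hk0' : (0 : ℝ) < k := (div_pos hβ hγ₀).trans hk
  have hk0 : 0 < k := by exact_mod_cast hk0'
  have hγ : 0 < β / (4 * k) := by positivity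
  have hγ' : β / (4 * k) < γ₀ := by
    rw [div_lt_iff₀ hγ₀] at hk
    rw [div_lt_iff₀ (by positivity)]
    nlinarith
  obtain ⟨h, hm, hi, hL⟩ := H _ hγ hγ'
  refine ⟨k, hk0, h, hm, hi, fun t ht => ?_⟩
  have hi0 : IntegrableOn h (Ioi 0) := by simpa using hi 0 le_rfl hγ
  have hσ : 0 < t ^ (α / (β / (4 * k))) := Real.rpow_pos_of_pos ht _
  have : Nonempty (Fin d) := ⟨⟨0, hd⟩⟩
  -- The Laplace formula is available only for `ρ > 0`; the origin is a null set as `d > 0`.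
  have hne : ∀ᵐ ξ : Space d, ξ ≠ 0 := Measure.ae_ne volume 0
  have hK := isInverseFourier_heatSuperposition (d := d) hk0 hm hi0 hσ
    (m := symbolW α β μ ν t) (by
      filter_upwards [hne] with ξ hξ
      have hξ0 : 0 < ‖ξ‖ := norm_pos_iff.2 hξ
      rw [← hL _ (mul_pos hσ (pow_pos hξ0 _)), symbolW, hexp, neg_mul,
        Real.mul_rpow hσ.le (by positivity), ← Real.rpow_mul ht.le, div_mul_cancel₀ _ hγ.ne',
        ← Real.rpow_natCast, ← Real.rpow_mul hξ0.le]
      push_cast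
      rw [mul_div_cancel₀ _ (by positivity : (4 * k : ℝ) ≠ 0)])
  exact ⟨isInverseFourier_kernelW hK, (isInverseFourier_kernelW hK).ae_eq hK⟩

/-- The exponent is given by `1/a = 1 - (1/p - 1/q)`; `a ≤ q` amounts to `1/p ≤ 1`. -/
lemma exists_young_exponent {p q : ℝ≥0∞} (hp : 1 ≤ p) (hpq : p ≤ q) :
    ∃ a : ℝ≥0∞, 1 ≤ a ∧ a ≤ q ∧ a⁻¹ + p⁻¹ = 1 + q⁻¹ ∧
      1 - (1 / a).toReal = (1 / p).toReal - (1 / q).toReal := by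
  have hp1 : p⁻¹ ≤ 1 := ENNReal.inv_le_one.2 hp
  have hqp : q⁻¹ ≤ p⁻¹ := ENNReal.inv_le_inv.2 hpq
  have hx : p⁻¹ - q⁻¹ ≤ 1 := tsub_le_self.trans hp1
  have hxt : p⁻¹ - q⁻¹ ≠ ∞ := ne_top_of_le_ne_top ENNReal.one_ne_top hx
  have hpt : p⁻¹ ≠ ∞ := ne_top_of_le_ne_top ENNReal.one_ne_top hp1
  refine ⟨(1 - (p⁻¹ - q⁻¹))⁻¹, ?_, ?_, ?_, ?_⟩
  · rw [ENNReal.one_le_inv]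
    exact tsub_le_self
  · rw [ENNReal.inv_le_iff_inv_le]
    refine ENNReal.le_sub_of_add_le_left hxt ?_
    rwa [tsub_add_cancel_of_le hqp]
  · rw [inv_inv]
    nth_rewrite 2 [← tsub_add_cancel_of_le hqp]
    rw [← add_assoc, tsub_add_cancel_of_le hx]
  · rw [one_div, one_div, one_div, inv_inv, ENNReal.toReal_sub_of_le hx ENNReal.one_ne_top,
      ENNReal.toReal_sub_of_le hqp hpt, ENNReal.toReal_one]
    ring

lemma convolution_integrand_ae_eq {K K' g g' : Space d → ℂ} (hK : K =ᵐ[volume] K')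
    (hg : g =ᵐ[volume] g') (x : Space d) :
    (fun y => ContinuousLinearMap.mul ℂ ℂ (K y) (g (x - y))) =ᵐ[volume]
      fun y => K' y * g' (x - y) := by
  have h2 := (quasiMeasurePreserving_sub_left (volume : Measure (Space d)) x).ae hg
  filter_upwards [hK, h2] with y h3 h4
  rw [ContinuousLinearMap.mul_apply', h3, h4]

/-- The conclusions about `duhamel`, for the kernel written as a superposition of heat kernels and
the inhomogeneity replaced by a jointly measurable one. -/
lemma duhamel_of_duhamelMajorant_lt_top {α β μ ν ε : ℝ} {k : ℕ} (hk : 0 < k) {h : ℝ → ℂ}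
    (hm : Measurable h)
    (hW : ∀ t, 0 < t → kernelW (d := d) α β μ ν t =ᵐ[volume] heatSuperposition d k h (t ^ ε))
    {F F' : ℝ → Space d → ℂ} (hF' : Measurable (Function.uncurry F')) {t : ℝ} (ht : 0 < t)
    (hFF' : ∀ᵐ s ∂(volume.restrict (Ioo 0 t)), F s =ᵐ[volume] F' s) :
    (∀ x, duhamelMajorant k h ε (α - 1) F' t x < ∞ →
      (∀ᵐ s ∂(volume.restrict (Ioo 0 t)), ConvolutionExistsAt (kernelW α β μ ν (t - s)) (F s) x
        (ContinuousLinearMap.mul ℂ ℂ) volume) ∧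
      IntervalIntegrable (duhamelIntegrand α β μ ν F t x) volume 0 t) ∧
    StronglyMeasurable (duhamel α β μ ν F t) ∧
    ∀ x, ‖duhamel α β μ ν F t x‖ₑ ≤ duhamelMajorant k h ε (α - 1) F' t x := by
  have key : ∀ x, ∀ᵐ s ∂(volume.restrict (Ioo 0 t)),
      (fun y => ContinuousLinearMap.mul ℂ ℂ (kernelW α β μ ν (t - s) y) (F s (x - y))) =ᵐ[volume]
        fun y => heatSuperposition d k h ((t - s) ^ ε) y * F' s (x - y) := by
    intro x
    filter_upwards [hFF', ae_restrict_mem measurableSet_Ioo] with s hs hst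
    exact convolution_integrand_ae_eq (hW _ (sub_pos.2 hst.2)) hs x
  have hint : ∀ x, duhamelIntegrand α β μ ν F t x =ᵐ[volume.restrict (Ioo 0 t)]
      heatDuhamelIntegrand k h ε (α - 1) F' t x := by
    intro x
    filter_upwards [key x] with s hs
    rw [duhamelIntegrand, heatDuhamelIntegrand, convW, convolution, integral_congr_ae hs]
  have hdu : duhamel α β μ ν F t = fun x => Complex.exp (-((μ * Real.pi : ℝ) * Complex.I)) *
      ∫ s in Ioo 0 t, heatDuhamelIntegrand k h ε (α - 1) F' t x s := by
    funext x
    rw [duhamel, intervalIntegral.integral_of_le ht.le, integral_Ioc_eq_integral_Ioo,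
      integral_congr_ae (hint x)]
  have hmeas := stronglyMeasurable_heatDuhamelIntegrand (ε := ε) (e₀ := α - 1) hk hm hF' t
  refine ⟨fun x hx => ⟨?_, ?_⟩, ?_, fun x => ?_⟩
  · filter_upwards [key x, ae_integrable_heatSuperposition_mul hk hm hF' hx] with s h1 h2
    exact h2.congr h1.symm
  · rw [intervalIntegrable_iff_integrableOn_Ioo_of_le ht.le]
    have h1 : IntegrableOn (heatDuhamelIntegrand k h ε (α - 1) F' t x) (Ioo 0 t) :=
      ⟨(hmeas.comp_measurable measurable_prodMk_left).aestronglyMeasurable,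
        (lintegral_heatDuhamelIntegrand_le hk hm hF' t x).trans_lt hx⟩
    exact h1.congr (hint x).symm
  · rw [hdu]
    exact stronglyMeasurable_const.mul hmeas.integral_prod_right'
  · rw [hdu]
    have hone : ‖Complex.exp (-((μ * Real.pi : ℝ) * Complex.I))‖ₑ = 1 := by
      rw [← ofReal_norm, ← neg_mul, ← Complex.ofReal_neg, Complex.norm_exp_ofReal_mul_I,
        ENNReal.ofReal_one]
    simp only [enorm_mul, hone, one_mul]
    exact (enorm_integral_le_lintegral_enorm _).trans
      (lintegral_heatDuhamelIntegrand_le hk hm hF' t x)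

end Final

end FracDuhamel

theorem theorem5 (d : ℕ) (hd : 0 < d) (α β μ ν : ℝ) (hα : 0 < α) (hα2 : α < 2) (hβ : 0 < β)
    (hμ : μ ∈ Set.Ioc (-1 : ℝ) 1) (hν : ν ∈ Set.Ioc (-1 : ℝ) 1)
    (hlow : α / 2 < |μ - ν|) (hupp : |μ - ν| < 2 - α / 2)
    (p q r : ℝ≥0∞) (hp : 1 ≤ p) (hpq : p < q) (hr : 1 ≤ r) (hαr : ENNReal.ofReal (1 / α) < r)
    (hgap : (1 / p).toReal - (1 / q).toReal < β / d * (1 - 1 / α * (1 / r).toReal)) :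
    (∀ t : ℝ, 0 < t → FracDuhamel.IsInverseFourier (d := d)
        (FracDuhamel.symbolW α β μ ν t) (FracDuhamel.kernelW α β μ ν t)) ∧
    ∃ C : ℝ≥0, ∀ F : ℝ → FracDuhamel.Space d → ℂ,
      AEStronglyMeasurable (Function.uncurry F) ((volume.restrict (Set.Ici (0 : ℝ))).prod volume) →
      FracDuhamel.mixedNorm r p F < ∞ →
      ∀ t : ℝ, 0 < t →
        (∀ᵐ x : FracDuhamel.Space d,
          (∀ᵐ s ∂(volume.restrict (Set.Ioo 0 t)),
            ConvolutionExistsAt (FracDuhamel.kernelW α β μ ν (t - s)) (F s) x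
              (ContinuousLinearMap.mul ℂ ℂ) volume) ∧
          IntervalIntegrable (FracDuhamel.duhamelIntegrand α β μ ν F t x) volume 0 t) ∧
        AEStronglyMeasurable (FracDuhamel.duhamel α β μ ν F t) volume ∧
        eLpNorm (FracDuhamel.duhamel α β μ ν F t) q volume ≤
          C * ENNReal.ofReal (t ^ (α / β * d * (β / d - ((1 / p).toReal - (1 / q).toReal))
              - (1 / r).toReal)) * FracDuhamel.mixedNorm r p F := by
  open FracDuhamel in
  obtain ⟨k, hk, h, hm, hi, hW⟩ :=
    exists_kernelW_ae_eq_heatSuperposition (d := d) hd hα hβ hlow hupp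
  refine ⟨fun t ht => (hW t ht).1, ?_⟩
  obtain ⟨a, ha, haq, hapq, haδ⟩ := exists_young_exponent hp hpq.le
  have hp' : p ≠ ∞ := (hpq.trans_le le_top).ne
  have hd' : (0 : ℝ) < d := by exact_mod_cast hd
  have hk' : (0 : ℝ) < k := by exact_mod_cast hk
  set δ := (1 / p).toReal - (1 / q).toReal with hδ
  have hδ0 : 0 ≤ δ := by
    rw [hδ, sub_nonneg, one_div, one_div]
    exact ENNReal.toReal_mono (ENNReal.inv_ne_top.2 (zero_lt_one.trans_le hp).ne')
      (ENNReal.inv_le_inv.2 hpq.le)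
  have hr0 : 0 ≤ (1 / r).toReal := ENNReal.toReal_nonneg
  -- The power of `t` collects `α - 1` from Duhamel's weight, the scaling of the heat kernel, and `1
  -- - 1/r` from Hölder in time. The auxiliary `k` cancels.
  have hexp : α - 1 - α / (β / (4 * k)) * (d / (4 * k) * (1 - (1 / a).toReal)) + 1 -
      (1 / r).toReal = α / β * d * (β / d - δ) - (1 / r).toReal := by
    rw [haδ]; field_simp; ring
  -- This puts the required moment order `dδ/(4k)` below `β/(4k)`.
  have hδβ : d * δ < β := by
    have h1 : β / d * (1 - 1 / α * (1 / r).toReal) ≤ β / d := by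
      refine mul_le_of_le_one_right (by positivity) ?_
      have : 0 ≤ 1 / α * (1 / r).toReal := by positivity
      linarith
    have := hgap.trans_le h1
    rwa [lt_div_iff₀ hd', mul_comm] at this
  -- The gap condition multiplied by `αd/β`: it expresses exactly the convergence of the time
  -- integral.
  have hpos : 0 < α / β * d * (β / d - δ) - (1 / r).toReal := by
    have h1 := mul_lt_mul_of_pos_left hgap (show 0 < α / β * d by positivity)
    have h2 : α / β * d * (β / d * (1 - 1 / α * (1 / r).toReal)) = α - (1 / r).toReal := by
      field_simp
    have h3 : α / β * d * (β / d) = α := by field_simp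
    rw [mul_sub, h3]
    linarith
  obtain ⟨C, hC⟩ := exists_eLpNorm_duhamelMajorant_le (d := d) (ε := α / (β / (4 * k)))
    (e₀ := α - 1) hk hm ha hp hp' haq hapq hr rfl
    (hi _ (by rw [haδ]; positivity) (by
      rw [haδ, div_mul_eq_mul_div]
      exact div_lt_div_of_pos_right hδβ (by positivity))) (by rw [hexp]; exact hpos)
  rw [hexp] at hC
  refine ⟨C, fun F hF hFfin t ht => ?_⟩
  -- A jointly measurable representative. For almost every `s` its slice agrees almost everywhere
  -- with that of `F`, so neither the mixed norm nor the convolutions change.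
  set F' : ℝ → Space d → ℂ := fun s x => hF.mk _ (s, x) with hF'
  have hF'm : Measurable (Function.uncurry F') := hF.stronglyMeasurable_mk.measurable
  have hIoo : volume.restrict (Ioo 0 t) ≤ volume.restrict (Ici (0 : ℝ)) :=
    Measure.restrict_mono (fun s hs => hs.1.le) le_rfl
  have hFF'Ici : ∀ᵐ s ∂(volume.restrict (Ici (0 : ℝ))), F s =ᵐ[volume] F' s :=
    Measure.ae_ae_of_ae_prod hF.ae_eq_mk
  have hnorm : eLpNorm (fun s => eLpNorm (F' s) p volume) r (volume.restrict (Ioo 0 t)) ≤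
      mixedNorm r p F := by
    refine (eLpNorm_mono_measure _ hIoo).trans (le_of_eq (eLpNorm_congr_ae ?_))
    filter_upwards [hFF'Ici] with s hs
    exact (eLpNorm_congr_ae hs).symm
  obtain ⟨h1, h2, h3⟩ := duhamel_of_duhamelMajorant_lt_top hk hm (fun t ht => (hW t ht).2) hF'm ht
    (ae_mono hIoo hFF'Ici)
  have hmaj := (hC F' hF'm t ht (hnorm.trans_lt hFfin)).trans (mul_le_mul_right hnorm _)
  have hfin : ∀ᵐ x, duhamelMajorant k h (α / (β / (4 * k))) (α - 1) F' t x < ∞ :=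
    ae_lt_top_of_eLpNorm_lt_top (measurable_duhamelMajorant hk hm hF'm t)
      ((zero_lt_one.trans_le hp).trans hpq).ne' (hmaj.trans_lt (ENNReal.mul_lt_top
        (ENNReal.mul_lt_top ENNReal.coe_lt_top ENNReal.ofReal_lt_top) hFfin))
  refine ⟨hfin.mono h1, h2.aestronglyMeasurable, le_trans ?_ hmaj⟩
  exact eLpNorm_mono_enorm fun x => by rw [enorm_eq_self]; exact h3 x
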